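/- Let $\mathbb V=\mathbb R^3$ and let $\mathbb K$ be the space of skew-symmetric $3\times3$ real matrices with the Frobenius inner product. Let $\mathcal T_h$ be a triangulation of $\Omega\subset\mathbb R^3$ by tetrahedra: a finite simplicial complex in which every simplex is contained in a tetrahedron, with $\Omega$ the interior of the union of its simplices. Let $r\ge 0$ be an integer. For an inner product space $\mathbb X$, let $\Lambda^k(\Omega;\mathbb X)$ be the $\mathbb X$-valued differential $k$-forms on $\Omega$ that are smooth up to the boundary, let $H\Lambda^k(\Omega;\mathbb X)$ be the square integrable $k$-forms with square integrable weak exterior derivative, and let $$\mathcal P_s^+\Lambda^k(\mathcal T_h;\mathbb X)=\{\omega\in H\Lambda^k(\Omega;\mathbb X): \omega|_T\in \mathcal P_s\Lambda^k(T;\mathbb X)+\kappa\mathcal P_s\Lambda^{k+1}(T;\mathbb X)\text{ for every tetrahedron }T\in\mathcal T_h\},$$ where $\mathcal P_s\Lambda^k$ denotes the $k$-forms with polynomial coefficients of degree at most $s$ (only $0$ if $s<0$) and $(\kappa\omega)_x(v_1,\dots,v_k)=\omega_x(x,v_1,\dots,v_k)$. The canonical degrees of freedom of this space are $$\int_f\omega\wedge\zeta,\qquad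 \zeta\in\mathcal P_{s-d+k}\Lambda^{d-k}(f;\mathbb X),$$ for all $d$-dimensional simplices $f$ of $\mathcal T_h$, $k\le d\le 3$; the wedge product uses the inner product of $\mathbb X$, and for piecewise forms the trace on $f$ is taken from every tetrahedron containing $f$. The canonical projection of a form is the element of $\mathcal P_s^+\Lambda^k(\mathcal T_h;\mathbb X)$ with the same degrees of freedom. Put $K_xv=xv^T-vx^T\in\mathbb K$ for $x,v\in\mathbb V$, and for a $\mathbb V$-valued $1$-form $\omega$ put $(S_1\omega)(v_1,v_2)=K_{v_1}[\omega(v_2)]-K_{v_2}[\omega(v_1)]$, a $\mathbb K$-valued $2$-form. Let $$\tilde\Lambda^1_h(\mathbb V)=\mathcal P^+_{r+1}\Lambda^1(\mathcal T_h;\mathbb V),\qquad \Lambda^2_h(\mathbb K)=\mathcal P^+_r\Lambda^2(\mathcal T_h;\mathbb K),$$ with canonical projections $\tilde\Pi^1_h$ and $\Pi^2_h$, and let $S_{1,h}=\Pi^2_hS_1:\tilde\Lambda^1_h(\mathbb V)\to\Lambda^2_h(\mathbb K)$. Then $\tilde\Pi^1_h$ is well defined on $\Lambda^1(\Omega;\mathbb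 V)$, and $\Pi^2_h$ is well defined on $\Lambda^2(\Omega;\mathbb K)$ and on $S_1\tilde\Lambda^1_h(\mathbb V)$ (in each case there is exactly one element of the discrete space with the prescribed degrees of freedom); $$S_{1,h}\tilde\Pi^1_h\sigma=\Pi^2_hS_1\sigma\qquad\text{for all }\sigma\in\Lambda^1(\Omega;\mathbb V);$$ and $S_{1,h}$ maps $\tilde\Lambda^1_h(\mathbb V)$ onto $\Lambda^2_h(\mathbb K)$. -/

import Mathlib

open MeasureTheory

namespace ElasticityFEM

noncomputable section

/-! ### Vectors, matrices, alternating forms -/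

/-- The Euclidean space `𝕍 = ℝ³`. -/
abbrev V3 : Type := EuclideanSpace ℝ (Fin 3)

/-- The space of real `3 × 3` matrices (entries indexed by pairs), with the Frobenius inner
product. -/
abbrev Mat3 : Type := EuclideanSpace ℝ (Fin 3 × Fin 3)

/-- The space `𝕂` of skew-symmetric matrices, with the Frobenius inner product. -/
def Skew : Submodule ℝ Mat3 where
  carrier := {A | ∀ i j, A (i, j) = -A (j, i)}
  zero_mem' := by intro i j; simp
  add_mem' := by
    intro A B hA hB i j
    simp only [PiLp.add_apply, hA i j, hB i j]
    ring
  smul_mem' := by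
    intro c A hA i j
    simp only [PiLp.smul_apply, smul_eq_mul, hA i j]
    ring

/-- The matrix `x vᵀ`. -/
def outer (x v : V3) : Mat3 := WithLp.toLp 2 fun p => x p.1 * v p.2

/-- The skew-symmetric part `(A - Aᵀ) / 2`. -/
def skw (A : Mat3) : Skew :=
  ⟨WithLp.toLp 2 fun p => (A p - A p.swap) / 2, by
    intro i j
    simp only [Prod.swap_prod_mk]
    ring⟩

/-- The map `K_x v = 2 skw (x vᵀ)`, bundled as a continuous bilinear map of `(x, v)`. -/
def KMap : V3 →L[ℝ] V3 →L[ℝ] Skew :=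
  LinearMap.toContinuousLinearMap
    (LinearMap.toContinuousLinearMap.toLinearMap ∘ₗ
      LinearMap.mk₂ ℝ (fun x v : V3 => (2 : ℝ) • skw (outer x v))
        (by
          intro x y v; apply Subtype.ext; ext p
          simp only [skw, outer, SetLike.mk_smul_mk, AddMemClass.mk_add_mk, PiLp.add_apply,
            PiLp.smul_apply, smul_eq_mul, Prod.fst_swap, Prod.snd_swap]
          ring)
        (by
          intro c x v; apply Subtype.ext; ext p
          simp only [skw, outer, SetLike.mk_smul_mk, PiLp.smul_apply, smul_eq_mul,
            Prod.fst_swap, Prod.snd_swap]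
          ring)
        (by
          intro x v w; apply Subtype.ext; ext p
          simp only [skw, outer, SetLike.mk_smul_mk, AddMemClass.mk_add_mk, PiLp.add_apply,
            PiLp.smul_apply, smul_eq_mul, Prod.fst_swap, Prod.snd_swap]
          ring)
        (by
          intro c x v; apply Subtype.ext; ext p
          simp only [skw, outer, SetLike.mk_smul_mk, PiLp.smul_apply, smul_eq_mul,
            Prod.fst_swap, Prod.snd_swap]
          ring))

theorem KMap_apply (x v : V3) : KMap x v = (2 : ℝ) • skw (outer x v) := rfl

/-- `Alt k X`: alternating `k`-linear forms on `𝕍` with values in `X`. A differential `k`-form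
with values in `X` is a function `V3 → Alt k X`. -/
abbrev Alt (k : ℕ) (X : Type) [NormedAddCommGroup X] [NormedSpace ℝ X] : Type :=
  V3 [⋀^Fin k]→L[ℝ] X

/-- The algebraic operator `S_k`:
`(S ω)(v₀, …, v_k) = ∑ j, (-1)ʲ K_{v_j} [ω (v₀, …, v̂_j, …, v_k)]`; see `S_apply` for this
formula and `extDeriv_K_sub` for the identity `S = d K - K d`. -/
def S {k : ℕ} (ω : Alt k V3) : Alt (k + 1) Skew :=
  ContinuousAlternatingMap.alternatizeUncurryFin
    (LinearMap.toContinuousLinearMap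
      { toFun := fun v => (KMap v).compContinuousAlternatingMap ω
        map_add' := by intro v w; ext u : 1; simp
        map_smul' := by intro c v; ext u : 1; simp })

theorem S_apply {k : ℕ} (ω : Alt k V3) (v : Fin (k + 1) → V3) :
    S ω v = ∑ j : Fin (k + 1), (-1 : ℤ) ^ (j : ℕ) • KMap (v j) (ω (j.removeNth v)) := by
  simp [S, ContinuousAlternatingMap.alternatizeUncurryFin_apply]

/-- The operator `(K ω)_x (v₁, …, v_k) = K_x [ω_x (v₁, …, v_k)]` on forms. -/
def KForm {k : ℕ} (ω : V3 → Alt k V3) : V3 → Alt k Skew :=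
  fun x => (KMap x).compContinuousAlternatingMap (ω x)

/-- `S = d K - K d`, where `d` is the exterior derivative. -/
theorem extDeriv_K_sub {k : ℕ} (ω : V3 → Alt k V3) (x : V3) (h : DifferentiableAt ℝ ω x) :
    extDeriv (KForm ω) x - KForm (extDeriv ω) x = S (ω x) := by
  have key : ∀ y : V3, fderiv ℝ (KForm ω) x y =
      (KMap x).compContinuousAlternatingMap (fderiv ℝ ω x y) +
        (KMap y).compContinuousAlternatingMap (ω x) := by
    intro y
    let L : V3 →L[ℝ] (Alt k V3 →L[ℝ] Alt k Skew) :=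
      (ContinuousLinearMap.compContinuousAlternatingMapCLM ℝ V3 V3 Skew (Fin k)).comp KMap
    have h1 : HasFDerivAt (fun z => L z) L x := L.hasFDerivAt
    have h2 := HasFDerivAt.clm_apply (𝕜 := ℝ) (E := V3) (H := Alt k Skew) (G := Alt k V3)
      (c := fun z => L z) (c' := L) (u := ω) (u' := fderiv ℝ ω x) (x := x) h1 h.hasFDerivAt
    have h3 : fderiv ℝ (KForm ω) x = _ := h2.fderiv
    rw [h3]
    rfl
  ext v : 1
  rw [S_apply]
  simp only [extDeriv, KForm, ContinuousAlternatingMap.sub_apply,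
    ContinuousAlternatingMap.alternatizeUncurryFin_apply, key,
    ContinuousLinearMap.compContinuousAlternatingMap_coe, Function.comp_apply,
    ContinuousAlternatingMap.add_apply, map_sum, map_zsmul, smul_add, Finset.sum_add_distrib,
    add_sub_cancel_left]

/-- The wedge product of an `X`-valued `k`-form and an `X`-valued `l`-form, using the inner
product of `X`: the signed sum over the `(k, l)`-shuffles. -/
def wedge {k l : ℕ} {X : Type} [NormedAddCommGroup X] [InnerProductSpace ℝ X]
    (ω : Alt k X) (ζ : Alt l X) (v : Fin (k + l) → V3) : ℝ :=
  open Classical in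
  ∑ σ : Equiv.Perm (Fin (k + l)) with
      StrictMono (fun i : Fin k => σ (Fin.castAdd l i)) ∧
      StrictMono (fun j : Fin l => σ (Fin.natAdd k j)),
    ((Equiv.Perm.sign σ : ℤ) : ℝ) *
      inner ℝ (ω fun i => v (σ (Fin.castAdd l i))) (ζ fun j => v (σ (Fin.natAdd k j)))

/-! ### Polynomial forms -/

/-- Polynomial maps on `𝕍` of total degree at most `s` with values in a vector space `W`;
this is `{0}` when `s < 0`. -/
def PolyMap (s : ℤ) (W : Type) [AddCommGroup W] [Module ℝ W] : Submodule ℝ (V3 → W) :=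
  Submodule.span ℝ {f | ∃ (p : MvPolynomial (Fin 3) ℝ) (w : W),
    (∀ m ∈ p.support, (m.degree : ℤ) ≤ s) ∧
      f = fun x => (MvPolynomial.eval (fun i => x i) p) • w}

/-- The Koszul differential `(κ ω)_x (v₁, …, v_k) = ω_x (x, v₁, …, v_k)`. -/
def koszul (k : ℕ) (X : Type) [NormedAddCommGroup X] [NormedSpace ℝ X] :
    (V3 → Alt (k + 1) X) →ₗ[ℝ] (V3 → Alt k X) where
  toFun ω := fun x => (ω x).curryLeft x
  map_add' := by intro ω η; funext x; ext v : 1; simp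
  map_smul' := by intro c ω; funext x; ext v : 1; simp

/-- `P_r⁺ Λᵏ = P_r Λᵏ + κ P_r Λᵏ⁺¹`, with values in `X`. -/
def PPlus (r : ℤ) (k : ℕ) (X : Type) [NormedAddCommGroup X] [NormedSpace ℝ X] :
    Submodule ℝ (V3 → Alt k X) :=
  PolyMap r (Alt k X) ⊔ (PolyMap r (Alt (k + 1) X)).map (koszul k X)

/-! ### The space `H Λᵏ(Ω; X)` -/

/-- `η` is the exterior derivative of `u` on `Ω` in the sense of distributions: the formula
`dω (v₀, …, v_k) = ∑ j, (-1)ʲ ∂_{v_j} ω (v₀, …, v̂_j, …, v_k)` tested against smooth functions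
with compact support in `Ω`. -/
def IsWeakExtDeriv (Ω : Set V3) {k : ℕ} {X : Type} [NormedAddCommGroup X] [NormedSpace ℝ X]
    (u : V3 → Alt k X) (η : V3 → Alt (k + 1) X) : Prop :=
  ∀ φ : V3 → ℝ, ContDiff ℝ ((⊤ : ℕ∞) : WithTop ℕ∞) φ → HasCompactSupport φ → tsupport φ ⊆ Ω →
    ∀ v : Fin (k + 1) → V3,
      ∫ x in Ω, φ x • η x v =
        -∫ x in Ω, ∑ j : Fin (k + 1),
          ((-1 : ℝ) ^ (j : ℕ) * fderiv ℝ φ x (v j)) • u x (j.removeNth v)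

/-- `H Λᵏ(Ω; X)`: square integrable forms whose exterior derivative is square integrable. -/
def HForm (Ω : Set V3) (k : ℕ) (X : Type) [NormedAddCommGroup X] [NormedSpace ℝ X] :
    Set (V3 → Alt k X) :=
  {u | MemLp u 2 (volume.restrict Ω) ∧
    ∃ η : V3 → Alt (k + 1) X, MemLp η 2 (volume.restrict Ω) ∧ IsWeakExtDeriv Ω u η}

/-- `Λᵏ(Ω; X)`: `X`-valued `k`-forms that are smooth on `Ω` up to the boundary. -/
def SmoothForm (Ω : Set V3) (k : ℕ) (X : Type) [NormedAddCommGroup X] [NormedSpace ℝ X] :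
    Set (V3 → Alt k X) :=
  {σ | ContDiffOn ℝ ((⊤ : ℕ∞) : WithTop ℕ∞) σ (closure Ω)}

/-! ### Triangulations and finite element spaces -/

/-- A triangulation of `Ω ⊆ ℝ³` by tetrahedra: a finite simplicial complex, each simplex of
which lies in a tetrahedron of the complex, such that `Ω` is the interior of the union of the
simplices. -/
structure Triangulation (Ω : Set V3) where
  complex : Geometry.SimplicialComplex ℝ V3
  finite : complex.faces.Finite
  pure : ∀ s ∈ complex.faces, ∃ t ∈ complex.faces, s ⊆ t ∧ t.card = 4
  interior_space : interior complex.space = Ω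

variable {Ω : Set V3}

/-- The tetrahedra of a triangulation, as four-element sets of vertices. -/
def Triangulation.Tet (𝒯 : Triangulation Ω) : Type :=
  {T : Finset V3 // T ∈ 𝒯.complex.faces ∧ T.card = 4}

/-- A piecewise `k`-form: for every tetrahedron `T` a form, only the restriction of which to
`T` matters. -/
abbrev Triangulation.Piecewise (𝒯 : Triangulation Ω) (k : ℕ) (X : Type)
    [NormedAddCommGroup X] [NormedSpace ℝ X] : Type :=
  𝒯.Tet → V3 → Alt k X

/-- `P_r⁺ Λᵏ(𝒯; X)`: the forms `u ∈ H Λᵏ(Ω; X)` such that `u|_T ∈ P_r⁺ Λᵏ(T; X)` for each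
tetrahedron `T`. Such a form, modulo equality almost everywhere, is the same thing as the family
of the polynomial forms `ω T` with which it agrees on the tetrahedra `T`. -/
def Triangulation.PPlusSpace (𝒯 : Triangulation Ω) (r : ℤ) (k : ℕ) (X : Type)
    [NormedAddCommGroup X] [NormedSpace ℝ X] : Set (𝒯.Piecewise k X) :=
  {ω | (∀ T, ω T ∈ PPlus r k X) ∧
    ∃ u ∈ HForm Ω k X, ∀ T : 𝒯.Tet,
      u =ᵐ[volume.restrict (convexHull ℝ (T.1 : Set V3))] ω T}

/-- The simplex `{t ∈ ℝᵈ | t ≥ 0, ∑ t_i ≤ 1}`. -/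
def refSimplex (d : ℕ) : Set (Fin d → ℝ) :=
  {t | (∀ i, 0 ≤ t i) ∧ ∑ i, t i ≤ 1}

/-- The affine parametrization `t ↦ v₀ + ∑ t_i (v_{i+1} - v₀)` of the simplex with vertices
`v`. -/
def simplexParam {d : ℕ} (v : Fin (d + 1) → V3) (t : Fin d → ℝ) : V3 :=
  v 0 + ∑ i, t i • (v i.succ - v 0)

/-- The integral `∫_f ω ∧ ζ` over the `(k + l)`-dimensional simplex `f` with vertices
`v 0, …, v (k + l)`, oriented by this order of its vertices. -/
def simplexPairing {k l : ℕ} {X : Type} [NormedAddCommGroup X] [InnerProductSpace ℝ X]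
    (v : Fin (k + l + 1) → V3) (ω : V3 → Alt k X) (ζ : V3 → Alt l X) : ℝ :=
  ∫ t in refSimplex (k + l),
    wedge (ω (simplexParam v t)) (ζ (simplexParam v t)) fun i => v i.succ - v 0

/-- Equality of the canonical degrees of freedom of `P_r⁺ Λᵏ(𝒯; X)`: for every simplex `f` of
the mesh, of dimension `d = k + l` with `k ≤ d ≤ 3`, and every `ζ ∈ P_{r-d+k} Λ^{d-k}(f; X)`,
the integrals `∫_f ω ∧ ζ` and `∫_f η ∧ ζ` agree. As `ω` and `η` are given piecewise, this
is asked for the traces on `f` from every tetrahedron `T ⊇ f`. The elements of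
`P_s Λˡ(f; X)` are the restrictions to `f` of those of `P_s Λˡ(ℝ³; X)`; both orientations of `f`
occur, through the enumerations `v` of its vertices. -/
def Triangulation.SameDofs (𝒯 : Triangulation Ω) (r : ℤ) {k : ℕ} {X : Type}
    [NormedAddCommGroup X] [InnerProductSpace ℝ X] (ω η : 𝒯.Piecewise k X) : Prop :=
  ∀ l : ℕ, k + l ≤ 3 → ∀ T : 𝒯.Tet, ∀ v : Fin (k + l + 1) → V3,
    Function.Injective v → Set.range v ⊆ (T.1 : Set V3) →
      ∀ ζ ∈ PolyMap (r - l) (Alt l X),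
        simplexPairing v (ω T) ζ = simplexPairing v (η T) ζ

theorem Triangulation.zero_mem_PPlusSpace (𝒯 : Triangulation Ω) (r : ℤ) (k : ℕ) (X : Type)
    [NormedAddCommGroup X] [NormedSpace ℝ X] : 0 ∈ 𝒯.PPlusSpace r k X := by
  refine ⟨fun T => (PPlus r k X).zero_mem, fun _ => 0, ⟨MemLp.zero' (ε := Alt k X), fun _ => 0,
      MemLp.zero' (ε := Alt (k + 1) X), ?_⟩,
    fun T => Filter.Eventually.of_forall fun x => rfl⟩
  intro φ _ _ _ v
  simp

instance (𝒯 : Triangulation Ω) (r : ℤ) (k : ℕ) (X : Type)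
    [NormedAddCommGroup X] [NormedSpace ℝ X] : Nonempty (𝒯.PPlusSpace r k X) :=
  ⟨⟨0, 𝒯.zero_mem_PPlusSpace r k X⟩⟩

/-- The canonical projection onto `P_r⁺ Λᵏ(𝒯; X)`: the element with the same degrees of freedom
as `η`. (An arbitrary element if there is none.) -/
def Triangulation.proj (𝒯 : Triangulation Ω) (r : ℤ) {k : ℕ} {X : Type}
    [NormedAddCommGroup X] [InnerProductSpace ℝ X] (η : 𝒯.Piecewise k X) :
    𝒯.PPlusSpace r k X :=
  Classical.epsilon fun ω : 𝒯.PPlusSpace r k X => 𝒯.SameDofs r ω.1 η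

/-- A form on `Ω` as a piecewise form. -/
def Triangulation.ofForm (𝒯 : Triangulation Ω) {k : ℕ} {X : Type}
    [NormedAddCommGroup X] [NormedSpace ℝ X] (σ : V3 → Alt k X) : 𝒯.Piecewise k X :=
  fun _ => σ

/-- The operator `S_k` applied to a piecewise form. -/
def Triangulation.SPiecewise (𝒯 : Triangulation Ω) {k : ℕ} (ω : 𝒯.Piecewise k V3) :
    𝒯.Piecewise (k + 1) Skew :=
  fun T x => S (ω T x)

/-- `S_{1,h} = Π_h² S₁`, from `P_{r+1}⁺ Λ¹(𝒯; 𝕍)` to `P_r⁺ Λ²(𝒯; 𝕂)`. -/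
def Triangulation.S1h (𝒯 : Triangulation Ω) (r : ℕ) (τ : 𝒯.PPlusSpace (r + 1) 1 V3) :
    𝒯.PPlusSpace r 2 Skew :=
  𝒯.proj r (𝒯.SPiecewise τ.1)

end

end ElasticityFEM

open ElasticityFEM

/-!
# Canonical projections and the surjectivity of `S_{1,h}`

**Unisolvence on a tetrahedron.** In terms of the barycentric coordinates, `P_s⁺ Λᵏ` is the sum,
over the faces `F` of a tetrahedron, of the spaces `faceSpace b F s k X` spanned by the products of
a Whitney form of `F`, of the bubble of the remaining vertices of `F`, and of a polynomial in the
coordinates of `F` (`PPlus_le_iSup_faceSpace`); the trace of such a form on a face that does not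
contain `F` is zero (`faceSpace_trace`). So the degrees of freedom are triangular with respect to
this decomposition, and it remains to treat a single face. There the coefficients of the bubble
Whitney forms are polynomials of the same degree as the test forms, and tested against itself, such a
coefficient vector gives the integral of a quadratic form that is positive definite inside the face
(`FaceSystem`). It follows that the degrees of freedom can be prescribed independently on all faces
(`exists_interpolant`), that they determine the form (`eq_zero_of_faceDofs`), and that those on the
subfaces of `F` determine its trace on `F` (`trace_eq_zero`).

**Conformity.** By the divergence theorem on a tetrahedron (`integral_fderiv_convexHull`), a piecewise
smooth form has a weak exterior derivative if and only if its boundary terms cancel. As a facet that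
meets the domain has exactly two tetrahedra, on opposite sides, this means that the traces from both
sides agree (`Triangulation.mem_PPlusSpace_iff`). So interpolation of data given on the faces
produces elements of the discrete space, and the canonical projections are well defined. For the
2-form `S τ`, only facets and tetrahedra carry degrees of freedom, and on these the traces of `S τ`
are single-valued.

**The operator `S`.** It is algebraic, with an algebraic adjoint `SAdj` for the wedge product, so the
degrees of freedom of `S ω` with respect to `ζ` are those of `ω` with respect to `SAdj ζ`
(`Triangulation.Interpolates.S`); the degrees match, since the 1-forms have one polynomial degree
more. This gives the commutation. Moreover `S : Alt 1 𝕍 → Alt 2 𝕂` is surjective (`S_surjective`). If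
`R` is a linear right inverse, then for a discrete 2-form `μ` the interpolant `τ` of `R μ` satisfies
`S_{1,h} τ = μ`, as `S τ` has the same degrees of freedom as `S (R μ) = μ`. The traces of `R μ` on an
edge may depend on the tetrahedron; any one of them can be interpolated there, as the edges carry no
degrees of freedom of 2-forms.
-/

set_option linter.unusedSectionVars false

namespace ElasticityFEM

/-! ### Polynomial maps in Cartesian and in barycentric coordinates -/

section PolyMap

variable {W W' : Type} [AddCommGroup W] [Module ℝ W] [AddCommGroup W']
  [Module ℝ W']

theorem eval_smul_mem_polyMap {s : ℤ} (p : MvPolynomial (Fin 3) ℝ) (w : W)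
    (hp : ∀ m ∈ p.support, (m.degree : ℤ) ≤ s) :
    (fun x : V3 => MvPolynomial.eval (fun i => x i) p • w) ∈ PolyMap s W :=
  Submodule.subset_span ⟨p, w, hp, rfl⟩

theorem PolyMap.map {s : ℤ} (L : W →ₗ[ℝ] W') {f : V3 → W} (hf : f ∈ PolyMap s W) :
    (fun x => L (f x)) ∈ PolyMap s W' := by
  have : PolyMap s W ≤ (PolyMap s W').comap (L.compLeft V3) := by
    refine Submodule.span_le.2 ?_
    rintro _ ⟨p, w, hp, rfl⟩
    have := eval_smul_mem_polyMap p (L w) hp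
    simpa [LinearMap.compLeft, Function.comp_def] using this
  exact this hf

theorem PolyMap.mono {s t : ℤ} (h : s ≤ t) : PolyMap s W ≤ PolyMap t W := by
  refine Submodule.span_mono ?_
  rintro _ ⟨p, w, hp, rfl⟩
  exact ⟨p, w, fun m hm => (hp m hm).trans h, rfl⟩

theorem PolyMap.smul {s t : ℤ} {g : V3 → ℝ} {f : V3 → W} (hg : g ∈ PolyMap s ℝ)
    (hf : f ∈ PolyMap t W) : (fun x => g x • f x) ∈ PolyMap (s + t) W := by
  induction hg using Submodule.span_induction with
  | zero => simp only [Pi.zero_apply, zero_smul]; exact Submodule.zero_mem _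
  | add g₁ g₂ _ _ h₁ h₂ =>
    simp only [Pi.add_apply, add_smul]; exact Submodule.add_mem _ h₁ h₂
  | smul c g _ h =>
    simp only [Pi.smul_apply, smul_eq_mul, mul_smul]; exact Submodule.smul_mem _ c h
  | mem g hg =>
    obtain ⟨p, a, hp, rfl⟩ := hg
    induction hf using Submodule.span_induction with
    | zero => simp only [Pi.zero_apply, smul_zero]; exact Submodule.zero_mem _
    | add g₁ g₂ _ _ h₁ h₂ =>
      simp only [Pi.add_apply, smul_add]; exact Submodule.add_mem _ h₁ h₂
    | smul c g _ h =>
      simp only [Pi.smul_apply]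
      simp_rw [smul_comm _ c]
      exact Submodule.smul_mem _ c h
    | mem f hf =>
      obtain ⟨q, w, hq, rfl⟩ := hf
      have := eval_smul_mem_polyMap (s := s + t) (p * q) (a • w) (by
        intro m hm
        obtain ⟨i, hi, j, hj, rfl⟩ := Finset.mem_add.1 (MvPolynomial.support_mul p q hm)
        have := hp i hi
        have := hq j hj
        rw [map_add]; push_cast; omega)
      convert this using 2 with x
      simp only [map_mul, smul_eq_mul, smul_smul]
      congr 1; ring

theorem PolyMap.const_mem (w : W) : (fun _ : V3 => w) ∈ PolyMap 0 W := by
  have := eval_smul_mem_polyMap (s := 0) (1 : MvPolynomial (Fin 3) ℝ) w (by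
    intro m hm
    have : m = 0 := by
      by_contra h
      rw [MvPolynomial.mem_support_iff, MvPolynomial.coeff_one] at hm
      simp [Ne.symm h] at hm
    simp [this])
  simpa using this

theorem PolyMap.apply_mem (i : Fin 3) : (fun x : V3 => x i) ∈ PolyMap 1 ℝ := by
  have := eval_smul_mem_polyMap (s := 1) (MvPolynomial.X i : MvPolynomial (Fin 3) ℝ) (1 : ℝ) (by
    intro m hm
    rw [MvPolynomial.support_X, Finset.mem_singleton] at hm
    simp [hm])
  simpa using this

theorem PolyMap.linear_mem (L : V3 →ₗ[ℝ] W) : (fun x => L x) ∈ PolyMap 1 W := by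
  have h : (fun x => L x) = ∑ i : Fin 3, fun x : V3 => x i • L (EuclideanSpace.single i 1) := by
    funext x
    conv_lhs => rw [← (EuclideanSpace.basisFun (Fin 3) ℝ).sum_repr x]
    simp
  rw [h]
  refine Submodule.sum_mem _ fun i _ => ?_
  simpa using PolyMap.smul (PolyMap.apply_mem i) (PolyMap.const_mem (L (EuclideanSpace.single i 1)))

theorem PolyMap.affine_mem (A : V3 →ᵃ[ℝ] ℝ) : (fun x => A x) ∈ PolyMap 1 ℝ := by
  have h : (fun x => A x) = (fun x => A.linear x) + fun _ => A 0 := by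
    funext x
    exact congrFun A.decomp x
  rw [h]
  exact Submodule.add_mem _ (PolyMap.linear_mem _) (PolyMap.mono (by norm_num) (PolyMap.const_mem _))

theorem PolyMap.mul {s t : ℤ} {g f : V3 → ℝ} (hg : g ∈ PolyMap s ℝ)
    (hf : f ∈ PolyMap t ℝ) : (fun x => g x * f x) ∈ PolyMap (s + t) ℝ :=
  PolyMap.smul hg hf

theorem PolyMap.pow {s : ℤ} {g : V3 → ℝ} (hg : g ∈ PolyMap s ℝ) (n : ℕ) :
    (fun x => g x ^ n) ∈ PolyMap (n * s) ℝ := by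
  induction n with
  | zero => simpa using PolyMap.const_mem (1 : ℝ)
  | succ n ih =>
    have := PolyMap.mul ih hg
    simp_rw [pow_succ]
    convert this using 1
    push_cast; ring_nf

theorem PolyMap.prod {κ : Type*} (t : Finset κ) (s : κ → ℤ) (g : κ → V3 → ℝ)
    (hg : ∀ i ∈ t, g i ∈ PolyMap (s i) ℝ) :
    (fun x => ∏ i ∈ t, g i x) ∈ PolyMap (∑ i ∈ t, s i) ℝ := by
  classical
  induction t using Finset.induction_on with
  | empty => simpa using PolyMap.const_mem (1 : ℝ)
  | insert a t ha ih =>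
    simp_rw [Finset.prod_insert ha, Finset.sum_insert ha]
    exact PolyMap.mul (hg a (by simp)) (ih fun i hi => hg i (by simp [hi]))

theorem PolyMap.contDiff {W : Type} [NormedAddCommGroup W] [NormedSpace ℝ W] {s : ℤ}
    {f : V3 → W} (hf : f ∈ PolyMap s W) {n : WithTop ℕ∞} : ContDiff ℝ n f := by
  induction hf using Submodule.span_induction with
  | zero => exact contDiff_const
  | add g₁ g₂ _ _ h₁ h₂ => exact h₁.add h₂
  | smul c g _ h => exact h.const_smul c
  | mem f hf =>
    obtain ⟨p, w, -, rfl⟩ := hf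
    simp_rw [MvPolynomial.eval_eq']
    fun_prop

end PolyMap

section Barycentric

variable {ι : Type} [Fintype ι] (b : AffineBasis ι ℝ V3)
variable {W W' : Type} [AddCommGroup W] [Module ℝ W] [AddCommGroup W'] [Module ℝ W']

/-- The `W`-valued polynomial maps that are homogeneous of degree `m` in the barycentric
coordinates belonging to the vertices in `F`. -/
def HPoly (F : Finset ι) (m : ℤ) (W : Type) [AddCommGroup W] [Module ℝ W] :
    Submodule ℝ (V3 → W) :=
  Submodule.span ℝ {f | ∃ (α : ι → ℕ) (w : W), (∀ i ∉ F, α i = 0) ∧ ((∑ i, α i : ℕ) : ℤ) = m ∧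
    f = fun x => (∏ i, b.coord i x ^ α i) • w}

variable {b}

theorem HPoly.monomial_mem {F : Finset ι} {m : ℤ} (α : ι → ℕ) (w : W)
    (hα : ∀ i ∉ F, α i = 0) (hm : ((∑ i, α i : ℕ) : ℤ) = m) :
    (fun x => (∏ i, b.coord i x ^ α i) • w) ∈ HPoly b F m W :=
  Submodule.subset_span ⟨α, w, hα, hm, rfl⟩

theorem HPoly.map {F : Finset ι} {m : ℤ} (L : W →ₗ[ℝ] W') {f : V3 → W}
    (hf : f ∈ HPoly b F m W) : (fun x => L (f x)) ∈ HPoly b F m W' := by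
  have : HPoly b F m W ≤ (HPoly b F m W').comap (L.compLeft V3) := by
    refine Submodule.span_le.2 ?_
    rintro _ ⟨α, w, hα, hm, rfl⟩
    have := HPoly.monomial_mem (b := b) α (L w) hα hm
    simpa [LinearMap.compLeft, Function.comp_def] using this
  exact this hf

theorem HPoly.smul {F : Finset ι} {s t : ℤ} {g : V3 → ℝ} {f : V3 → W} (hg : g ∈ HPoly b F s ℝ)
    (hf : f ∈ HPoly b F t W) : (fun x => g x • f x) ∈ HPoly b F (s + t) W := by
  induction hg using Submodule.span_induction with
  | zero => simp only [Pi.zero_apply, zero_smul]; exact Submodule.zero_mem _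
  | add g₁ g₂ _ _ h₁ h₂ =>
    simp only [Pi.add_apply, add_smul]; exact Submodule.add_mem _ h₁ h₂
  | smul c g _ h =>
    simp only [Pi.smul_apply, smul_eq_mul, mul_smul]; exact Submodule.smul_mem _ c h
  | mem g hg =>
    obtain ⟨α, a, hα, hm, rfl⟩ := hg
    induction hf using Submodule.span_induction with
    | zero => simp only [Pi.zero_apply, smul_zero]; exact Submodule.zero_mem _
    | add g₁ g₂ _ _ h₁ h₂ =>
      simp only [Pi.add_apply, smul_add]; exact Submodule.add_mem _ h₁ h₂
    | smul c g _ h =>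
      simp only [Pi.smul_apply]
      simp_rw [smul_comm _ c]
      exact Submodule.smul_mem _ c h
    | mem f hf =>
      obtain ⟨β, w, hβ, hn, rfl⟩ := hf
      have := HPoly.monomial_mem (b := b) (m := s + t) (F := F) (α + β) (a • w)
        (fun i hi => by simp [hα i hi, hβ i hi])
        (by rw [← hm, ← hn]; simp [Finset.sum_add_distrib])
      convert this using 2 with x
      simp only [Pi.add_apply, pow_add, Finset.prod_mul_distrib, smul_eq_mul, smul_smul]
      congr 1; ring

theorem HPoly.const_mem (F : Finset ι) (w : W) : (fun _ : V3 => w) ∈ HPoly b F 0 W := by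
  simpa using HPoly.monomial_mem (b := b) (F := F) (m := 0) (fun _ => 0) w (by simp) (by simp)

theorem HPoly.coord_mem {F : Finset ι} {i : ι} (hi : i ∈ F) :
    (fun x => b.coord i x) ∈ HPoly b F 1 ℝ := by
  classical
  have := HPoly.monomial_mem (b := b) (F := F) (m := 1) (Pi.single i 1) (1 : ℝ)
    (fun j hj => Pi.single_eq_of_ne (by rintro rfl; exact hj hi) _) (by simp)
  convert this using 2 with x
  rw [Finset.prod_eq_single i] <;> simp +contextual

theorem HPoly.le_polyMap {F : Finset ι} {m : ℤ} : HPoly b F m W ≤ PolyMap m W := by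
  refine Submodule.span_le.2 ?_
  rintro _ ⟨α, w, hα, hm, rfl⟩
  have h := PolyMap.prod Finset.univ (fun i => (α i : ℤ) * 1) (fun i x => b.coord i x ^ α i)
    fun i _ => PolyMap.pow (PolyMap.affine_mem (b.coord i)) (α i)
  have := PolyMap.smul h (PolyMap.const_mem w)
  convert this using 1
  rw [← hm]; push_cast; simp

theorem HPoly.finiteDimensional (b : AffineBasis ι ℝ V3) (F : Finset ι) (m : ℤ)
    [FiniteDimensional ℝ W] : FiniteDimensional ℝ (HPoly b F m W) := by
  classical
  let S : Finset (ι → ℕ) := Fintype.piFinset fun _ => Finset.range (m.toNat + 1)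
  let R : (ι → ℕ) → Submodule ℝ (V3 → W) := fun α => LinearMap.range
    (LinearMap.pi fun x : V3 => (∏ i, b.coord i x ^ α i) • (LinearMap.id : W →ₗ[ℝ] W))
  have h : HPoly b F m W ≤ S.sup R := by
    refine Submodule.span_le.2 ?_
    rintro _ ⟨α, w, hα, hm, rfl⟩
    have hS : α ∈ S := by
      rw [Fintype.mem_piFinset]
      intro i
      have : α i ≤ ∑ j, α j := Finset.single_le_sum (fun _ _ => Nat.zero_le _) (Finset.mem_univ i)
      rw [Finset.mem_range]; omega
    exact (Finset.le_sup (f := R) hS) ⟨w, rfl⟩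
  have : FiniteDimensional ℝ (S.sup R : Submodule ℝ (V3 → W)) :=
    Submodule.finiteDimensional_finset_sup S R
  exact Submodule.finiteDimensional_of_le h

/-- On the affine hull of the face `F`, every polynomial map of degree at most `m` can be made
homogeneous of degree `m` in the barycentric coordinates of `F`, since these sum to one. -/
theorem PolyMap.exists_hpoly {m : ℤ} {f : V3 → W} (hf : f ∈ PolyMap m W) (F : Finset ι) :
    ∃ h ∈ HPoly b F m W, ∀ x, (∀ i ∉ F, b.coord i x = 0) → h x = f x := by
  classical
  let P : ℤ → (V3 → ℝ) → Prop := fun n g =>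
    ∃ h ∈ HPoly b F n ℝ, ∀ x, (∀ i ∉ F, b.coord i x = 0) → h x = g x
  have hmul : ∀ {n n' g g'}, P n g → P n' g' → P (n + n') (fun x => g x * g' x) := by
    rintro n n' g g' ⟨h, hh, e⟩ ⟨h', hh', e'⟩
    exact ⟨_, HPoly.smul hh hh', fun x hx => by simp [e x hx, e' x hx]⟩
  have hcoord : ∀ y : ι → ℝ, P 1 (fun x => ∑ i, b.coord i x * y i) := by
    intro y
    refine ⟨∑ i ∈ F, y i • fun x => b.coord i x, Submodule.sum_mem _ fun i hi =>
      Submodule.smul_mem _ _ (HPoly.coord_mem hi), fun x hx => ?_⟩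
    beta_reduce
    rw [Finset.sum_apply, ← Finset.sum_subset (Finset.subset_univ F)]
    · exact Finset.sum_congr rfl fun i _ => by simp [mul_comm]
    · intro i _ hi
      simp [hx i hi]
  have hone : P 1 (fun _ => 1) := by
    have := hcoord (fun _ => 1)
    simpa using this
  have hconst : ∀ c, P 0 (fun _ => c) := fun c => ⟨_, HPoly.const_mem F c, fun _ _ => rfl⟩
  have hX : ∀ i : Fin 3, P 1 (fun x => x i) := by
    intro i
    have := hcoord (fun j => b j i)
    convert this using 2 with x
    have h := congrArg (fun z : V3 => z i) (b.linear_combination_coord_eq_self x)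
    simpa only [WithLp.ofLp_sum, Finset.sum_apply, PiLp.smul_apply, smul_eq_mul] using h.symm
  have hpow : ∀ {n g} (k : ℕ), P n g → P (k * n) (fun x => g x ^ k) := by
    intro n g k hg
    induction k with
    | zero => simpa using hconst 1
    | succ k ih =>
      have := hmul ih hg
      simp_rw [pow_succ]
      convert this using 1
      push_cast; ring
  have hprod : ∀ (t : Finset (Fin 3)) (d : Fin 3 → ℕ),
      P (∑ i ∈ t, (d i : ℤ)) (fun x => ∏ i ∈ t, x i ^ d i) := by
    intro t d
    induction t using Finset.induction_on with
    | empty => simpa using hconst 1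
    | insert a t ha ih =>
      simp_rw [Finset.prod_insert ha, Finset.sum_insert ha]
      simpa using hmul (hpow (d a) (hX a)) ih
  induction hf using Submodule.span_induction with
  | zero => exact ⟨0, Submodule.zero_mem _, fun _ _ => rfl⟩
  | add g₁ g₂ _ _ h₁ h₂ =>
    obtain ⟨k₁, hk₁, e₁⟩ := h₁
    obtain ⟨k₂, hk₂, e₂⟩ := h₂
    exact ⟨k₁ + k₂, Submodule.add_mem _ hk₁ hk₂, fun x hx => by simp [e₁ x hx, e₂ x hx]⟩
  | smul c g _ h =>
    obtain ⟨k, hk, e⟩ := h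
    exact ⟨c • k, Submodule.smul_mem _ c hk, fun x hx => by simp [e x hx]⟩
  | mem f hf =>
    obtain ⟨p, w, hp, rfl⟩ := hf
    have key : ∀ d ∈ p.support, P m (fun x => p.coeff d * ∏ i, x i ^ d i) := by
      intro d hd
      have hdeg : ((d.degree : ℕ) : ℤ) = ∑ i, (d i : ℤ) := by
        rw [Finsupp.degree_eq_sum]; push_cast; rfl
      have h1 := hmul (hmul (hconst (p.coeff d)) (hprod Finset.univ d))
        (hpow (m - d.degree).toNat hone)
      have h2 := hp d hd
      convert h1 using 1
      · omega
      · simp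
    choose! h hh e using key
    refine ⟨fun x => (∑ d ∈ p.support, h d) x • w, ?_, fun x hx => ?_⟩
    · have h1 : ∑ d ∈ p.support, h d ∈ HPoly b F m ℝ := Submodule.sum_mem _ fun d hd => hh d hd
      exact HPoly.map ((LinearMap.id : ℝ →ₗ[ℝ] ℝ).smulRight w) h1
    · beta_reduce
      rw [MvPolynomial.eval_eq', Finset.sum_apply]
      congr 1
      exact Finset.sum_congr rfl fun d hd => e d hd x hx

theorem PolyMap.le_hpoly_univ (b : AffineBasis ι ℝ V3) {m : ℤ} :
    PolyMap m W ≤ HPoly b Finset.univ m W := by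
  intro f hf
  obtain ⟨h, hh, e⟩ := PolyMap.exists_hpoly (b := b) hf Finset.univ
  have : f = h := funext fun x => (e x (by simp)).symm
  exact this ▸ hh

/-- A point with prescribed barycentric coordinates. -/
theorem exists_coord_eq (b : AffineBasis ι ℝ V3) (y : ι → ℝ) (hy : ∑ i, y i = 1) :
    ∃ x, ∀ i, b.coord i x = y i := by
  refine ⟨Finset.univ.affineCombination ℝ b y, fun i => ?_⟩
  exact b.coord_apply_combination_of_mem (Finset.mem_univ i) hy

/-- A homogeneous polynomial in the barycentric coordinates of `F` that vanishes in the relative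
interior of the face `F` is zero everywhere, also off the face. -/
theorem HPoly.eq_zero {F : Finset ι} (hF : F.Nonempty) {m : ℤ} {f : V3 → W}
    (hf : f ∈ HPoly b F m W)
    (h0 : ∀ x, (∀ i ∈ F, 0 < b.coord i x) → (∀ i ∉ F, b.coord i x = 0) → f x = 0) : f = 0 := by
  classical
  -- it suffices to treat scalar maps
  suffices H : ∀ f ∈ HPoly b F m ℝ, (∀ x, (∀ i ∈ F, 0 < b.coord i x) →
      (∀ i ∉ F, b.coord i x = 0) → f x = 0) → f = 0 by
    funext x
    rw [Pi.zero_apply, ← Module.forall_dual_apply_eq_zero_iff ℝ]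
    intro φ
    have := H _ (HPoly.map φ hf) fun x h1 h2 => by rw [h0 x h1 h2, map_zero]
    exact congrFun this x
  clear h0 hf f
  intro f hf h0
  have key : ∃ P : MvPolynomial ι ℝ, (∀ y : ι → ℝ, MvPolynomial.eval y P =
      MvPolynomial.eval (fun i => if i ∈ F then y i else 0) P) ∧
      (∀ (c : ℝ) (y : ι → ℝ), MvPolynomial.eval (fun i => c * y i) P =
        c ^ m.toNat * MvPolynomial.eval y P) ∧
      ∀ x, f x = MvPolynomial.eval (fun i => b.coord i x) P := by
    clear h0
    induction hf using Submodule.span_induction with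
    | zero => exact ⟨0, by simp, by simp, by simp⟩
    | add g₁ g₂ _ _ h₁ h₂ =>
      obtain ⟨P, h1, h2, h3⟩ := h₁
      obtain ⟨Q, k1, k2, k3⟩ := h₂
      refine ⟨P + Q, fun y => ?_, fun c y => ?_, fun x => ?_⟩
      · rw [map_add, map_add, h1, k1]
      · rw [map_add, map_add, h2, k2]; ring
      · rw [map_add, Pi.add_apply, h3, k3]
    | smul c g _ h =>
      obtain ⟨P, h1, h2, h3⟩ := h
      refine ⟨c • P, fun y => ?_, fun c y => ?_, fun x => ?_⟩
      · rw [MvPolynomial.smul_eval, MvPolynomial.smul_eval, h1]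
      · rw [MvPolynomial.smul_eval, MvPolynomial.smul_eval, h2]; ring
      · rw [MvPolynomial.smul_eval, Pi.smul_apply, h3, smul_eq_mul]
    | mem f hf =>
      obtain ⟨α, w, hα, hm, rfl⟩ := hf
      refine ⟨w • ∏ i, MvPolynomial.X i ^ α i, fun y => ?_, fun c y => ?_, fun x => ?_⟩
      · simp only [MvPolynomial.smul_eval, map_prod, map_pow, MvPolynomial.eval_X]
        congr 1
        refine Finset.prod_congr rfl fun i _ => ?_
        by_cases hi : i ∈ F
        · simp [hi]
        · simp [hα i hi]
      · simp only [MvPolynomial.smul_eval, map_prod, map_pow, MvPolynomial.eval_X, mul_pow,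
          Finset.prod_mul_distrib, Finset.prod_pow_eq_pow_sum]
        have : ∑ i, α i = m.toNat := by omega
        rw [this]; ring
      · simp [mul_comm]
  obtain ⟨P, h1, h2, h3⟩ := key
  suffices P = 0 by funext x; simp [h3, this]
  refine MvPolynomial.funext_set (fun _ => Set.Ioi (0 : ℝ)) (fun _ => Set.Ioi_infinite 0) ?_
  intro y hy
  have hy' : ∀ i, 0 < y i := fun i => hy i (Set.mem_univ i)
  have hS : 0 < ∑ i ∈ F, y i := Finset.sum_pos (fun i _ => hy' i) hF
  obtain ⟨x, hx⟩ := exists_coord_eq b (fun i => if i ∈ F then y i / ∑ i ∈ F, y i else 0) (by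
    rw [Finset.sum_ite_mem, Finset.univ_inter, ← Finset.sum_div, div_self hS.ne'])
  have h4 := h0 x (fun i hi => by rw [hx, if_pos hi]; exact div_pos (hy' i) hS)
    (fun i hi => by rw [hx, if_neg hi])
  rw [map_zero, h1]
  have h5 : (fun i => if i ∈ F then y i else 0) =
      fun i => (∑ i ∈ F, y i) * b.coord i x := by
    funext i
    rw [hx]
    split_ifs with hi
    · field_simp
    · simp
  rw [h5, h2, ← h3, h4, mul_zero]

end Barycentric

/-! ### Whitney forms and the geometric decomposition of `P_s⁺ Λᵏ` -/

section Whitney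

variable {X : Type} [NormedAddCommGroup X] [NormedSpace ℝ X] {k : ℕ}

/-- An alternating form on the finite dimensional space `V3` is continuous. -/
noncomputable def altOfAlternating (f : V3 [⋀^Fin k]→ₗ[ℝ] X) : Alt k X :=
  { f with
    cont := by
      have h : (fun v => f v) = fun v : Fin k → V3 => ∑ r : Fin k → Fin 3,
          (∏ j, v j (r j)) • f fun j => EuclideanSpace.single (r j) (1 : ℝ) := by
        funext v
        have hv : v = fun j => ∑ i : Fin 3, v j i • EuclideanSpace.single i (1 : ℝ) := by
          funext j
          conv_lhs => rw [← (EuclideanSpace.basisFun (Fin 3) ℝ).sum_repr (v j)]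
          simp
        conv_lhs => rw [hv]
        have := f.toMultilinearMap.map_sum
          (fun j (i : Fin 3) => v j i • EuclideanSpace.single i (1 : ℝ))
        refine this.trans (Finset.sum_congr rfl fun r _ => ?_)
        exact f.toMultilinearMap.map_smul_univ (fun j => v j (r j)) _
      change Continuous fun v => f v
      rw [h]
      fun_prop }

@[simp]
theorem altOfAlternating_apply (f : V3 [⋀^Fin k]→ₗ[ℝ] X) (v : Fin k → V3) :
    altOfAlternating f v = f v := rfl

variable {ι : Type} [Fintype ι]

/-- The differential of a barycentric coordinate. -/
noncomputable def dcoord (b : AffineBasis ι ℝ V3) (i : ι) : V3 →L[ℝ] ℝ :=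
  LinearMap.toContinuousLinearMap (b.coord i).linear

variable (b : AffineBasis ι ℝ V3)

theorem dcoord_sub (i : ι) (x y : V3) : dcoord b i (x - y) = b.coord i x - b.coord i y := by
  simpa [dcoord] using (b.coord i).linearMap_vsub x y

theorem coord_add (i : ι) (x v : V3) : b.coord i (x + v) = b.coord i x + dcoord b i v := by
  have := dcoord_sub b i (x + v) x
  rw [add_sub_cancel_left] at this
  rw [this]; ring

theorem sum_dcoord (v : V3) : ∑ i, dcoord b i v = 0 := by
  have h : ∀ i, dcoord b i v = b.coord i v - b.coord i 0 := fun i => by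
    rw [← dcoord_sub, sub_zero]
  simp [h]

theorem sum_dcoord_smul (v : V3) : ∑ i, dcoord b i v • b i = v := by
  have h : ∀ i, dcoord b i v = b.coord i v - b.coord i 0 := fun i => by
    rw [← dcoord_sub, sub_zero]
  simp [h, sub_smul]

theorem continuous_coord (i : ι) : Continuous fun x => b.coord i x :=
  (PolyMap.contDiff (PolyMap.affine_mem (b.coord i)) (n := 0)).continuous

/-- The `k`-form `x ↦ B (λ(x), dλ ·, …, dλ ·)` obtained from an alternating `(k + 1)`-form `B` in
homogeneous barycentric coordinates. -/
noncomputable def homForm (B : (ι → ℝ) [⋀^Fin (k + 1)]→ₗ[ℝ] X) (x : V3) : Alt k X :=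
  altOfAlternating ((B.curryLeft fun i => b.coord i x).compLinearMap
    (LinearMap.pi fun i => (dcoord b i : V3 →ₗ[ℝ] ℝ)))

theorem homForm_apply (B : (ι → ℝ) [⋀^Fin (k + 1)]→ₗ[ℝ] X) (x : V3) (v : Fin k → V3) :
    homForm b B x v = B (Matrix.vecCons (fun i => b.coord i x) fun j i => dcoord b i (v j)) := rfl

/-- A form in homogeneous coordinates is the sum of a constant form and the Koszul differential of
a constant form. -/
theorem homForm_eq_add (B : (ι → ℝ) [⋀^Fin (k + 1)]→ₗ[ℝ] X) :
    ∃ (α : Alt k X) (β : Alt (k + 1) X), ∀ x, homForm b B x = α + β.curryLeft x := by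
  refine ⟨homForm b B 0, altOfAlternating (B.compLinearMap
    (LinearMap.pi fun i => (dcoord b i : V3 →ₗ[ℝ] ℝ))), fun x => ?_⟩
  ext v
  have h : (fun i => b.coord i x) = (fun i => b.coord i 0) + fun i => dcoord b i x := by
    funext i
    simpa using coord_add b i 0 x
  rw [ContinuousAlternatingMap.add_apply, homForm_apply, homForm_apply, h]
  change (B.curryLeft _) _ = (B.curryLeft _) _ + _
  rw [map_add, AlternatingMap.add_apply]
  congr 1
  rw [ContinuousAlternatingMap.curryLeft_apply_apply, altOfAlternating_apply,
    AlternatingMap.compLinearMap_apply, AlternatingMap.curryLeft_apply_apply]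
  congr 1
  funext j
  refine Fin.cases ?_ (fun j => ?_) j <;> simp <;> rfl

theorem exists_homForm_const (α : Alt k X) :
    ∃ B : (ι → ℝ) [⋀^Fin (k + 1)]→ₗ[ℝ] X, ∀ x, homForm b B x = α := by
  let P : (ι → ℝ) →ₗ[ℝ] V3 := ∑ i, (LinearMap.proj i : (ι → ℝ) →ₗ[ℝ] ℝ).smulRight (b i)
  have hP : ∀ u, P u = ∑ i, u i • b i := fun u => by simp [P]
  let σ : (ι → ℝ) →ₗ[ℝ] ℝ := ∑ i, LinearMap.proj i
  have hσ : ∀ u, σ u = ∑ i, u i := fun u => by simp [σ]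
  refine ⟨AlternatingMap.alternatizeUncurryFin
    (σ.smulRight (α.toAlternatingMap.compLinearMap P)), fun x => ?_⟩
  ext v
  rw [homForm_apply, AlternatingMap.alternatizeUncurryFin_apply, Fin.sum_univ_succ]
  have h0 : ∑ j : Fin k, (-1 : ℤ) ^ ((j.succ : Fin (k + 1)) : ℕ) •
      (σ.smulRight (α.toAlternatingMap.compLinearMap P))
        ((Matrix.vecCons (fun i => b.coord i x) fun j i => dcoord b i (v j) :
          Fin (k + 1) → ι → ℝ) j.succ)
        (j.succ.removeNth (Matrix.vecCons (fun i => b.coord i x) fun j i => dcoord b i (v j) :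
          Fin (k + 1) → ι → ℝ)) = 0 := by
    refine Finset.sum_eq_zero fun j _ => ?_
    rw [LinearMap.smulRight_apply, Matrix.cons_val_succ, hσ, sum_dcoord, zero_smul]
    simp
  rw [h0, add_zero, LinearMap.smulRight_apply, Matrix.cons_val_zero, hσ, b.sum_coord_apply_eq_one,
    one_smul, Fin.val_zero, pow_zero, one_smul, AlternatingMap.compLinearMap_apply]
  change α _ = α _
  congr 1
  funext j
  rw [show (Fin.removeNth 0 (Matrix.vecCons (fun i => b.coord i x) fun j i => dcoord b i (v j) :
          Fin (k + 1) → ι → ℝ)) j = fun i => dcoord b i (v j) from rfl, hP, sum_dcoord_smul]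

theorem exists_homForm_koszul (β : Alt (k + 1) X) :
    ∃ B : (ι → ℝ) [⋀^Fin (k + 1)]→ₗ[ℝ] X, ∀ x, homForm b B x = β.curryLeft x := by
  let P : (ι → ℝ) →ₗ[ℝ] V3 := ∑ i, (LinearMap.proj i : (ι → ℝ) →ₗ[ℝ] ℝ).smulRight (b i)
  have hP : ∀ u, P u = ∑ i, u i • b i := fun u => by simp [P]
  refine ⟨β.toAlternatingMap.compLinearMap P, fun x => ?_⟩
  ext v
  rw [homForm_apply, AlternatingMap.compLinearMap_apply,
    ContinuousAlternatingMap.curryLeft_apply_apply]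
  change β _ = β _
  congr 1
  funext j
  refine Fin.cases ?_ (fun j => ?_) j
  · simp [hP]
  · simp [hP, sum_dcoord_smul]

variable [DecidableEq ι]

/-- The determinant of the coordinates `τ 0, …, τ k`, times `w`, as an alternating form. -/
noncomputable def minorForm (τ : Fin (k + 1) → ι) (w : X) : (ι → ℝ) [⋀^Fin (k + 1)]→ₗ[ℝ] X :=
  (Matrix.detRowAlternating.compLinearMap (LinearMap.funLeft ℝ ℝ τ)).smulRight w

theorem minorForm_apply (τ : Fin (k + 1) → ι) (w : X) (u : Fin (k + 1) → ι → ℝ) :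
    minorForm τ w u = Matrix.det (Matrix.of fun j a => u j (τ a)) • w := rfl

theorem alternatingMap_sum_apply {κ M N ι' : Type*} [AddCommGroup M] [Module ℝ M] [AddCommGroup N]
    [Module ℝ N] (t : Finset κ) (f : κ → M [⋀^ι']→ₗ[ℝ] N) (u : ι' → M) :
    (∑ i ∈ t, f i) u = ∑ i ∈ t, f i u := by
  classical
  induction t using Finset.induction_on with
  | empty => simp
  | insert a t ha ih => rw [Finset.sum_insert ha, Finset.sum_insert ha, AlternatingMap.add_apply, ih]

/-- The minors span the alternating forms. -/
theorem factorial_smul_eq_sum_minorForm (B : (ι → ℝ) [⋀^Fin (k + 1)]→ₗ[ℝ] X) :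
    ((k + 1).factorial : ℝ) • B =
      ∑ τ : Fin (k + 1) → ι, minorForm τ (B fun j => Pi.single (τ j) 1) := by
  ext u
  have key : ∀ π : Equiv.Perm (Fin (k + 1)), B u = ∑ τ : Fin (k + 1) → ι,
      ((Equiv.Perm.sign π : ℤ) : ℝ) • (∏ j, u (π j) (τ j)) •
        B fun j => Pi.single (τ j) 1 := by
    intro π
    have hu : (fun j => u (π j)) = fun j => ∑ i, u (π j) i • (Pi.single i 1 : ι → ℝ) := by
      funext j
      conv_lhs => rw [pi_eq_sum_univ' (u (π j))]
    have h1 : B (fun j => u (π j)) = ∑ τ : Fin (k + 1) → ι, (∏ j, u (π j) (τ j)) •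
        B fun j => Pi.single (τ j) 1 := by
      rw [hu]
      refine (B.toMultilinearMap.map_sum
        (fun j i => u (π j) i • (Pi.single i 1 : ι → ℝ))).trans
        (Finset.sum_congr rfl fun τ _ => ?_)
      exact B.toMultilinearMap.map_smul_univ (fun j => u (π j) (τ j)) _
    have h2 : B (fun j => u (π j)) = (Equiv.Perm.sign π : ℤ) • B u := by
      have := B.map_perm u π
      simpa [Function.comp_def, Units.smul_def] using this
    rw [← Finset.smul_sum, ← h1, h2, ← Int.cast_smul_eq_zsmul ℝ, smul_smul, ← Int.cast_mul,
      ← Units.val_mul, Int.units_mul_self]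
    simp
  have h3 : ((k + 1).factorial : ℝ) • B u = ∑ _π : Equiv.Perm (Fin (k + 1)), B u := by
    simp [Fintype.card_perm, Nat.cast_smul_eq_nsmul]
  rw [AlternatingMap.smul_apply, h3, Finset.sum_congr rfl fun π _ => key π, Finset.sum_comm,
    alternatingMap_sum_apply]
  refine Finset.sum_congr rfl fun τ _ => ?_
  rw [minorForm_apply, Matrix.det_apply', Finset.sum_smul]
  refine Finset.sum_congr rfl fun π _ => ?_
  rw [smul_smul]
  rfl

/-- The Whitney form of the vertices `τ 0, …, τ k`, times `w`. -/
noncomputable def whitney (τ : Fin (k + 1) → ι) (w : X) : V3 → Alt k X :=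
  homForm b (minorForm τ w)

theorem whitney_apply (τ : Fin (k + 1) → ι) (w : X) (x : V3) (v : Fin k → V3) :
    whitney b τ w x v = Matrix.det (Matrix.of fun j a =>
      (Matrix.vecCons (fun i => b.coord i x) fun j i => dcoord b i (v j) :
        Fin (k + 1) → ι → ℝ) j (τ a)) • w := rfl

theorem whitney_eq_zero {τ : Fin (k + 1) → ι} (hτ : ¬ Function.Injective τ) (w : X) (x : V3) :
    whitney b τ w x = 0 := by
  obtain ⟨a, a', h, hne⟩ := Function.not_injective_iff.1 hτ
  ext v
  rw [whitney_apply, Matrix.det_zero_of_column_eq hne, zero_smul]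
  · rfl
  · intro j; simp [h]

theorem homForm_eq_sum_whitney (B : (ι → ℝ) [⋀^Fin (k + 1)]→ₗ[ℝ] X) (x : V3) :
    homForm b B x = ((k + 1).factorial : ℝ)⁻¹ •
      ∑ τ : Fin (k + 1) → ι, whitney b τ (B fun j => Pi.single (τ j) 1) x := by
  have hk : ((k + 1).factorial : ℝ) ≠ 0 := by positivity
  rw [eq_inv_smul_iff₀ hk]
  ext v
  have h := congrArg (fun C : (ι → ℝ) [⋀^Fin (k + 1)]→ₗ[ℝ] X =>
    C (Matrix.vecCons (fun i => b.coord i x) fun j i => dcoord b i (v j)))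
    (factorial_smul_eq_sum_minorForm B)
  simp only [AlternatingMap.smul_apply, alternatingMap_sum_apply] at h
  rw [ContinuousAlternatingMap.smul_apply, homForm_apply, h, ContinuousAlternatingMap.sum_apply]
  rfl

/-- The part of `P_s⁺ Λᵏ` that belongs to the face `F`: it is spanned by the Whitney forms of
`F` times polynomials that are homogeneous in the barycentric coordinates of `F` and that vanish
wherever the barycentric coordinate of a vertex of `F` outside the Whitney form vanishes. -/
def faceSpace (F : Finset ι) (s : ℤ) (k : ℕ) (X : Type) [NormedAddCommGroup X]
    [NormedSpace ℝ X] : Submodule ℝ (V3 → Alt k X) :=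
  Submodule.span ℝ {ω | ∃ (τ : Fin (k + 1) → ι) (h : V3 → ℝ) (w : X), Function.Injective τ ∧
    (∀ a, τ a ∈ F) ∧ h ∈ HPoly b F (s + k + 1 - F.card) ℝ ∧
    ω = fun x => ((∏ i ∈ F \ Finset.univ.image τ, b.coord i x) * h x) • whitney b τ w x}

theorem smul_homForm_mem_PPlus {s : ℤ} {g : V3 → ℝ} (hg : g ∈ PolyMap s ℝ)
    (B : (ι → ℝ) [⋀^Fin (k + 1)]→ₗ[ℝ] X) :
    (fun x => g x • homForm b B x) ∈ PPlus s k X := by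
  obtain ⟨α, β, h⟩ := homForm_eq_add b B
  have e : (fun x => g x • homForm b B x) =
      (fun x => g x • α) + koszul k X (fun x => g x • β) := by
    funext x
    rw [h, smul_add, Pi.add_apply]
    congr 1
  rw [e]
  refine Submodule.add_mem_sup ?_ (Submodule.mem_map_of_mem ?_)
  · simpa using PolyMap.smul hg (PolyMap.const_mem α)
  · simpa using PolyMap.smul hg (PolyMap.const_mem β)

theorem faceSpace_le_PPlus (F : Finset ι) (s : ℤ) : faceSpace b F s k X ≤ PPlus s k X := by
  refine Submodule.span_le.2 ?_
  rintro _ ⟨τ, h, w, hτ, hF, hh, rfl⟩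
  refine smul_homForm_mem_PPlus b (g := fun x => (∏ i ∈ F \ Finset.univ.image τ, b.coord i x) * h x)
    ?_ _
  have h1 := PolyMap.prod (F \ Finset.univ.image τ) (fun _ => 1) (fun i x => b.coord i x)
    fun i _ => PolyMap.affine_mem (b.coord i)
  have h2 := PolyMap.mul h1 (HPoly.le_polyMap hh)
  have hsub : Finset.univ.image τ ⊆ F := by
    intro i hi
    obtain ⟨a, -, rfl⟩ := Finset.mem_image.1 hi
    exact hF a
  have hc : (Finset.univ.image τ).card = k + 1 := by
    rw [Finset.card_image_of_injective _ hτ, Finset.card_univ, Fintype.card_fin]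
  convert h2 using 1
  have := Finset.card_le_card hsub
  rw [Finset.sum_const, Finset.card_sdiff_of_subset hsub, hc]
  rw [hc] at this
  simp only [nsmul_eq_mul, mul_one]
  congr 1
  omega

theorem smul_whitney_mem_iSup {s : ℤ} {g : V3 → ℝ} (hg : g ∈ PolyMap s ℝ)
    (τ : Fin (k + 1) → ι) (w : X) :
    (fun x => g x • whitney b τ w x) ∈ ⨆ F, faceSpace b F s k X := by
  by_cases hτ : Function.Injective τ
  swap
  · simp only [whitney_eq_zero b hτ, smul_zero]
    exact Submodule.zero_mem _
  have hg' := PolyMap.le_hpoly_univ b hg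
  clear hg
  induction hg' using Submodule.span_induction with
  | zero => simp only [Pi.zero_apply, zero_smul]; exact Submodule.zero_mem _
  | add g₁ g₂ _ _ h₁ h₂ =>
    simp only [Pi.add_apply, add_smul]; exact Submodule.add_mem _ h₁ h₂
  | smul c g _ h =>
    simp only [Pi.smul_apply, smul_assoc]; exact Submodule.smul_mem _ c h
  | mem g hg =>
    obtain ⟨α, c, -, hα, rfl⟩ := hg
    let F : Finset ι := Finset.univ.filter (fun i => α i ≠ 0) ∪ Finset.univ.image τ
    let β : ι → ℕ := fun i => if i ∈ F \ Finset.univ.image τ then α i - 1 else α i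
    have hpos : ∀ i ∈ F \ Finset.univ.image τ, α i ≠ 0 := by
      intro i hi
      simp only [F, Finset.mem_sdiff, Finset.mem_union, Finset.mem_filter] at hi
      tauto
    have hαβ : ∀ i, α i = (if i ∈ F \ Finset.univ.image τ then 1 else 0) + β i := by
      intro i
      simp only [β]
      split_ifs with hi
      · have := hpos i hi; omega
      · omega
    have hc : (Finset.univ.image τ).card = k + 1 := by
      rw [Finset.card_image_of_injective _ hτ, Finset.card_univ, Fintype.card_fin]
    have hsub : Finset.univ.image τ ⊆ F := Finset.subset_union_right
    have hcard := Finset.card_le_card hsub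
    refine Submodule.mem_iSup_of_mem F (Submodule.subset_span
      ⟨τ, fun x => (∏ i, b.coord i x ^ β i) • c, w, hτ, fun a => ?_, ?_, ?_⟩)
    · exact hsub (Finset.mem_image_of_mem _ (Finset.mem_univ a))
    · refine HPoly.monomial_mem β c (fun i hi => ?_) ?_
      · have h1 : α i = 0 := by
          by_contra h
          exact hi (Finset.mem_union_left _ (by simp [h]))
        have := hαβ i
        omega
      · have h1 : ∑ i, α i = (F \ Finset.univ.image τ).card + ∑ i, β i := by
          rw [Finset.sum_congr rfl fun i _ => hαβ i, Finset.sum_add_distrib, Finset.sum_ite_mem,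
            Finset.univ_inter, Finset.sum_const, smul_eq_mul, mul_one]
        rw [Finset.card_sdiff_of_subset hsub, hc] at h1
        omega
    · funext x
      congr 1
      have h1 : ∏ i, b.coord i x ^ α i =
          (∏ i ∈ F \ Finset.univ.image τ, b.coord i x) * ∏ i, b.coord i x ^ β i := by
        rw [Finset.prod_congr rfl fun i _ => by rw [hαβ i, pow_add], Finset.prod_mul_distrib]
        congr 1
        simp only [pow_ite, pow_one, pow_zero]
        rw [Finset.prod_ite_mem, Finset.univ_inter]
      beta_reduce
      rw [h1, smul_eq_mul, smul_eq_mul, mul_assoc]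

/-- The geometric decomposition of `P_s⁺ Λᵏ`: every element is a sum of contributions of the
faces. -/
theorem PPlus_le_iSup_faceSpace (s : ℤ) : PPlus s k X ≤ ⨆ F, faceSpace b F s k X := by
  have key : ∀ {g : V3 → ℝ}, g ∈ PolyMap s ℝ → ∀ B : (ι → ℝ) [⋀^Fin (k + 1)]→ₗ[ℝ] X,
      (fun x => g x • homForm b B x) ∈ ⨆ F, faceSpace b F s k X := by
    intro g hg B
    have e : (fun x => g x • homForm b B x) = ((k + 1).factorial : ℝ)⁻¹ •
        ∑ τ : Fin (k + 1) → ι, fun x => g x • whitney b τ (B fun j => Pi.single (τ j) 1) x := by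
      funext x
      rw [homForm_eq_sum_whitney, Pi.smul_apply, Finset.sum_apply, smul_comm, Finset.smul_sum]
    rw [e]
    exact Submodule.smul_mem _ _ (Submodule.sum_mem _ fun τ _ => smul_whitney_mem_iSup b hg τ _)
  refine sup_le (Submodule.span_le.2 ?_) (Submodule.map_le_iff_le_comap.2 (Submodule.span_le.2 ?_))
  · rintro _ ⟨p, α, hp, rfl⟩
    obtain ⟨B, hB⟩ := exists_homForm_const b α
    have := key (g := fun x => MvPolynomial.eval (fun i => x i) p)
      (by simpa using eval_smul_mem_polyMap p (1 : ℝ) hp) B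
    simp only [hB] at this
    exact this
  · rintro _ ⟨p, β, hp, rfl⟩
    obtain ⟨B, hB⟩ := exists_homForm_koszul b β
    have := key (g := fun x => MvPolynomial.eval (fun i => x i) p)
      (by simpa using eval_smul_mem_polyMap p (1 : ℝ) hp) B
    simp only [hB] at this
    exact this

/-- The contribution of `F` has vanishing trace on every face that does not contain `F`. -/
theorem faceSpace_trace {F G : Finset ι} (hFG : ¬ F ⊆ G) {s : ℤ} {ω : V3 → Alt k X}
    (hω : ω ∈ faceSpace b F s k X) {x : V3} (hx : ∀ i ∉ G, b.coord i x = 0) {v : Fin k → V3}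
    (hv : ∀ j, ∀ i ∉ G, dcoord b i (v j) = 0) : ω x v = 0 := by
  obtain ⟨i, hiF, hiG⟩ := Finset.not_subset.1 hFG
  induction hω using Submodule.span_induction with
  | zero => rfl
  | add g₁ g₂ _ _ h₁ h₂ =>
    rw [Pi.add_apply, ContinuousAlternatingMap.add_apply, h₁, h₂, add_zero]
  | smul c g _ h => rw [Pi.smul_apply, ContinuousAlternatingMap.smul_apply, h, smul_zero]
  | mem ω hω =>
    obtain ⟨τ, h, w, hτ, hF, hh, rfl⟩ := hω
    by_cases hi : i ∈ Finset.univ.image τ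
    · obtain ⟨a, -, rfl⟩ := Finset.mem_image.1 hi
      rw [ContinuousAlternatingMap.smul_apply, whitney_apply,
        Matrix.det_eq_zero_of_column_eq_zero a, zero_smul, smul_zero]
      intro j
      refine Fin.cases ?_ (fun j => ?_) j
      · simpa using hx _ hiG
      · simpa using hv j _ hiG
    · beta_reduce
      rw [Finset.prod_eq_zero (f := fun i => b.coord i x) (Finset.mem_sdiff.2 ⟨hiF, hi⟩) (hx i hiG), zero_mul, zero_smul]
      rfl

end Whitney

/-! ### The wedge products that occur in the degrees of freedom -/

section Wedge

variable {X : Type} [NormedAddCommGroup X] [InnerProductSpace ℝ X]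

theorem wedge_eq_sum {k l : ℕ} (s : Finset (Equiv.Perm (Fin (k + l))))
    (hs : ∀ σ : Equiv.Perm (Fin (k + l)), (StrictMono (fun i : Fin k => σ (Fin.castAdd l i)) ∧
      StrictMono (fun j : Fin l => σ (Fin.natAdd k j))) ↔ σ ∈ s)
    (ω : Alt k X) (ζ : Alt l X) (v : Fin (k + l) → V3) :
    wedge ω ζ v = ∑ σ ∈ s, ((Equiv.Perm.sign σ : ℤ) : ℝ) *
      inner ℝ (ω fun i => v (σ (Fin.castAdd l i))) (ζ fun j => v (σ (Fin.natAdd k j))) := by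
  rw [wedge]
  refine Finset.sum_congr ?_ fun _ _ => rfl
  ext σ
  rw [Finset.mem_filter, hs σ]
  simp

theorem wedge_one_zero (ω : Alt 1 X) (ζ : Alt 0 X) (v : Fin (1 + 0) → V3) :
    wedge ω ζ v = inner ℝ (ω ![v 0]) (ζ ![]) := by
  rw [wedge_eq_sum {1} (by unfold StrictMono; decide)]
  rw [Finset.sum_singleton]
  simp only [Equiv.Perm.sign_one, Units.val_one, Int.cast_one, one_mul, Equiv.Perm.coe_one, id]
  congr 2
  · funext i; fin_cases i; rfl
  · funext i; exact i.elim0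

theorem wedge_two_zero (ω : Alt 2 X) (ζ : Alt 0 X) (v : Fin (2 + 0) → V3) :
    wedge ω ζ v = inner ℝ (ω ![v 0, v 1]) (ζ ![]) := by
  rw [wedge_eq_sum {1} (by unfold StrictMono; decide)]
  rw [Finset.sum_singleton]
  simp only [Equiv.Perm.sign_one, Units.val_one, Int.cast_one, one_mul, Equiv.Perm.coe_one, id]
  congr 2
  · funext i; fin_cases i <;> rfl
  · funext i; exact i.elim0

theorem wedge_one_one (ω ζ : Alt 1 X) (v : Fin (1 + 1) → V3) :
    wedge ω ζ v = inner ℝ (ω ![v 0]) (ζ ![v 1]) - inner ℝ (ω ![v 1]) (ζ ![v 0]) := by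
  rw [wedge_eq_sum {1, Equiv.swap 0 1} (by unfold StrictMono; decide)]
  rw [Finset.sum_pair (by decide), sub_eq_add_neg]
  congr 1
  · simp only [Equiv.Perm.sign_one, Units.val_one, Int.cast_one, one_mul, Equiv.Perm.coe_one, id]
    congr 2 <;> (funext i; fin_cases i; rfl)
  · rw [Equiv.Perm.sign_swap (by decide)]
    simp only [Units.val_neg, Units.val_one, Int.cast_neg, Int.cast_one, neg_mul, one_mul]
    congr 3 <;> (funext i; fin_cases i; rfl)

theorem wedge_one_two (ω : Alt 1 X) (ζ : Alt 2 X) (v : Fin (1 + 2) → V3) :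
    wedge ω ζ v = inner ℝ (ω ![v 0]) (ζ ![v 1, v 2]) - inner ℝ (ω ![v 1]) (ζ ![v 0, v 2])
      + inner ℝ (ω ![v 2]) (ζ ![v 0, v 1]) := by
  rw [wedge_eq_sum {1, Equiv.swap 0 1, Equiv.swap 0 1 * Equiv.swap 0 2}
    (by unfold StrictMono; decide)]
  rw [Finset.sum_insert (by decide), Finset.sum_pair (by decide), sub_eq_add_neg, add_assoc]
  congr 1
  · simp only [Equiv.Perm.sign_one, Units.val_one, Int.cast_one, one_mul, Equiv.Perm.coe_one, id]
    congr 2 <;> (funext i; fin_cases i <;> rfl)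
  congr 1
  · rw [Equiv.Perm.sign_swap (by decide)]
    simp only [Units.val_neg, Units.val_one, Int.cast_neg, Int.cast_one, neg_mul, one_mul]
    congr 3 <;> (funext i; fin_cases i <;> rfl)
  · rw [Equiv.Perm.sign_mul, Equiv.Perm.sign_swap (by decide), Equiv.Perm.sign_swap (by decide)]
    simp only [neg_mul_neg, mul_one, Units.val_one, Int.cast_one, one_mul]
    congr 2 <;> (funext i; fin_cases i <;> rfl)

theorem wedge_two_one (ω : Alt 2 X) (ζ : Alt 1 X) (v : Fin (2 + 1) → V3) :
    wedge ω ζ v = inner ℝ (ω ![v 1, v 2]) (ζ ![v 0]) - inner ℝ (ω ![v 0, v 2]) (ζ ![v 1])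
      + inner ℝ (ω ![v 0, v 1]) (ζ ![v 2]) := by
  rw [wedge_eq_sum {Equiv.swap 0 2 * Equiv.swap 0 1, Equiv.swap 1 2, 1}
    (by unfold StrictMono; decide)]
  rw [Finset.sum_insert (by decide), Finset.sum_pair (by decide), sub_eq_add_neg, add_assoc]
  congr 1
  · rw [Equiv.Perm.sign_mul, Equiv.Perm.sign_swap (by decide), Equiv.Perm.sign_swap (by decide)]
    simp only [neg_mul_neg, mul_one, Units.val_one, Int.cast_one, one_mul]
    congr 2 <;> (funext i; fin_cases i <;> rfl)
  congr 1
  · rw [Equiv.Perm.sign_swap (by decide)]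
    simp only [Units.val_neg, Units.val_one, Int.cast_neg, Int.cast_one, neg_mul, one_mul]
    congr 3 <;> (funext i; fin_cases i <;> rfl)
  · simp only [Equiv.Perm.sign_one, Units.val_one, Int.cast_one, one_mul, Equiv.Perm.coe_one, id]
    congr 2 <;> (funext i; fin_cases i <;> rfl)

theorem wedge_congr {k l : ℕ} {ω ω' : Alt k X} {ζ ζ' : Alt l X} {v : Fin (k + l) → V3}
    (h : ∀ r : Fin k → Fin (k + l), ω (fun i => v (r i)) = ω' fun i => v (r i))
    (h' : ∀ r : Fin l → Fin (k + l), ζ (fun i => v (r i)) = ζ' fun i => v (r i)) :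
    wedge ω ζ v = wedge ω' ζ' v := by
  refine Finset.sum_congr rfl fun σ _ => ?_
  rw [h fun i => σ (Fin.castAdd l i), h' fun i => σ (Fin.natAdd k i)]

theorem wedge_add_left {k l : ℕ} (ω ω' : Alt k X) (ζ : Alt l X) (v : Fin (k + l) → V3) :
    wedge (ω + ω') ζ v = wedge ω ζ v + wedge ω' ζ v := by
  simp only [wedge, ContinuousAlternatingMap.add_apply, inner_add_left, mul_add,
    Finset.sum_add_distrib]

theorem wedge_add_right {k l : ℕ} (ω : Alt k X) (ζ ζ' : Alt l X) (v : Fin (k + l) → V3) :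
    wedge ω (ζ + ζ') v = wedge ω ζ v + wedge ω ζ' v := by
  simp only [wedge, ContinuousAlternatingMap.add_apply, inner_add_right, mul_add,
    Finset.sum_add_distrib]

theorem wedge_smul_left {k l : ℕ} (c : ℝ) (ω : Alt k X) (ζ : Alt l X) (v : Fin (k + l) → V3) :
    wedge (c • ω) ζ v = c * wedge ω ζ v := by
  simp only [wedge, ContinuousAlternatingMap.smul_apply, real_inner_smul_left, Finset.mul_sum]
  exact Finset.sum_congr rfl fun _ _ => by ring

theorem wedge_smul_right {k l : ℕ} (c : ℝ) (ω : Alt k X) (ζ : Alt l X) (v : Fin (k + l) → V3) :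
    wedge ω (c • ζ) v = c * wedge ω ζ v := by
  simp only [wedge, ContinuousAlternatingMap.smul_apply, real_inner_smul_right, Finset.mul_sum]
  exact Finset.sum_congr rfl fun _ _ => by ring

theorem continuousOn_wedge {k l : ℕ} {T : Type*} [TopologicalSpace T] {s : Set T}
    {ω : T → Alt k X} {ζ : T → Alt l X} (hω : ContinuousOn ω s) (hζ : ContinuousOn ζ s)
    (v : Fin (k + l) → V3) : ContinuousOn (fun t => wedge (ω t) (ζ t) v) s := by
  unfold wedge
  refine continuousOn_finsetSum _ fun σ _ => continuousOn_const.mul (ContinuousOn.inner ?_ ?_)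
  · exact (ContinuousAlternatingMap.apply ℝ V3 X _).continuous.comp_continuousOn hω
  · exact (ContinuousAlternatingMap.apply ℝ V3 X _).continuous.comp_continuousOn hζ

/-- The wedge product `ω ∧ ζ` is an alternating form for the pairs of degrees `(k, l)` that occur
in the degrees of freedom of 1-forms and 2-forms. -/
def WedgeAlternating (k l : ℕ) (X : Type) [NormedAddCommGroup X] [InnerProductSpace ℝ X] : Prop :=
  ∀ (ω : Alt k X) (ζ : Alt l X), ∃ Ψ : V3 [⋀^Fin (k + l)]→ₗ[ℝ] ℝ, ∀ v, wedge ω ζ v = Ψ v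

/-- The linear map `u ↦ ⟨ω u, ζ (·, …, ·)⟩`. -/
noncomputable def innerAlternating {l : ℕ} (ω : Alt 1 X) (ζ : Alt l X) :
    V3 →ₗ[ℝ] V3 [⋀^Fin l]→ₗ[ℝ] ℝ where
  toFun u := (innerSL ℝ (ω.curryLeft u ![])).toLinearMap.compAlternatingMap ζ.toAlternatingMap
  map_add' u u' := by
    ext v
    rw [map_add, ContinuousAlternatingMap.add_apply, map_add]; rfl
  map_smul' c u := by
    ext v
    rw [map_smul, ContinuousAlternatingMap.smul_apply, map_smul]; rfl

theorem innerAlternating_apply {l : ℕ} (ω : Alt 1 X) (ζ : Alt l X) (u : V3) (v : Fin l → V3) :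
    innerAlternating ω ζ u v = inner ℝ (ω ![u]) (ζ v) := rfl

theorem wedgeAlternating_one_zero : WedgeAlternating 1 0 X := by
  intro ω ζ
  refine ⟨AlternatingMap.alternatizeUncurryFin (innerAlternating ω ζ), fun v => ?_⟩
  rw [wedge_one_zero, AlternatingMap.alternatizeUncurryFin_apply, Fin.sum_univ_one,
    innerAlternating_apply]
  simp only [Fin.val_zero, pow_zero, one_smul]
  congr 2
  funext i; exact i.elim0

theorem wedgeAlternating_one_one : WedgeAlternating 1 1 X := by
  intro ω ζ
  refine ⟨AlternatingMap.alternatizeUncurryFin (innerAlternating ω ζ), fun v => ?_⟩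
  rw [wedge_one_one, AlternatingMap.alternatizeUncurryFin_apply, Fin.sum_univ_two]
  simp only [innerAlternating_apply, Fin.val_zero, pow_zero, one_smul, Fin.val_one, pow_one,
    neg_smul, ← sub_eq_add_neg]
  congr 3 <;> (funext i; fin_cases i; rfl)

theorem wedgeAlternating_one_two : WedgeAlternating 1 2 X := by
  intro ω ζ
  refine ⟨AlternatingMap.alternatizeUncurryFin (innerAlternating ω ζ), fun v => ?_⟩
  rw [wedge_one_two, AlternatingMap.alternatizeUncurryFin_apply, Fin.sum_univ_three]
  simp only [innerAlternating_apply, Fin.val_zero, pow_zero, one_smul, Fin.val_one, pow_one,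
    neg_smul, ← sub_eq_add_neg, Fin.val_two, even_two, Even.neg_pow, one_pow]
  congr 3
  · congr 1; funext i; fin_cases i <;> rfl
  · congr 1; funext i; fin_cases i <;> rfl
  · funext i; fin_cases i <;> rfl

theorem wedgeAlternating_two_zero : WedgeAlternating 2 0 X := by
  intro ω ζ
  refine ⟨(innerSL ℝ (ζ ![])).toLinearMap.compAlternatingMap ω.toAlternatingMap, fun v => ?_⟩
  rw [wedge_two_zero]
  change _ = inner ℝ (ζ ![]) (ω v)
  rw [real_inner_comm]
  congr 2
  funext i; fin_cases i <;> rfl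

theorem wedgeAlternating_two_one : WedgeAlternating 2 1 X := by
  intro ω ζ
  refine ⟨AlternatingMap.alternatizeUncurryFin (innerAlternating ζ ω), fun v => ?_⟩
  rw [wedge_two_one, AlternatingMap.alternatizeUncurryFin_apply, Fin.sum_univ_three]
  simp only [innerAlternating_apply, Fin.val_zero, pow_zero, one_smul, Fin.val_one, pow_one,
    neg_smul, ← sub_eq_add_neg, Fin.val_two, even_two, Even.neg_pow, one_pow]
  rw [real_inner_comm, real_inner_comm _ (ω ![v 0, v 2]), real_inner_comm _ (ω ![v 0, v 1])]
  congr 3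
  · congr 1; funext i; fin_cases i <;> rfl
  · congr 1; funext i; fin_cases i <;> rfl
  · funext i; fin_cases i <;> rfl

end Wedge

/-! ### Integration over simplices -/

section RefSimplex

variable {d : ℕ}

/-- The barycentric coordinates of a point of the reference simplex. -/
def bary (t : Fin d → ℝ) : Fin (d + 1) → ℝ := Fin.cons (1 - ∑ i, t i) t

@[simp] theorem bary_zero (t : Fin d → ℝ) : bary t 0 = 1 - ∑ i, t i := rfl

@[simp] theorem bary_succ (t : Fin d → ℝ) (i : Fin d) : bary t i.succ = t i := rfl

theorem sum_bary (t : Fin d → ℝ) : ∑ i, bary t i = 1 := by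
  simp [Fin.sum_univ_succ]

theorem mem_refSimplex_iff {t : Fin d → ℝ} : t ∈ refSimplex d ↔ ∀ i, 0 ≤ bary t i := by
  rw [Fin.forall_fin_succ]
  simp [refSimplex, and_comm]

theorem continuous_bary (i : Fin (d + 1)) : Continuous fun t : Fin d → ℝ => bary t i := by
  refine Fin.cases ?_ (fun i => ?_) i
  · simp only [bary_zero]; fun_prop
  · simp only [bary_succ]; fun_prop

theorem simplexParam_eq_sum (v : Fin (d + 1) → V3) (t : Fin d → ℝ) :
    simplexParam v t = ∑ i, bary t i • v i := by
  rw [simplexParam, Fin.sum_univ_succ]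
  simp only [bary_zero, bary_succ, smul_sub, Finset.sum_sub_distrib, sub_smul, Finset.sum_smul,
    one_smul]
  abel

theorem continuous_simplexParam (v : Fin (d + 1) → V3) : Continuous (simplexParam v) := by
  unfold simplexParam; fun_prop

/-- The points of the reference simplex with positive barycentric coordinates. -/
def refInterior (d : ℕ) : Set (Fin d → ℝ) := {t | ∀ i, 0 < bary t i}

theorem refInterior_subset : refInterior d ⊆ refSimplex d :=
  fun _ ht => mem_refSimplex_iff.2 fun i => (ht i).le

theorem isOpen_refInterior : IsOpen (refInterior d) := by
  rw [show refInterior d = ⋂ i, {t | 0 < bary t i} by ext; simp [refInterior]]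
  exact isOpen_iInter_of_finite fun i => isOpen_lt continuous_const (continuous_bary i)

theorem refInterior_nonempty : (refInterior d).Nonempty := by
  refine ⟨fun _ => 1 / (d + 1), fun i => ?_⟩
  refine Fin.cases ?_ (fun i => ?_) i
  · simp only [bary_zero, Finset.sum_const, Finset.card_univ, Fintype.card_fin, nsmul_eq_mul]
    rw [sub_pos, mul_one_div, div_lt_one (by positivity)]
    linarith
  · simp only [bary_succ]; positivity

theorem isClosed_refSimplex : IsClosed (refSimplex d) := by
  rw [show refSimplex d = ⋂ i, {t | 0 ≤ bary t i} by ext; simp [mem_refSimplex_iff]]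
  exact isClosed_iInter fun i => isClosed_le continuous_const (continuous_bary i)

theorem isCompact_refSimplex : IsCompact (refSimplex d) := by
  refine (isCompact_Icc (a := (0 : Fin d → ℝ)) (b := 1)).of_isClosed_subset isClosed_refSimplex ?_
  intro t ht
  refine ⟨fun i => ht.1 i, fun i => ?_⟩
  exact (Finset.single_le_sum (fun j _ => ht.1 j) (Finset.mem_univ i)).trans ht.2

theorem volume_refSimplex_ne_zero : volume (refSimplex d) ≠ 0 :=
  ((isOpen_refInterior.measure_pos volume refInterior_nonempty).trans_le
    (measure_mono refInterior_subset)).ne'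

theorem volume_refSimplex_ne_top : volume (refSimplex d) ≠ ⊤ :=
  isCompact_refSimplex.measure_lt_top.ne

/-- A nonnegative continuous function with vanishing integral vanishes in the interior. -/
theorem eq_zero_of_integral_refSimplex {f : (Fin d → ℝ) → ℝ} (hf : ContinuousOn f (refSimplex d))
    (h0 : ∀ t ∈ refSimplex d, 0 ≤ f t) (h : ∫ t in refSimplex d, f t = 0) {t : Fin d → ℝ}
    (ht : t ∈ refInterior d) : f t = 0 := by
  have hint : IntegrableOn f (refSimplex d) := hf.integrableOn_compact isCompact_refSimplex
  rw [integral_eq_zero_iff_of_nonneg_ae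
    ((ae_restrict_iff' isClosed_refSimplex.measurableSet).2 (.of_forall h0)) hint] at h
  have h2 : f =ᵐ[volume.restrict (refInterior d)] 0 := ae_restrict_of_ae_restrict_of_subset
    refInterior_subset h
  exact Measure.eqOn_open_of_ae_eq h2 isOpen_refInterior (hf.mono refInterior_subset)
    continuousOn_const ht

/-- The affine map of the reference simplex that permutes the barycentric coordinates. -/
def permMap (π : Equiv.Perm (Fin (d + 1))) (t : Fin d → ℝ) : Fin d → ℝ :=
  fun i => bary t (π.symm i.succ)

theorem bary_permMap (π : Equiv.Perm (Fin (d + 1))) (t : Fin d → ℝ) (i : Fin (d + 1)) :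
    bary (permMap π t) i = bary t (π.symm i) := by
  have h : ∀ i : Fin d, bary (permMap π t) i.succ = bary t (π.symm i.succ) := fun i => rfl
  refine Fin.cases ?_ h i
  have h1 := sum_bary (permMap π t)
  have h2 := sum_bary t
  rw [← Equiv.sum_comp π.symm, Fin.sum_univ_succ] at h2
  rw [Fin.sum_univ_succ] at h1
  simp only [h] at h1
  linarith

theorem permMap_symm (π : Equiv.Perm (Fin (d + 1))) (t : Fin d → ℝ) :
    permMap π (permMap π.symm t) = t := by
  funext i
  rw [permMap, bary_permMap]; simp

theorem permMap_mem {π : Equiv.Perm (Fin (d + 1))} {t : Fin d → ℝ} (ht : t ∈ refSimplex d) :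
    permMap π t ∈ refSimplex d := by
  rw [mem_refSimplex_iff] at ht ⊢
  intro i
  rw [bary_permMap]; exact ht _

theorem permMap_image (π : Equiv.Perm (Fin (d + 1))) :
    permMap π '' refSimplex d = refSimplex d := by
  refine Set.Subset.antisymm ?_ fun t ht => ⟨permMap π.symm t, permMap_mem ht, permMap_symm π t⟩
  rintro _ ⟨t, ht, rfl⟩
  exact permMap_mem ht

theorem permMap_injective (π : Equiv.Perm (Fin (d + 1))) : Function.Injective (permMap π) := by
  intro s t h
  have := congrArg (permMap π.symm) h
  have h1 := permMap_symm π.symm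
  rw [Equiv.symm_symm] at h1
  rwa [h1, h1] at this

theorem simplexParam_permMap (v : Fin (d + 1) → V3) (π : Equiv.Perm (Fin (d + 1)))
    (t : Fin d → ℝ) : simplexParam v (permMap π t) = simplexParam (v ∘ π) t := by
  rw [simplexParam_eq_sum, simplexParam_eq_sum, ← Equiv.sum_comp π]
  simp [bary_permMap]

/-- The integral over the reference simplex is invariant under permutations of the vertices. As
the permuting affine map preserves the simplex, its Jacobian has to be one. -/
theorem integral_permMap {E : Type*} [NormedAddCommGroup E] [NormedSpace ℝ E]
    (π : Equiv.Perm (Fin (d + 1))) (f : (Fin d → ℝ) → E) :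
    ∫ t in refSimplex d, f (permMap π t) = ∫ t in refSimplex d, f t := by
  let Λ : (Fin d → ℝ) →L[ℝ] (Fin (d + 1) → ℝ) := ContinuousLinearMap.pi
    (Fin.cons (-∑ i, ContinuousLinearMap.proj i) fun i => ContinuousLinearMap.proj i)
  have hΛ : ∀ t i, bary t i = bary (0 : Fin d → ℝ) i + Λ t i := by
    intro t i
    refine Fin.cases ?_ (fun i => ?_) i
    · simp [Λ, sub_eq_add_neg]
    · simp [Λ]
  let M : (Fin d → ℝ) →L[ℝ] (Fin d → ℝ) :=
    ContinuousLinearMap.pi fun i => (ContinuousLinearMap.proj (π.symm i.succ)).comp Λ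
  have hM : permMap π = fun t => permMap π 0 + M t := by
    funext t i
    exact hΛ t _
  have hd : ∀ t ∈ refSimplex d, HasFDerivWithinAt (permMap π) M (refSimplex d) t := by
    intro t _
    rw [hM]
    exact (M.hasFDerivWithinAt).const_add _
  have key : ∀ {E : Type _} [NormedAddCommGroup E] [NormedSpace ℝ E] (f : (Fin d → ℝ) → E),
      ∫ t in refSimplex d, f t = |M.det| • ∫ t in refSimplex d, f (permMap π t) := by
    intro E _ _ f
    have := integral_image_eq_integral_abs_det_fderiv_smul volume
      isClosed_refSimplex.measurableSet hd (permMap_injective π).injOn f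
    rw [permMap_image, integral_smul] at this
    exact this
  have h1 : |M.det| = 1 := by
    have := integral_image_eq_integral_abs_det_fderiv_smul volume
      isClosed_refSimplex.measurableSet hd (permMap_injective π).injOn (fun _ => (1 : ℝ))
    rw [permMap_image, integral_smul, setIntegral_const, smul_eq_mul, smul_eq_mul, mul_one] at this
    have hv : volume.real (refSimplex d) ≠ 0 :=
      (ENNReal.toReal_pos volume_refSimplex_ne_zero volume_refSimplex_ne_top).ne'
    exact (mul_right_cancel₀ hv (by linarith)).symm
  rw [key f, h1, one_smul]

theorem integral_simplexParam_perm {E : Type*} [NormedAddCommGroup E] [NormedSpace ℝ E]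
    (π : Equiv.Perm (Fin (d + 1))) (v : Fin (d + 1) → V3) (f : V3 → E) :
    ∫ t in refSimplex d, f (simplexParam (v ∘ π) t) = ∫ t in refSimplex d, f (simplexParam v t) := by
  rw [← integral_permMap π fun t => f (simplexParam v t)]
  simp_rw [simplexParam_permMap]

/-- Reordering the vertices of a simplex changes the integral of `ω ∧ ζ` by a constant factor. -/
theorem exists_simplexPairing_perm {k l : ℕ} {X : Type} [NormedAddCommGroup X]
    [InnerProductSpace ℝ X] (hkl : WedgeAlternating k l X) (π : Equiv.Perm (Fin (k + l + 1))) :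
    ∃ c : ℝ, ∀ (v : Fin (k + l + 1) → V3) (ω : V3 → Alt k X) (ζ : V3 → Alt l X),
      simplexPairing (v ∘ π) ω ζ = c * simplexPairing v ω ζ := by
  let E : Fin (k + l + 1) → Fin (k + l) → ℝ := Fin.cons 0 fun i => Pi.single i 1
  let m : Fin (k + l) → Fin (k + l) → ℝ := fun i => E (π i.succ) - E (π 0)
  refine ⟨(Pi.basisFun ℝ (Fin (k + l))).det m, fun v ω ζ => ?_⟩
  let L : (Fin (k + l) → ℝ) →ₗ[ℝ] V3 :=
    ∑ i, (LinearMap.proj i : (Fin (k + l) → ℝ) →ₗ[ℝ] ℝ).smulRight (v i.succ - v 0)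
  have hE : ∀ i, L (E i) = v i - v 0 := by
    intro i
    refine Fin.cases ?_ (fun i => ?_) i
    · simp [E]
    · simp [L, E, Pi.single_apply]
  have hm : ∀ i, L (m i) = (v ∘ π) i.succ - (v ∘ π) 0 := by
    intro i
    simp [m, hE]
  have key : ∀ (α : Alt k X) (β : Alt l X),
      wedge α β (fun i => (v ∘ π) i.succ - (v ∘ π) 0) =
        (Pi.basisFun ℝ (Fin (k + l))).det m * wedge α β (fun i => v i.succ - v 0) := by
    intro α β
    obtain ⟨Ψ, hΨ⟩ := hkl α β
    rw [hΨ, hΨ]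
    have h1 := (Ψ.compLinearMap L).eq_smul_basis_det (Pi.basisFun ℝ (Fin (k + l)))
    have h2 := congrArg (fun f : (Fin (k + l) → ℝ) [⋀^Fin (k + l)]→ₗ[ℝ] ℝ => f m) h1
    simp only [AlternatingMap.compLinearMap_apply, AlternatingMap.smul_apply, smul_eq_mul] at h2
    have h3 : (fun i => L (m i)) = fun i => (v ∘ π) i.succ - (v ∘ π) 0 := funext hm
    have h4 : (fun i => L ((Pi.basisFun ℝ (Fin (k + l))) i)) = fun i => v i.succ - v 0 := by
      funext i
      have := hE i.succ
      simpa [E] using this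
    rw [h3, h4] at h2
    rw [h2]; ring
  rw [simplexPairing, simplexPairing]
  simp_rw [key]
  rw [integral_const_mul, integral_simplexParam_perm π v fun x =>
    wedge (ω x) (ζ x) fun i => v i.succ - v 0]

end RefSimplex

section FaceCoordinates

variable {ι : Type} [Fintype ι] (b : AffineBasis ι ℝ V3) {d : ℕ} (c : Fin (d + 1) → ι)

theorem coord_simplexParam (i : ι) (t : Fin d → ℝ) :
    b.coord i (simplexParam (b ∘ c) t) = ∑ a, bary t a * b.coord i (b (c a)) := by
  rw [simplexParam, coord_add, map_sum, Fin.sum_univ_succ]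
  simp only [map_smul, smul_eq_mul, Function.comp_apply, dcoord_sub, bary_zero, bary_succ, mul_sub,
    Finset.sum_sub_distrib, sub_mul, Finset.sum_mul]
  ring

theorem coord_simplexParam_apply {c : Fin (d + 1) → ι} (hc : Function.Injective c)
    (a : Fin (d + 1)) (t : Fin d → ℝ) : b.coord (c a) (simplexParam (b ∘ c) t) = bary t a := by
  classical
  rw [coord_simplexParam, Finset.sum_eq_single a]
  · simp
  · intro a' _ h
    rw [b.coord_apply_ne (hc.ne h.symm), mul_zero]
  · simp

theorem coord_simplexParam_of_notMem {i : ι} (hi : ∀ a, c a ≠ i) (t : Fin d → ℝ) :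
    b.coord i (simplexParam (b ∘ c) t) = 0 := by
  rw [coord_simplexParam, Finset.sum_eq_zero]
  intro a _
  rw [b.coord_apply_ne (hi a).symm, mul_zero]

theorem exists_simplexParam_eq {c : Fin (d + 1) → ι} (hc : Function.Injective c) {x : V3}
    (hx : ∀ i, (∀ a, c a ≠ i) → b.coord i x = 0) :
    ∃ t, simplexParam (b ∘ c) t = x ∧ ∀ a, bary t a = b.coord (c a) x := by
  have h1 : ∑ a, b.coord (c a) x = 1 := by
    classical
    rw [← b.sum_coord_apply_eq_one x, ← Finset.sum_image (s := Finset.univ) (g := c)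
      (f := fun i => b.coord i x) (fun a _ a' _ h => hc h)]
    refine Finset.sum_subset (Finset.subset_univ _) fun i _ hi => hx i fun a ha => hi ?_
    exact Finset.mem_image.2 ⟨a, Finset.mem_univ a, ha⟩
  have h2 : ∀ a, bary (fun i : Fin d => b.coord (c i.succ) x) a = b.coord (c a) x := by
    intro a
    refine Fin.cases ?_ (fun a => rfl) a
    rw [Fin.sum_univ_succ] at h1
    rw [bary_zero]; linarith
  refine ⟨fun i => b.coord (c i.succ) x, b.ext_elem fun i => ?_, h2⟩
  by_cases hi : ∀ a, c a ≠ i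
  · rw [coord_simplexParam_of_notMem b c hi, hx i hi]
  · push Not at hi
    obtain ⟨a, rfl⟩ := hi
    rw [coord_simplexParam_apply b hc, h2]

theorem dcoord_edge {c : Fin (d + 1) → ι} (hc : Function.Injective c) (a j : Fin (d + 1)) :
    dcoord b (c a) (b (c j) - b (c 0)) =
      (if a = j then 1 else 0) - if a = 0 then 1 else 0 := by
  classical
  rw [dcoord_sub, b.coord_apply, b.coord_apply]
  simp [hc.eq_iff]

theorem dcoord_edge_of_notMem {i : ι} (hi : ∀ a, c a ≠ i) (j : Fin d) :
    dcoord b i (b (c j.succ) - b (c 0)) = 0 := by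
  rw [dcoord_sub, b.coord_apply_ne (hi _).symm, b.coord_apply_ne (hi _).symm, sub_zero]

end FaceCoordinates

/-! ### Unisolvence on a single face -/

theorem PPlus.contDiff {X : Type} [NormedAddCommGroup X] [NormedSpace ℝ X] {s : ℤ} {k : ℕ}
    {ω : V3 → Alt k X} (hω : ω ∈ PPlus s k X) {n : WithTop ℕ∞} : ContDiff ℝ n ω := by
  obtain ⟨α, hα, κ, hκ, rfl⟩ := Submodule.mem_sup.1 hω
  obtain ⟨β, hβ, rfl⟩ := Submodule.mem_map.1 hκ
  refine (PolyMap.contDiff hα).add ?_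
  have h1 : ContDiff ℝ n fun x =>
      (ContinuousAlternatingMap.curryLeftLI (𝕜 := ℝ) (E := V3) (F := X) (n := k)
        ).toContinuousLinearMap (β x) :=
    (ContinuousLinearMap.contDiff _).comp (PolyMap.contDiff hβ)
  exact h1.clm_apply contDiff_id

section Pairing

variable {X : Type} [NormedAddCommGroup X] [InnerProductSpace ℝ X] {k l : ℕ}
  {v : Fin (k + l + 1) → V3} {ω ω' : V3 → Alt k X} {ζ ζ' : V3 → Alt l X}

/-- Continuity on the simplex with vertices `v`. -/
def ContinuousOnSimplex {d : ℕ} {E : Type*} [TopologicalSpace E] (v : Fin (d + 1) → V3)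
    (f : V3 → E) : Prop :=
  ContinuousOn (fun t => f (simplexParam v t)) (refSimplex d)

theorem Continuous.onSimplex {d : ℕ} {E : Type*} [TopologicalSpace E] {f : V3 → E}
    (hf : Continuous f) (v : Fin (d + 1) → V3) : ContinuousOnSimplex v f :=
  (hf.comp (continuous_simplexParam v)).continuousOn

theorem PPlus.onSimplex {s : ℤ} (hω : ω ∈ PPlus s k X) {d : ℕ} (v : Fin (d + 1) → V3) :
    ContinuousOnSimplex v ω :=
  Continuous.onSimplex (PPlus.contDiff hω (n := 0)).continuous v

theorem PolyMap.onSimplex {s : ℤ} (hζ : ζ ∈ PolyMap s (Alt l X)) {d : ℕ} (v : Fin (d + 1) → V3) :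
    ContinuousOnSimplex v ζ :=
  Continuous.onSimplex (PolyMap.contDiff hζ (n := 0)).continuous v

theorem integrableOn_pairing (hω : ContinuousOnSimplex v ω) (hζ : ContinuousOnSimplex v ζ) :
    IntegrableOn (fun t => wedge (ω (simplexParam v t)) (ζ (simplexParam v t))
      fun i => v i.succ - v 0) (refSimplex (k + l)) :=
  (continuousOn_wedge hω hζ _).integrableOn_compact isCompact_refSimplex

theorem simplexPairing_add_left (hω : ContinuousOnSimplex v ω) (hω' : ContinuousOnSimplex v ω')
    (hζ : ContinuousOnSimplex v ζ) :
    simplexPairing v (ω + ω') ζ = simplexPairing v ω ζ + simplexPairing v ω' ζ := by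
  simp only [simplexPairing, Pi.add_apply, wedge_add_left]
  exact integral_add (integrableOn_pairing hω hζ) (integrableOn_pairing hω' hζ)

theorem simplexPairing_add_right (hω : ContinuousOnSimplex v ω) (hζ : ContinuousOnSimplex v ζ)
    (hζ' : ContinuousOnSimplex v ζ') :
    simplexPairing v ω (ζ + ζ') = simplexPairing v ω ζ + simplexPairing v ω ζ' := by
  simp only [simplexPairing, Pi.add_apply, wedge_add_right]
  exact integral_add (integrableOn_pairing hω hζ) (integrableOn_pairing hω hζ')

theorem simplexPairing_smul_left (a : ℝ) :
    simplexPairing v (a • ω) ζ = a * simplexPairing v ω ζ := by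
  simp only [simplexPairing, Pi.smul_apply, wedge_smul_left, integral_const_mul]

theorem simplexPairing_smul_right (a : ℝ) :
    simplexPairing v ω (a • ζ) = a * simplexPairing v ω ζ := by
  simp only [simplexPairing, Pi.smul_apply, wedge_smul_right, integral_const_mul]

theorem simplexPairing_sub_left (hω : ContinuousOnSimplex v ω) (hω' : ContinuousOnSimplex v ω')
    (hζ : ContinuousOnSimplex v ζ) :
    simplexPairing v (ω - ω') ζ = simplexPairing v ω ζ - simplexPairing v ω' ζ := by
  have h : ω - ω' = ω + (-1 : ℝ) • ω' := by rw [neg_one_smul, sub_eq_add_neg]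
  have h' : ContinuousOnSimplex v ((-1 : ℝ) • ω') := ContinuousOn.const_smul hω' (-1 : ℝ)
  rw [h, simplexPairing_add_left hω h' hζ, simplexPairing_smul_left]
  ring

theorem simplexPairing_congr
    (h : ∀ t ∈ refSimplex (k + l), wedge (ω (simplexParam v t)) (ζ (simplexParam v t))
      (fun i => v i.succ - v 0) = wedge (ω' (simplexParam v t)) (ζ' (simplexParam v t))
      fun i => v i.succ - v 0) :
    simplexPairing v ω ζ = simplexPairing v ω' ζ' :=
  setIntegral_congr_fun isClosed_refSimplex.measurableSet h

end Pairing

theorem exists_apply_eq_of_forall_dual {E V : Type*} [AddCommGroup E] [Module ℝ E] [AddCommGroup V]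
    [Module ℝ V] [FiniteDimensional ℝ V] (R : E →ₗ[ℝ] Module.Dual ℝ V) (φ : Module.Dual ℝ V)
    (h : ∀ z, (∀ e, R e z = 0) → φ z = 0) : ∃ e, R e = φ := by
  have key : φ ∈ (LinearMap.range R).dualCoannihilator.dualAnnihilator := by
    rw [Submodule.mem_dualAnnihilator]
    intro z hz
    rw [Submodule.mem_dualCoannihilator] at hz
    exact h z fun e => hz (R e) ⟨e, rfl⟩
  rwa [Subspace.dualCoannihilator_dualAnnihilator_eq] at key

section FaceSystem

variable {ι : Type} [Fintype ι] [DecidableEq ι] (b : AffineBasis ι ℝ V3)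

section Bubble

variable {X : Type} [NormedAddCommGroup X] [NormedSpace ℝ X] {k : ℕ}

/-- The Whitney form of the vertices `τ`, times the barycentric coordinates of the remaining
vertices of `F`. -/
noncomputable def bubbleWhitney (F : Finset ι) (τ : Fin (k + 1) → ι) (w : X) (x : V3) : Alt k X :=
  (∏ i ∈ F \ Finset.univ.image τ, b.coord i x) • whitney b τ w x

theorem bubbleWhitney_add (F : Finset ι) (τ : Fin (k + 1) → ι) (w w' : X) (x : V3) :
    bubbleWhitney b F τ (w + w') x = bubbleWhitney b F τ w x + bubbleWhitney b F τ w' x := by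
  ext v
  simp [bubbleWhitney, whitney_apply]

theorem bubbleWhitney_smul (F : Finset ι) (τ : Fin (k + 1) → ι) (a : ℝ) (w : X) (x : V3) :
    bubbleWhitney b F τ (a • w) x = a • bubbleWhitney b F τ w x := by
  ext v
  simp only [bubbleWhitney, whitney_apply, ContinuousAlternatingMap.smul_apply, smul_smul]
  congr 1; ring

theorem bubbleWhitney_mem {F : Finset ι} {τ : Fin (k + 1) → ι} (hτ : Function.Injective τ)
    (hF : ∀ a, τ a ∈ F) {s m : ℤ} (hm : s + k + 1 - F.card = m) {q : V3 → X}
    (hq : q ∈ HPoly b F m X) :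
    (fun x => bubbleWhitney b F τ (q x) x) ∈ faceSpace b F s k X := by
  subst hm
  induction hq using Submodule.span_induction with
  | zero =>
    convert Submodule.zero_mem _ using 1
    funext x; ext v; simp [bubbleWhitney, whitney_apply]
  | add g₁ g₂ _ _ h₁ h₂ =>
    simp only [Pi.add_apply, bubbleWhitney_add]; exact Submodule.add_mem _ h₁ h₂
  | smul c g _ h =>
    simp only [Pi.smul_apply, bubbleWhitney_smul]; exact Submodule.smul_mem _ c h
  | mem q hq =>
    obtain ⟨α, w, hα, hm, rfl⟩ := hq
    refine Submodule.subset_span ⟨τ, _, w, hτ, hF, HPoly.monomial_mem α 1 hα hm, ?_⟩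
    funext x
    simp only [bubbleWhitney_smul]
    rw [bubbleWhitney, smul_smul, smul_eq_mul, mul_one, mul_comm]

end Bubble

variable {X : Type} [NormedAddCommGroup X] [InnerProductSpace ℝ X] {k l : ℕ}

/-- A basis of the Whitney forms with bubbles of the face `c`, dual to a basis of the test forms:
`ω ∧ ζ` is the sum of the products of the components `ω (A i)` and `T i ζ`, and the Gram matrix of
the components of the basis is positive definite inside the face. -/
structure FaceSystem (c : Fin (k + l + 1) → ι) (X : Type) [NormedAddCommGroup X]
    [InnerProductSpace ℝ X] where
  /-- The number of basis forms. -/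
  N : ℕ
  /-- The vertices of the Whitney form that belongs to a basis form. -/
  ρ : Fin N → Fin (k + 1) → Fin (k + l + 1)
  ρ_injective : ∀ i, Function.Injective (ρ i)
  /-- The arguments at which the components of a `k`-form are taken. -/
  A : Fin N → Fin k → V3
  /-- The components of a test form. -/
  T : Fin N → Alt l X →ₗ[ℝ] X
  /-- The test form with given components. -/
  Z : (Fin N → X) →ₗ[ℝ] Alt l X
  T_Z : ∀ z i, T i (Z z) = z i
  wedge_eq : ∀ (ω : Alt k X) (ζ : Alt l X),
    wedge ω ζ (fun i => b (c i.succ) - b (c 0)) = ∑ i, inner ℝ (ω (A i)) (T i ζ)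
  span : ∀ τ : Fin (k + 1) → Fin (k + l + 1), Function.Injective τ → ∃ n : Fin N → ℝ,
    ∀ (w : X) (x : V3), bubbleWhitney b (Finset.univ.image c) (c ∘ τ) w x =
      ∑ i, n i • bubbleWhitney b (Finset.univ.image c) (c ∘ ρ i) w x
  nonneg : ∀ t ∈ refSimplex (k + l), ∀ z : Fin N → X, 0 ≤ ∑ i, inner ℝ
    ((∑ j, bubbleWhitney b (Finset.univ.image c) (c ∘ ρ j) (z j) (simplexParam (b ∘ c) t)) (A i))
    (z i)
  definite : ∀ t ∈ refInterior (k + l), ∀ z : Fin N → X, ∑ i, inner ℝ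
    ((∑ j, bubbleWhitney b (Finset.univ.image c) (c ∘ ρ j) (z j) (simplexParam (b ∘ c) t)) (A i))
    (z i) = 0 → z = 0

variable {b} {c : Fin (k + l + 1) → ι}

namespace FaceSystem

variable (D : FaceSystem b c X)

/-- The form with coefficients `q` in the basis. -/
noncomputable def form (q : Fin D.N → V3 → X) (x : V3) : Alt k X :=
  ∑ j, bubbleWhitney b (Finset.univ.image c) (c ∘ D.ρ j) (q j x) x

theorem degree_eq (hc : Function.Injective c) (s : ℤ) :
    s + k + 1 - (Finset.univ.image c).card = s - l := by
  rw [Finset.card_image_of_injective _ hc, Finset.card_univ, Fintype.card_fin]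
  push_cast; ring

theorem form_mem (hc : Function.Injective c) {s : ℤ} {q : Fin D.N → V3 → X}
    (hq : ∀ i, q i ∈ HPoly b (Finset.univ.image c) (s - l) X) :
    D.form q ∈ faceSpace b (Finset.univ.image c) s k X := by
  have h : D.form q = ∑ j, fun x =>
      bubbleWhitney b (Finset.univ.image c) (c ∘ D.ρ j) (q j x) x := by
    funext x; simp [form]
  rw [h]
  exact Submodule.sum_mem _ fun j _ => bubbleWhitney_mem b (q := q j) (τ := c ∘ D.ρ j) (hc.comp (D.ρ_injective j))
    (fun a => Finset.mem_image_of_mem c (Finset.mem_univ (D.ρ j a))) (degree_eq hc s) (hq j)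

theorem exists_form (hc : Function.Injective c) {s : ℤ} {ω : V3 → Alt k X}
    (hω : ω ∈ faceSpace b (Finset.univ.image c) s k X) :
    ∃ q : Fin D.N → V3 → X, (∀ i, q i ∈ HPoly b (Finset.univ.image c) (s - l) X) ∧
      ω = D.form q := by
  induction hω using Submodule.span_induction with
  | zero =>
    refine ⟨fun _ _ => 0, fun i => Submodule.zero_mem _, ?_⟩
    funext x; ext v; simp [form, bubbleWhitney, whitney_apply]
  | add g₁ g₂ _ _ h₁ h₂ =>
    obtain ⟨q, hq, rfl⟩ := h₁
    obtain ⟨q', hq', rfl⟩ := h₂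
    refine ⟨fun i x => q i x + q' i x, fun i => Submodule.add_mem _ (hq i) (hq' i), ?_⟩
    funext x
    simp only [form, bubbleWhitney_add, Finset.sum_add_distrib, Pi.add_apply]
  | smul a g _ h =>
    obtain ⟨q, hq, rfl⟩ := h
    refine ⟨fun i x => a • q i x, fun i => Submodule.smul_mem _ a (hq i), ?_⟩
    funext x
    simp only [form, bubbleWhitney_smul, Finset.smul_sum, Pi.smul_apply]
  | mem ω hω =>
    obtain ⟨τ, h, w, hτ, hF, hh, rfl⟩ := hω
    have hF' : ∀ a, ∃ j, c j = τ a := fun a => by simpa using hF a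
    choose σ hσ using hF'
    have hτσ : τ = c ∘ σ := funext fun a => (hσ a).symm
    obtain ⟨n, hn⟩ := D.span σ fun a a' e => hτ (by rw [← hσ, ← hσ, e])
    refine ⟨fun i x => h x • (n i • w), fun i => ?_, ?_⟩
    · have := HPoly.map ((LinearMap.id : ℝ →ₗ[ℝ] ℝ).smulRight (n i • w)) hh
      rw [degree_eq hc s] at this
      exact this
    · funext x
      simp only [form, bubbleWhitney_smul]
      rw [← Finset.smul_sum, ← hn, ← hτσ, bubbleWhitney, smul_smul, mul_comm]

theorem coord_eq_zero_of_notMem (t : Fin (k + l) → ℝ) {i : ι} (hi : i ∉ Finset.univ.image c) :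
    b.coord i (simplexParam (b ∘ c) t) = 0 :=
  coord_simplexParam_of_notMem b c
    (fun a h => hi (Finset.mem_image.2 ⟨a, Finset.mem_univ a, h⟩)) t

/-- Positive definiteness: if the form with coefficients `q` is orthogonal to test forms with
components `q` on the face, then `q` vanishes. -/
theorem coeff_eq_zero (hc : Function.Injective c) {m : ℤ} {q : Fin D.N → V3 → X}
    (hq : ∀ i, q i ∈ HPoly b (Finset.univ.image c) m X) {ζ : V3 → Alt l X}
    (hζ : ∀ t i, D.T i (ζ (simplexParam (b ∘ c) t)) = q i (simplexParam (b ∘ c) t))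
    (h : simplexPairing (b ∘ c) (D.form q) ζ = 0) : q = 0 := by
  have hqc : ∀ i, Continuous (q i) := fun i =>
    (PolyMap.contDiff (HPoly.le_polyMap (hq i)) (n := 0)).continuous
  have hform : Continuous (D.form q) :=
    (PPlus.contDiff (faceSpace_le_PPlus b _ (m + l) (D.form_mem hc (s := m + l)
      (by simpa using hq))) (n := 0)).continuous
  let f : (Fin (k + l) → ℝ) → ℝ := fun t => ∑ i, inner ℝ
    (D.form q (simplexParam (b ∘ c) t) (D.A i)) (q i (simplexParam (b ∘ c) t))
  have hf : Continuous f := by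
    refine continuous_finsetSum _ fun i _ => Continuous.inner ?_ ?_
    · exact (ContinuousAlternatingMap.apply ℝ V3 X (D.A i)).continuous.comp
        (hform.comp (continuous_simplexParam _))
    · exact (hqc i).comp (continuous_simplexParam _)
  have h0 : ∫ t in refSimplex (k + l), f t = 0 := by
    rw [← h]
    refine setIntegral_congr_fun isClosed_refSimplex.measurableSet fun t _ => ?_
    have := D.wedge_eq (D.form q (simplexParam (b ∘ c) t)) (ζ (simplexParam (b ∘ c) t))
    simp only [hζ] at this
    exact this.symm
  have key : ∀ t ∈ refInterior (k + l), ∀ i, q i (simplexParam (b ∘ c) t) = 0 := by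
    intro t ht i
    have h1 := eq_zero_of_integral_refSimplex hf.continuousOn
      (fun t ht => D.nonneg t ht fun i => q i (simplexParam (b ∘ c) t)) h0 ht
    exact congrFun (D.definite t ht (fun i => q i (simplexParam (b ∘ c) t)) h1) i
  funext i
  refine HPoly.eq_zero (F := Finset.univ.image c) (Finset.image_nonempty.2 Finset.univ_nonempty)
    (hq i) fun x hx hx' => ?_
  obtain ⟨t, rfl, ht⟩ := exists_simplexParam_eq b hc (x := x)
    fun i hi => hx' i (by simpa using hi)
  refine key t (fun a => ?_) i
  rw [ht]
  exact hx _ (Finset.mem_image_of_mem _ (Finset.mem_univ _))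

/-- The contribution of a face is determined by the degrees of freedom on this face. -/
theorem eq_zero (D : FaceSystem b c X) (hc : Function.Injective c) {s : ℤ} {ω : V3 → Alt k X}
    (hω : ω ∈ faceSpace b (Finset.univ.image c) s k X)
    (h : ∀ ζ ∈ PolyMap (s - l) (Alt l X), simplexPairing (b ∘ c) ω ζ = 0) : ω = 0 := by
  obtain ⟨q, hq, rfl⟩ := D.exists_form hc hω
  have hζ : (fun x => D.Z fun i => q i x) ∈ PolyMap (s - l) (Alt l X) := by
    have e : (fun x => D.Z fun i => q i x) =
        ∑ j, fun x => (D.Z ∘ₗ LinearMap.single ℝ (fun _ => X) j) (q j x) := by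
      funext x
      rw [Finset.sum_apply]
      simp only [LinearMap.comp_apply]
      rw [← map_sum]
      congr 1
      funext i
      simp [Finset.sum_apply, Pi.single_apply]
    rw [e]
    exact Submodule.sum_mem _ fun j _ => PolyMap.map _ (HPoly.le_polyMap (hq j))
  have := D.coeff_eq_zero hc hq (fun t i => D.T_Z _ i) (h _ hζ)
  subst this
  funext x; ext v; simp [form, bubbleWhitney, whitney_apply]

/-- The degrees of freedom on a face can be prescribed by an arbitrary continuous form. -/
theorem exists_eq (D : FaceSystem b c X) (hc : Function.Injective c) [FiniteDimensional ℝ (Alt l X)] (s : ℤ)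
    {η : V3 → Alt k X} (hη : ContinuousOnSimplex (b ∘ c) η) :
    ∃ ω ∈ faceSpace b (Finset.univ.image c) s k X, ∀ ζ ∈ PolyMap (s - l) (Alt l X),
      simplexPairing (b ∘ c) ω ζ = simplexPairing (b ∘ c) η ζ := by
  have hcont : ∀ ω ∈ faceSpace b (Finset.univ.image c) s k X, ContinuousOnSimplex (b ∘ c) ω :=
    fun ω hω => PPlus.onSimplex (faceSpace_le_PPlus b _ s hω) _
  have hfin : FiniteDimensional ℝ (PolyMap (s - l) (Alt l X)) := by
    have := HPoly.finiteDimensional (W := Alt l X) b Finset.univ (s - l)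
    exact Submodule.finiteDimensional_of_le (PolyMap.le_hpoly_univ b)
  let P : (ω : V3 → Alt k X) → ContinuousOnSimplex (b ∘ c) ω →
      Module.Dual ℝ (PolyMap (s - l) (Alt l X)) := fun ω hω =>
    { toFun := fun ζ => simplexPairing (b ∘ c) ω ζ
      map_add' := fun ζ ζ' => simplexPairing_add_right hω (PolyMap.onSimplex ζ.2 _)
        (PolyMap.onSimplex ζ'.2 _)
      map_smul' := fun a ζ => simplexPairing_smul_right a }
  let R : faceSpace b (Finset.univ.image c) s k X →ₗ[ℝ]
      Module.Dual ℝ (PolyMap (s - l) (Alt l X)) :=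
    { toFun := fun ω => P ω (hcont ω ω.2)
      map_add' := fun ω ω' => LinearMap.ext fun ζ => simplexPairing_add_left (hcont ω ω.2)
        (hcont ω' ω'.2) (PolyMap.onSimplex ζ.2 _)
      map_smul' := fun a ω => LinearMap.ext fun ζ => simplexPairing_smul_left a }
  have key : ∃ ω, R ω = P η hη := by
    refine exists_apply_eq_of_forall_dual R _ fun ζ hζ => ?_
    have hT : ∀ i, ∃ q ∈ HPoly b (Finset.univ.image c) (s - l) X, ∀ x,
        (∀ i ∉ Finset.univ.image c, b.coord i x = 0) → q x = D.T i (ζ.1 x) := fun i =>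
      PolyMap.exists_hpoly (PolyMap.map (D.T i) ζ.2) _
    choose q hq hqT using hT
    have hqT' : ∀ t i, D.T i (ζ.1 (simplexParam (b ∘ c) t)) = q i (simplexParam (b ∘ c) t) :=
      fun t i => (hqT i _ fun j hj => coord_eq_zero_of_notMem t hj).symm
    have h0 : q = 0 := by
      refine D.coeff_eq_zero hc hq hqT' ?_
      exact hζ ⟨D.form q, D.form_mem hc hq⟩
    change simplexPairing (b ∘ c) η ζ.1 = 0
    rw [simplexPairing]
    refine (setIntegral_congr_fun (g := fun _ => (0 : ℝ)) isClosed_refSimplex.measurableSet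
      fun t _ => ?_).trans (by simp)
    have := D.wedge_eq (η (simplexParam (b ∘ c) t)) (ζ.1 (simplexParam (b ∘ c) t))
    simp only [hqT', h0, Pi.zero_apply, inner_zero_right, Finset.sum_const_zero] at this
    exact this
  obtain ⟨ω, hω⟩ := key
  exact ⟨ω, ω.2, fun ζ hζ => congrArg (fun f : Module.Dual ℝ (PolyMap (s - l) (Alt l X)) =>
    f ⟨ζ, hζ⟩) hω⟩

end FaceSystem

end FaceSystem

/-! ### The faces that carry degrees of freedom of 1-forms and 2-forms -/

section Instances

variable {ι : Type} [Fintype ι] [DecidableEq ι] (b : AffineBasis ι ℝ V3)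
  {X : Type} [NormedAddCommGroup X] [InnerProductSpace ℝ X]

/-- Evaluation of alternating forms at fixed arguments. -/
noncomputable def evalAlt {l : ℕ} (X : Type) [NormedAddCommGroup X] [InnerProductSpace ℝ X]
    (m : Fin l → V3) : Alt l X →ₗ[ℝ] X :=
  (ContinuousAlternatingMap.apply ℝ V3 X m).toLinearMap

@[simp] theorem evalAlt_apply {l : ℕ} (m : Fin l → V3) (ζ : Alt l X) : evalAlt X m ζ = ζ m := rfl

/-- The exterior product of the differentials of the barycentric coordinates `σ`, times `w`. -/
noncomputable def coordForm {l : ℕ} (σ : Fin l → ι) : X →ₗ[ℝ] Alt l X where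
  toFun w := altOfAlternating ((Matrix.detRowAlternating.compLinearMap
    (LinearMap.pi fun a => (dcoord b (σ a) : V3 →ₗ[ℝ] ℝ))).smulRight w)
  map_add' w w' := by
    ext v
    exact smul_add _ _ _
  map_smul' a w := by
    ext v
    exact smul_comm _ _ _

theorem coordForm_apply {l : ℕ} (σ : Fin l → ι) (w : X) (v : Fin l → V3) :
    coordForm b σ w v = Matrix.det (Matrix.of fun j a => dcoord b (σ a) (v j)) • w := rfl

theorem bubble_prod_eq {n : ℕ} {k : ℕ} {c : Fin n → ι} (hc : Function.Injective c)
    (τ : Fin k → Fin n) (x : V3) :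
    ∏ i ∈ Finset.univ.image c \ Finset.univ.image (c ∘ τ), b.coord i x =
      ∏ a ∈ Finset.univ \ Finset.univ.image τ, b.coord (c a) x := by
  rw [← Finset.image_image, ← Finset.image_sdiff _ _ hc, Finset.prod_image fun _ _ _ _ h => hc h]

section One

variable {d : ℕ} (c : Fin (d + 1) → ι)

/-- The 1-form `(∏_{j ≠ a} λ_j) dλ_a` on a face. -/
noncomputable def bubbleOne (x : V3) (a : Fin (d + 1)) (u : V3) : ℝ :=
  (∏ a' ∈ Finset.univ.erase a, b.coord (c a') x) * dcoord b (c a) u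

theorem bubbleWhitney_one {c : Fin (d + 1) → ι} (hc : Function.Injective c)
    {τ : Fin (1 + 1) → Fin (d + 1)} (hτ : Function.Injective τ) (w : X) (x : V3) (v : Fin 1 → V3) :
    bubbleWhitney b (Finset.univ.image c) (c ∘ τ) w x v =
      (bubbleOne b c x (τ 1) (v 0) - bubbleOne b c x (τ 0) (v 0)) • w := by
  have hne : τ 0 ≠ τ 1 := hτ.ne (by decide)
  have him : Finset.univ.image τ = {τ 0, τ 1} := by
    ext i; simp [Fin.exists_fin_two, eq_comm]
  have h1 : Finset.univ.erase (τ 1) =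
      insert (τ 0) (Finset.univ \ Finset.univ.image τ) := by
    rw [him]; ext i; simp; grind
  have h0 : Finset.univ.erase (τ 0) =
      insert (τ 1) (Finset.univ \ Finset.univ.image τ) := by
    rw [him]; ext i; simp; grind
  rw [bubbleWhitney, ContinuousAlternatingMap.smul_apply, whitney_apply, smul_smul,
    bubble_prod_eq b hc, bubbleOne, bubbleOne, h1, h0,
    Finset.prod_insert (by simp), Finset.prod_insert (by simp), Matrix.det_fin_two]
  congr 1
  simp only [Matrix.of_apply, Matrix.cons_val_zero, Matrix.cons_val_one, Function.comp_apply]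
  ring

theorem sum_ite_sub {E : Type*} [AddCommGroup E] [Module ℝ E] (f : Fin (d + 1) → E)
    (a : Fin (d + 1)) :
    ∑ i : Fin d, (if a = i.succ then (1 : ℝ) else 0) • (f i.succ - f 0) = f a - f 0 := by
  refine Fin.cases ?_ (fun a => ?_) a
  · rw [sub_self]
    exact Finset.sum_eq_zero fun i _ => by rw [if_neg (Fin.succ_ne_zero i).symm, zero_smul]
  · rw [Finset.sum_eq_single a]
    · simp
    · intro i _ hi
      rw [if_neg (by simpa using hi.symm), zero_smul]
    · simp

theorem bubbleOne_prod_nonneg {c : Fin (d + 1) → ι} (hc : Function.Injective c) {t : Fin d → ℝ}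
    (ht : t ∈ refSimplex d) (s : Finset (Fin (d + 1))) :
    0 ≤ ∏ a' ∈ s, b.coord (c a') (simplexParam (b ∘ c) t) :=
  Finset.prod_nonneg fun a _ => by
    rw [coord_simplexParam_apply b hc]; exact mem_refSimplex_iff.1 ht a

theorem bubbleOne_prod_pos {c : Fin (d + 1) → ι} (hc : Function.Injective c) {t : Fin d → ℝ}
    (ht : t ∈ refInterior d) (s : Finset (Fin (d + 1))) :
    0 < ∏ a' ∈ s, b.coord (c a') (simplexParam (b ∘ c) t) :=
  Finset.prod_pos fun a _ => by
    rw [coord_simplexParam_apply b hc]; exact ht a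

/-- The Gram matrix in degree one is the sum of a diagonal matrix and a matrix of rank one. -/
theorem sum_inner_bubbleWhitney_one {c : Fin (d + 1) → ι} (hc : Function.Injective c) (x : V3)
    (z : Fin d → X) : ∑ i, inner ℝ ((∑ j, bubbleWhitney b (Finset.univ.image c)
      (c ∘ ![0, j.succ]) (z j) x) ![b (c (Fin.succ i)) - b (c 0)]) (z i) =
      ∑ i : Fin d, (∏ a' ∈ Finset.univ.erase i.succ, b.coord (c a') x) * ‖z i‖ ^ 2 +
      (∏ a' ∈ Finset.univ.erase 0, b.coord (c a') x) * ‖∑ i, z i‖ ^ 2 := by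
  have hinj : ∀ j : Fin d, Function.Injective ![(0 : Fin (d + 1)), j.succ] := by
    intro j
    simp [Function.Injective, Fin.forall_fin_two, (Fin.succ_ne_zero j).symm]
  have h1 : ∀ i, (∑ j, bubbleWhitney b (Finset.univ.image c)
      (c ∘ ![0, j.succ]) (z j) x) ![b (c i.succ) - b (c 0)] =
      (∏ a' ∈ Finset.univ.erase i.succ, b.coord (c a') x) • z i +
      (∏ a' ∈ Finset.univ.erase 0, b.coord (c a') x) • ∑ j, z j := by
    intro i
    rw [ContinuousAlternatingMap.sum_apply, Finset.smul_sum]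
    simp only [bubbleWhitney_one b hc (hinj _), bubbleOne, Matrix.cons_val_zero,
      Matrix.cons_val_one, dcoord_edge b hc, sub_smul]
    rw [Finset.sum_sub_distrib, sub_eq_add_neg, ← Finset.sum_neg_distrib]
    congr 1
    · rw [Finset.sum_eq_single i]
      · simp
      · intro j _ hj
        simp [hj]
      · simp
    · refine Finset.sum_congr rfl fun j _ => ?_
      simp [(Fin.succ_ne_zero i).symm]
  simp only [h1, inner_add_left, real_inner_smul_left, Finset.sum_add_distrib,
    real_inner_self_eq_norm_sq]
  rw [← Finset.mul_sum, ← inner_sum, real_inner_self_eq_norm_sq]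

end One

/-- The face system for 1-forms, given the components of the test forms. -/
noncomputable def faceSystemOne {l : ℕ} {c : Fin (1 + l + 1) → ι} (hc : Function.Injective c)
    (T : Fin (1 + l) → Alt l X →ₗ[ℝ] X) (Z : (Fin (1 + l) → X) →ₗ[ℝ] Alt l X)
    (T_Z : ∀ z i, T i (Z z) = z i)
    (wedge_eq : ∀ (ω : Alt 1 X) (ζ : Alt l X), wedge ω ζ (fun i => b (c i.succ) - b (c 0)) =
      ∑ i, inner ℝ (ω ![b (c i.succ) - b (c 0)]) (T i ζ)) : FaceSystem b c X where
  N := 1 + l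
  ρ i := ![0, i.succ]
  ρ_injective i := by
    simp [Function.Injective, Fin.forall_fin_two, (Fin.succ_ne_zero i).symm]
  A i := ![b (c i.succ) - b (c 0)]
  T := T
  Z := Z
  T_Z := T_Z
  wedge_eq := wedge_eq
  span τ hτ := by
    refine ⟨fun i => (if τ 1 = i.succ then 1 else 0) - if τ 0 = i.succ then 1 else 0,
      fun w x => ?_⟩
    have hinj : ∀ j : Fin (1 + l), Function.Injective ![(0 : Fin (1 + l + 1)), j.succ] := by
      intro j
      simp [Function.Injective, Fin.forall_fin_two, (Fin.succ_ne_zero j).symm]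
    ext v
    simp only [ContinuousAlternatingMap.sum_apply, ContinuousAlternatingMap.smul_apply,
      bubbleWhitney_one b hc hτ, bubbleWhitney_one b hc (hinj _), Matrix.cons_val_one,
      Matrix.cons_val_zero]
    simp only [sub_smul (_ : ℝ) _ (_ • w), Finset.sum_sub_distrib]
    simp only [sub_smul _ _ w]
    rw [sum_ite_sub fun a => bubbleOne b c x a (v 0) • w,
      sum_ite_sub fun a => bubbleOne b c x a (v 0) • w]
    abel
  nonneg t ht z := by
    rw [sum_inner_bubbleWhitney_one b hc]
    exact add_nonneg (Finset.sum_nonneg fun i _ => mul_nonneg (bubbleOne_prod_nonneg b hc ht _)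
      (sq_nonneg _)) (mul_nonneg (bubbleOne_prod_nonneg b hc ht _) (sq_nonneg _))
  definite t ht z h := by
    rw [sum_inner_bubbleWhitney_one b hc] at h
    have h1 : ∀ i ∈ Finset.univ, 0 ≤ (∏ a' ∈ Finset.univ.erase (Fin.succ i),
        b.coord (c a') (simplexParam (b ∘ c) t)) * ‖z i‖ ^ 2 := fun i _ =>
      mul_nonneg (bubbleOne_prod_pos b hc ht _).le (sq_nonneg _)
    have h2 : 0 ≤ (∏ a' ∈ Finset.univ.erase 0, b.coord (c a') (simplexParam (b ∘ c) t)) *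
        ‖∑ i, z i‖ ^ 2 := mul_nonneg (bubbleOne_prod_pos b hc ht _).le (sq_nonneg _)
    have h3 := (add_eq_zero_iff_of_nonneg (Finset.sum_nonneg h1) h2).1 h
    funext i
    have h4 := (Finset.sum_eq_zero_iff_of_nonneg h1).1 h3.1 i (Finset.mem_univ i)
    have h5 := (mul_eq_zero.1 h4).resolve_left (bubbleOne_prod_pos b hc ht _).ne'
    simpa using h5

noncomputable def faceSystemOneZero {c : Fin (1 + 0 + 1) → ι} (hc : Function.Injective c) :
    FaceSystem b c X :=
  faceSystemOne b hc (fun _ => evalAlt X ![])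
    (coordForm b ![] ∘ₗ LinearMap.proj 0)
    (by
      intro z i
      fin_cases i
      simp [coordForm_apply])
    (by
      intro ω ζ
      rw [wedge_one_zero, Fin.sum_univ_one]
      rfl)

noncomputable def faceSystemOneOne {c : Fin (1 + 1 + 1) → ι} (hc : Function.Injective c) :
    FaceSystem b c X :=
  faceSystemOne b hc
    ![evalAlt X ![b (c 2) - b (c 0)], -evalAlt X ![b (c 1) - b (c 0)]]
    (coordForm b ![c 2] ∘ₗ LinearMap.proj 0 - coordForm b ![c 1] ∘ₗ LinearMap.proj 1)
    (by
      intro z i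
      have h := dcoord_edge b hc
      obtain ⟨e, he⟩ : ∃ e : Fin (1 + 1 + 1) → V3, ∀ j, e j = b (c j) - b (c 0) := ⟨_, fun _ => rfl⟩
      simp only [← he] at h ⊢
      fin_cases i <;> simp [coordForm_apply, h])
    (by
      intro ω ζ
      rw [wedge_one_one, Fin.sum_univ_two]
      simp [sub_eq_add_neg])

noncomputable def faceSystemOneTwo {c : Fin (1 + 2 + 1) → ι} (hc : Function.Injective c) :
    FaceSystem b c X :=
  faceSystemOne b hc
    ![evalAlt X ![b (c 2) - b (c 0), b (c 3) - b (c 0)],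
      -evalAlt X ![b (c 1) - b (c 0), b (c 3) - b (c 0)],
      evalAlt X ![b (c 1) - b (c 0), b (c 2) - b (c 0)]]
    (coordForm b ![c 2, c 3] ∘ₗ LinearMap.proj 0 - coordForm b ![c 1, c 3] ∘ₗ LinearMap.proj 1 +
      coordForm b ![c 1, c 2] ∘ₗ LinearMap.proj 2)
    (by
      intro z i
      have h := dcoord_edge b hc
      obtain ⟨e, he⟩ : ∃ e : Fin (1 + 2 + 1) → V3, ∀ j, e j = b (c j) - b (c 0) := ⟨_, fun _ => rfl⟩
      simp only [← he] at h ⊢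
      fin_cases i <;> simp [coordForm_apply, h, Matrix.det_fin_two])
    (by
      intro ω ζ
      rw [wedge_one_two, Fin.sum_univ_three]
      simp [sub_eq_add_neg])

section Two

variable {d : ℕ} (c : Fin (d + 1) → ι)

/-- The 2-form `(∏_{j ≠ a, a'} λ_j) dλ_a ∧ dλ_a'` on a face. -/
noncomputable def bubbleTwo (x : V3) (u v : V3) (a a' : Fin (d + 1)) : ℝ :=
  (∏ j ∈ Finset.univ \ {a, a'}, b.coord (c j) x) *
    (dcoord b (c a) u * dcoord b (c a') v - dcoord b (c a) v * dcoord b (c a') u)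

theorem bubbleTwo_swap (x : V3) (u v : V3) (a a' : Fin (d + 1)) :
    bubbleTwo b c x u v a a' = -bubbleTwo b c x u v a' a := by
  rw [bubbleTwo, bubbleTwo, Finset.pair_comm]; ring

theorem bubbleWhitney_two {c : Fin (d + 1) → ι} (hc : Function.Injective c)
    {τ : Fin (2 + 1) → Fin (d + 1)} (hτ : Function.Injective τ) (w : X) (x : V3) (v : Fin 2 → V3) :
    bubbleWhitney b (Finset.univ.image c) (c ∘ τ) w x v =
      (bubbleTwo b c x (v 0) (v 1) (τ 1) (τ 2) - bubbleTwo b c x (v 0) (v 1) (τ 0) (τ 2) +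
        bubbleTwo b c x (v 0) (v 1) (τ 0) (τ 1)) • w := by
  have h01 : τ 0 ≠ τ 1 := hτ.ne (by decide)
  have h02 : τ 0 ≠ τ 2 := hτ.ne (by decide)
  have h12 : τ 1 ≠ τ 2 := hτ.ne (by decide)
  have him : Finset.univ.image τ = {τ 0, τ 1, τ 2} := by
    ext i
    simp only [Finset.mem_image, Finset.mem_univ, true_and, Finset.mem_insert,
      Finset.mem_singleton]
    constructor
    · rintro ⟨a, rfl⟩; fin_cases a <;> simp
    · rintro (rfl | rfl | rfl) <;> exact ⟨_, rfl⟩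
  have e12 : Finset.univ \ {τ 1, τ 2} = insert (τ 0) (Finset.univ \ Finset.univ.image τ) := by
    rw [him]; ext i; simp; grind
  have e02 : Finset.univ \ {τ 0, τ 2} = insert (τ 1) (Finset.univ \ Finset.univ.image τ) := by
    rw [him]; ext i; simp; grind
  have e01 : Finset.univ \ {τ 0, τ 1} = insert (τ 2) (Finset.univ \ Finset.univ.image τ) := by
    rw [him]; ext i; simp; grind
  rw [bubbleWhitney, ContinuousAlternatingMap.smul_apply, whitney_apply, smul_smul,
    bubble_prod_eq b hc, bubbleTwo, bubbleTwo, bubbleTwo, e12, e02, e01,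
    Finset.prod_insert (by simp), Finset.prod_insert (by simp), Finset.prod_insert (by simp),
    Matrix.det_fin_three]
  congr 1
  simp only [Matrix.of_apply, Matrix.cons_val_zero, Matrix.cons_val_one, Matrix.cons_val,
    Function.comp_apply]
  ring

/-- Whitney forms of a face are combinations of those that contain the vertex `0`. -/
theorem exists_bubbleWhitney_two_eq {c : Fin (d + 1) → ι} (hc : Function.Injective c) {N : ℕ}
    (pr : Fin N → Fin (d + 1) × Fin (d + 1))
    (hpr : ∀ m, Function.Injective ![0, (pr m).1, (pr m).2])
    (H : ∀ f : Fin (d + 1) → Fin (d + 1) → ℝ, (∀ a a', f a a' = -f a' a) → ∀ a a',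
      ∑ m, ((if (a, a') = pr m then 1 else 0) - if (a', a) = pr m then 1 else 0) *
        (f (pr m).1 (pr m).2 - f 0 (pr m).2 + f 0 (pr m).1) = f a a' - f 0 a' + f 0 a)
    {τ : Fin (2 + 1) → Fin (d + 1)} (hτ : Function.Injective τ) :
    ∃ n : Fin N → ℝ, ∀ (w : X) (x : V3),
      bubbleWhitney b (Finset.univ.image c) (c ∘ τ) w x =
        ∑ m, n m • bubbleWhitney b (Finset.univ.image c) (c ∘ ![0, (pr m).1, (pr m).2]) w x := by
  let κ : Fin N → Fin (d + 1) → Fin (d + 1) → ℝ := fun m a a' =>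
    (if (a, a') = pr m then 1 else 0) - if (a', a) = pr m then 1 else 0
  refine ⟨fun m => κ m (τ 1) (τ 2) - κ m (τ 0) (τ 2) + κ m (τ 0) (τ 1), fun w x => ?_⟩
  ext v
  have hf := bubbleTwo_swap b c x (v 0) (v 1)
  simp only [ContinuousAlternatingMap.sum_apply, ContinuousAlternatingMap.smul_apply,
    bubbleWhitney_two b hc hτ, bubbleWhitney_two b hc (hpr _), Matrix.cons_val_one,
    Matrix.cons_val_zero, Matrix.cons_val, smul_smul, ← Finset.sum_smul]
  congr 1
  simp only [add_mul, sub_mul (κ _ _ _), Finset.sum_add_distrib, Finset.sum_sub_distrib]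
  rw [H _ hf, H _ hf, H _ hf]
  ring

theorem form_edge_two {c : Fin (d + 1) → ι} (hc : Function.Injective c) {N : ℕ}
    (ρ : Fin N → Fin (2 + 1) → Fin (d + 1)) (hρ : ∀ m, Function.Injective (ρ m))
    (x : V3) (z : Fin N → X) (a a' : Fin (d + 1)) :
    (∑ m, bubbleWhitney b (Finset.univ.image c) (c ∘ ρ m) (z m) x)
      ![b (c a) - b (c 0), b (c a') - b (c 0)] =
      ∑ m, (bubbleTwo b c x (b (c a) - b (c 0)) (b (c a') - b (c 0)) (ρ m 1) (ρ m 2) -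
        bubbleTwo b c x (b (c a) - b (c 0)) (b (c a') - b (c 0)) (ρ m 0) (ρ m 2) +
        bubbleTwo b c x (b (c a) - b (c 0)) (b (c a') - b (c 0)) (ρ m 0) (ρ m 1)) • z m := by
  rw [ContinuousAlternatingMap.sum_apply]
  exact Finset.sum_congr rfl fun m _ => bubbleWhitney_two b hc (hρ m) _ _ _

end Two

theorem sum_inner_bubbleWhitney_two_zero {c : Fin (2 + 1) → ι} (hc : Function.Injective c) (x : V3)
    (z : Fin 1 → X) : ∑ i, inner ℝ ((∑ m, bubbleWhitney b (Finset.univ.image c)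
      (c ∘ (fun _ : Fin 1 => ![0, 1, 2]) m) (z m) x)
        ![b (c 1) - b (c 0), b (c 2) - b (c 0)]) (z i) =
      ((∏ j ∈ Finset.univ \ {1, 2}, b.coord (c j) x) +
        (∏ j ∈ Finset.univ \ {0, 2}, b.coord (c j) x) +
        ∏ j ∈ Finset.univ \ {0, 1}, b.coord (c j) x) * ‖z 0‖ ^ 2 := by
  rw [form_edge_two b hc (fun _ : Fin 1 => ![0, 1, 2]) (fun _ => by decide)]
  have h := dcoord_edge b hc
  obtain ⟨e, he⟩ : ∃ e : Fin (2 + 1) → V3, ∀ j, e j = b (c j) - b (c 0) := ⟨_, fun _ => rfl⟩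
  simp only [← he] at h ⊢
  rw [Fin.sum_univ_one, Fin.sum_univ_one, real_inner_smul_left, real_inner_self_eq_norm_sq]
  congr 1
  simp [bubbleTwo, h]

noncomputable def faceSystemTwoZero {c : Fin (2 + 0 + 1) → ι} (hc : Function.Injective c) :
    FaceSystem b c X where
  N := 1
  ρ _ := ![0, 1, 2]
  ρ_injective _ := by decide
  A _ := ![b (c 1) - b (c 0), b (c 2) - b (c 0)]
  T _ := evalAlt X ![]
  Z := coordForm b ![] ∘ₗ LinearMap.proj 0
  T_Z z i := by
    fin_cases i
    simp [coordForm_apply]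
  wedge_eq ω ζ := by
    rw [wedge_two_zero, Fin.sum_univ_one]; rfl
  span τ hτ := by
    refine exists_bubbleWhitney_two_eq b hc ![(1, 2)] (by decide) ?_ hτ
    intro f hf a a'
    have h0 : ∀ a, f a a = 0 := fun a => by linarith [hf a a]
    fin_cases a <;> fin_cases a' <;> simp [h0] <;> linarith [hf 0 1, hf 0 2, hf 1 2]
  nonneg t ht z := by
    rw [sum_inner_bubbleWhitney_two_zero b hc]
    exact mul_nonneg (add_nonneg (add_nonneg (bubbleOne_prod_nonneg b hc ht _)
      (bubbleOne_prod_nonneg b hc ht _)) (bubbleOne_prod_nonneg b hc ht _)) (sq_nonneg _)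
  definite t ht z h := by
    rw [sum_inner_bubbleWhitney_two_zero b hc] at h
    have h1 := (mul_eq_zero.1 h).resolve_left (add_pos (add_pos (bubbleOne_prod_pos b hc ht _)
      (bubbleOne_prod_pos b hc ht _)) (bubbleOne_prod_pos b hc ht _)).ne'
    funext i
    fin_cases i
    simpa using h1

theorem sum_inner_bubbleWhitney_two_one {c : Fin (3 + 1) → ι} (hc : Function.Injective c) (x : V3)
    (z : Fin 3 → X) : ∑ i, inner ℝ ((∑ m, bubbleWhitney b (Finset.univ.image c)
      (c ∘ (![![0, 1, 2], ![0, 1, 3], ![0, 2, 3]] : Fin 3 → Fin (2 + 1) → Fin (3 + 1)) m) (z m) x)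
        ((![![b (c 1) - b (c 0), b (c 2) - b (c 0)], ![b (c 1) - b (c 0), b (c 3) - b (c 0)],
          ![b (c 2) - b (c 0), b (c 3) - b (c 0)]] : Fin 3 → Fin 2 → V3) i)) (z i) =
      (∏ j ∈ Finset.univ \ {1, 2}, b.coord (c j) x) * ‖z 0‖ ^ 2 +
      (∏ j ∈ Finset.univ \ {1, 3}, b.coord (c j) x) * ‖z 1‖ ^ 2 +
      (∏ j ∈ Finset.univ \ {2, 3}, b.coord (c j) x) * ‖z 2‖ ^ 2 +
      (∏ j ∈ Finset.univ \ {0, 1}, b.coord (c j) x) * ‖z 0 + z 1‖ ^ 2 +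
      (∏ j ∈ Finset.univ \ {0, 2}, b.coord (c j) x) * ‖z 0 - z 2‖ ^ 2 +
      (∏ j ∈ Finset.univ \ {0, 3}, b.coord (c j) x) * ‖z 1 + z 2‖ ^ 2 := by
  have hρ : ∀ m, Function.Injective
      ((![![0, 1, 2], ![0, 1, 3], ![0, 2, 3]] : Fin 3 → Fin (2 + 1) → Fin (3 + 1)) m) := by decide
  rw [Fin.sum_univ_three]
  have hA : (![![b (c 1) - b (c 0), b (c 2) - b (c 0)], ![b (c 1) - b (c 0), b (c 3) - b (c 0)],
      ![b (c 2) - b (c 0), b (c 3) - b (c 0)]] : Fin 3 → Fin 2 → V3) 2 =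
      ![b (c 2) - b (c 0), b (c 3) - b (c 0)] := rfl
  rw [hA, Matrix.cons_val_zero, Matrix.cons_val_one, Matrix.cons_val_zero]
  rw [form_edge_two b hc _ hρ, form_edge_two b hc _ hρ, form_edge_two b hc _ hρ]
  have h := dcoord_edge b hc
  obtain ⟨e, he⟩ : ∃ e : Fin (3 + 1) → V3, ∀ j, e j = b (c j) - b (c 0) := ⟨_, fun _ => rfl⟩
  simp only [← he] at h ⊢
  simp only [Fin.sum_univ_three, Matrix.cons_val_zero, Matrix.cons_val_one, Matrix.cons_val,
    bubbleTwo, h]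
  simp [inner_add_left, real_inner_smul_left, norm_add_sq_real, norm_sub_sq_real]
  rw [real_inner_comm (z 0) (z 1), real_inner_comm (z 0) (z 2), real_inner_comm (z 1) (z 2)]
  ring

noncomputable def faceSystemTwoOne {c : Fin (2 + 1 + 1) → ι} (hc : Function.Injective c) :
    FaceSystem b c X where
  N := 3
  ρ := ![![0, 1, 2], ![0, 1, 3], ![0, 2, 3]]
  ρ_injective := by decide
  A := ![![b (c 1) - b (c 0), b (c 2) - b (c 0)], ![b (c 1) - b (c 0), b (c 3) - b (c 0)],
          ![b (c 2) - b (c 0), b (c 3) - b (c 0)]]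
  T := ![evalAlt X ![b (c 3) - b (c 0)], -evalAlt X ![b (c 2) - b (c 0)],
    evalAlt X ![b (c 1) - b (c 0)]]
  Z := coordForm b ![c 3] ∘ₗ LinearMap.proj 0 - coordForm b ![c 2] ∘ₗ LinearMap.proj 1 +
      coordForm b ![c 1] ∘ₗ LinearMap.proj 2
  T_Z z i := by
    have h := dcoord_edge b hc
    obtain ⟨e, he⟩ : ∃ e : Fin (2 + 1 + 1) → V3, ∀ j, e j = b (c j) - b (c 0) := ⟨_, fun _ => rfl⟩
    simp only [← he] at h ⊢
    fin_cases i <;> simp [coordForm_apply, h]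
  wedge_eq ω ζ := by
    rw [wedge_two_one, Fin.sum_univ_three]
    obtain ⟨e, he⟩ : ∃ e : Fin (2 + 1 + 1) → V3, ∀ j, e j = b (c j) - b (c 0) := ⟨_, fun _ => rfl⟩
    simp only [← he]
    simp
    ring
  span τ hτ := by
    have h := exists_bubbleWhitney_two_eq (X := X) b hc ![(1, 2), (1, 3), (2, 3)] (by decide) ?_ hτ
    · obtain ⟨n, hn⟩ := h
      have hρ : ∀ m, ![0, ((![(1, 2), (1, 3), (2, 3)] : Fin 3 → Fin 4 × Fin 4) m).1,
          ((![(1, 2), (1, 3), (2, 3)] : Fin 3 → Fin 4 × Fin 4) m).2] =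
          (![![0, 1, 2], ![0, 1, 3], ![0, 2, 3]] : Fin 3 → Fin (2 + 1) → Fin 4) m := by decide
      simp only [hρ] at hn
      exact ⟨n, hn⟩
    intro f hf a a'
    have h0 : ∀ a, f a a = 0 := fun a => by linarith [hf a a]
    rw [Fin.sum_univ_three]
    fin_cases a <;> fin_cases a' <;> simp [h0] <;>
      linarith [hf 0 1, hf 0 2, hf 1 2, hf 0 3, hf 1 3, hf 2 3]
  nonneg t ht z := by
    have hP := fun s => bubbleOne_prod_nonneg b hc ht s
    refine le_of_le_of_eq ?_ (sum_inner_bubbleWhitney_two_one b hc _ z).symm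
    refine add_nonneg (add_nonneg (add_nonneg (add_nonneg (add_nonneg ?_ ?_) ?_) ?_) ?_) ?_ <;>
      exact mul_nonneg (hP _) (sq_nonneg _)
  definite t ht z h := by
    have h' := (sum_inner_bubbleWhitney_two_one b hc _ z).symm.trans h
    have hP := fun s => bubbleOne_prod_pos b hc ht s
    have hn := fun s (y : X) => mul_nonneg (hP s).le (sq_nonneg ‖y‖)
    have hz : ∀ s (y : X), (∏ a' ∈ s, b.coord (c a') (simplexParam (b ∘ c) t)) * ‖y‖ ^ 2 ≤ 0 →
        y = 0 := by
      intro s y hy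
      have := (mul_eq_zero.1 (le_antisymm hy (hn s y))).resolve_left (hP s).ne'
      simpa using this
    have n1 := hn (Finset.univ \ {1, 2}) (z 0)
    have n2 := hn (Finset.univ \ {1, 3}) (z 1)
    have n3 := hn (Finset.univ \ {2, 3}) (z 2)
    have n4 := hn (Finset.univ \ {0, 1}) (z 0 + z 1)
    have n5 := hn (Finset.univ \ {0, 2}) (z 0 - z 2)
    have n6 := hn (Finset.univ \ {0, 3}) (z 1 + z 2)
    funext i
    fin_cases i
    · exact hz (Finset.univ \ {1, 2}) (z 0) (by linarith)
    · exact hz (Finset.univ \ {1, 3}) (z 1) (by linarith)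
    · exact hz (Finset.univ \ {2, 3}) (z 2) (by linarith)

end Instances

/-! ### Unisolvence on a tetrahedron -/

section Tetrahedron

variable {k : ℕ} {X : Type} [NormedAddCommGroup X] [InnerProductSpace ℝ X]

/-- All faces that carry degrees of freedom of `X`-valued `k`-forms have a face system. -/
def HasFaceSystems (k : ℕ) (X : Type) [NormedAddCommGroup X] [InnerProductSpace ℝ X] : Prop :=
  ∀ l, k + l ≤ 3 → WedgeAlternating k l X ∧ ∀ (ι : Type) [Fintype ι] [DecidableEq ι]
    (b : AffineBasis ι ℝ V3) (c : Fin (k + l + 1) → ι), Function.Injective c →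
      Nonempty (FaceSystem b c X)

theorem hasFaceSystems_one : HasFaceSystems 1 X := by
  intro l hl
  have : l ≤ 2 := by omega
  interval_cases l
  · exact ⟨wedgeAlternating_one_zero, fun ι _ _ b c hc => ⟨faceSystemOneZero b hc⟩⟩
  · exact ⟨wedgeAlternating_one_one, fun ι _ _ b c hc => ⟨faceSystemOneOne b hc⟩⟩
  · exact ⟨wedgeAlternating_one_two, fun ι _ _ b c hc => ⟨faceSystemOneTwo b hc⟩⟩

theorem hasFaceSystems_two : HasFaceSystems 2 X := by
  intro l hl
  have : l ≤ 1 := by omega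
  interval_cases l
  · exact ⟨wedgeAlternating_two_zero, fun ι _ _ b c hc => ⟨faceSystemTwoZero b hc⟩⟩
  · exact ⟨wedgeAlternating_two_one, fun ι _ _ b c hc => ⟨faceSystemTwoOne b hc⟩⟩

variable {ι : Type} [Fintype ι] [DecidableEq ι] (b : AffineBasis ι ℝ V3)

/-- Equality of the degrees of freedom on the face `F`. -/
def FaceDofs (F : Finset ι) (s : ℤ) (ω η : V3 → Alt k X) : Prop :=
  ∀ l, k + l ≤ 3 → ∀ c : Fin (k + l + 1) → ι, Function.Injective c → Finset.univ.image c = F →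
    ∀ ζ ∈ PolyMap (s - l) (Alt l X), simplexPairing (b ∘ c) ω ζ = simplexPairing (b ∘ c) η ζ

theorem faceSpace_eq_bot {F : Finset ι} (hF : F.card ≤ k) {s : ℤ} {ω : V3 → Alt k X}
    (hω : ω ∈ faceSpace b F s k X) : ω = 0 := by
  have : faceSpace b F s k X ≤ ⊥ := by
    refine Submodule.span_le.2 ?_
    rintro _ ⟨τ, h, w, hτ, hF', -, rfl⟩
    exfalso
    have h1 := Finset.card_le_card_of_injOn (s := Finset.univ) (t := F) τ (fun a _ => hF' a)
      hτ.injOn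
    simp at h1
    omega
  simpa using this hω

theorem exists_enumeration {n : ℕ} {F : Finset ι} (hF : F.card = n) :
    ∃ c : Fin n → ι, Function.Injective c ∧ Finset.univ.image c = F := by
  refine ⟨fun i => (F.equivFinOfCardEq hF).symm i,
    Subtype.val_injective.comp (Equiv.injective _), ?_⟩
  ext i
  simp only [Finset.mem_image, Finset.mem_univ, true_and]
  constructor
  · rintro ⟨a, rfl⟩; exact Subtype.property _
  · intro hi
    exact ⟨F.equivFinOfCardEq hF ⟨i, hi⟩, by simp⟩

theorem face_card_le (F : Finset ι) (b : AffineBasis ι ℝ V3) : F.card ≤ 4 := by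
  have h1 := b.ind.card_le_finrank_succ
  have h2 : Module.finrank ℝ (vectorSpan ℝ (Set.range b)) ≤ 3 := by
    have := Submodule.finrank_le (vectorSpan ℝ (Set.range b))
    simpa using this
  have h3 := Finset.card_le_univ F
  omega

theorem face_eq_zero (H : HasFaceSystems k X) {F : Finset ι} {s : ℤ} {ω : V3 → Alt k X}
    (hω : ω ∈ faceSpace b F s k X) (h : FaceDofs b F s ω 0) : ω = 0 := by
  by_cases hF : F.card ≤ k
  · exact faceSpace_eq_bot b hF hω
  obtain ⟨l, hl⟩ : ∃ l, F.card = k + l + 1 := ⟨F.card - k - 1, by omega⟩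
  have hl3 : k + l ≤ 3 := by have := face_card_le F b; omega
  obtain ⟨c, hc, rfl⟩ := exists_enumeration hl
  obtain ⟨D⟩ := (H l hl3).2 ι b c hc
  refine D.eq_zero hc hω fun ζ hζ => ?_
  rw [h l hl3 c hc rfl ζ hζ]
  have := simplexPairing_smul_left (v := b ∘ c) (ω := 0) (ζ := ζ) 0
  simpa using this

theorem simplexParam_mem_convexHull {d : ℕ} (v : Fin (d + 1) → V3) {t : Fin d → ℝ}
    (ht : t ∈ refSimplex d) {s : Set V3} (hv : ∀ a, v a ∈ s) :
    simplexParam v t ∈ convexHull ℝ s := by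
  rw [simplexParam_eq_sum]
  exact (convex_convexHull ℝ s).sum_mem (fun i _ => mem_refSimplex_iff.1 ht i) (sum_bary t)
    fun i _ => subset_convexHull ℝ s (hv i)

theorem _root_.ContinuousOn.onSimplex {d : ℕ} {E : Type*} [TopologicalSpace E] {f : V3 → E}
    {s : Set V3} (hf : ContinuousOn f (convexHull ℝ s)) {v : Fin (d + 1) → V3}
    (hv : ∀ a, v a ∈ s) : ContinuousOnSimplex v f :=
  hf.comp (continuous_simplexParam v).continuousOn fun _ ht => simplexParam_mem_convexHull v ht hv

theorem face_exists (H : HasFaceSystems k X) [∀ l, FiniteDimensional ℝ (Alt l X)] (F : Finset ι)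
    (s : ℤ) {η : V3 → Alt k X} (hη : ContinuousOn η (convexHull ℝ (b '' F))) :
    ∃ ω ∈ faceSpace b F s k X, FaceDofs b F s ω η := by
  by_cases hF : F.card ≤ k
  · refine ⟨0, Submodule.zero_mem _, fun l hl c hc hcF => ?_⟩
    have := Finset.card_image_of_injective Finset.univ hc
    rw [hcF, Finset.card_univ, Fintype.card_fin] at this
    omega
  obtain ⟨l, hl⟩ : ∃ l, F.card = k + l + 1 := ⟨F.card - k - 1, by omega⟩
  have hl3 : k + l ≤ 3 := by have := face_card_le F b; omega
  obtain ⟨c, hc, hcF⟩ := exists_enumeration hl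
  obtain ⟨D⟩ := (H l hl3).2 ι b c hc
  have hη' : ContinuousOnSimplex (b ∘ c) η := hη.onSimplex fun a =>
    Set.mem_image_of_mem b (by rw [← hcF]; simp)
  obtain ⟨ω, hω, h⟩ := D.exists_eq hc s hη'
  rw [hcF] at hω
  refine ⟨ω, hω, fun l' hl' c' hc' hcF' ζ hζ => ?_⟩
  have hll : l' = l := by
    have := Finset.card_image_of_injective Finset.univ hc'
    rw [hcF', Finset.card_univ, Fintype.card_fin] at this
    omega
  subst hll
  have hex : ∀ a, ∃ a', c a' = c' a := by
    intro a
    have : c' a ∈ Finset.univ.image c := by rw [hcF, ← hcF']; simp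
    simpa using this
  choose π hπ using hex
  have hπi : Function.Injective π := fun a a' e => hc' (by rw [← hπ, ← hπ, e])
  let π' : Equiv.Perm (Fin (k + l' + 1)) :=
    Equiv.ofBijective π ((Fintype.bijective_iff_injective_and_card π).2 ⟨hπi, rfl⟩)
  have e : (b ∘ c' : Fin (k + l' + 1) → V3) = (b ∘ c) ∘ π' := by
    funext a
    simp [π', hπ]
  obtain ⟨q, hq⟩ := exists_simplexPairing_perm (H l' hl3).1 π'
  rw [e, hq, hq, h ζ hζ]

variable {b}

/-- The pairing on a face only depends on the traces on this face. -/
theorem simplexPairing_congr_trace {l : ℕ} {c : Fin (k + l + 1) → ι}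
    {ω ω' : V3 → Alt k X} (ζ : V3 → Alt l X)
    (h : ∀ x, (∀ i ∉ Finset.univ.image c, b.coord i x = 0) → ∀ v : Fin k → V3,
      (∀ j, ∀ i ∉ Finset.univ.image c, dcoord b i (v j) = 0) → ω x v = ω' x v) :
    simplexPairing (b ∘ c) ω ζ = simplexPairing (b ∘ c) ω' ζ := by
  refine simplexPairing_congr fun t _ => wedge_congr (fun r => ?_) fun r => rfl
  refine h _ (fun i hi => coord_simplexParam_of_notMem b c (fun a ha => hi ?_) t) _
    fun j i hi => dcoord_edge_of_notMem b c (fun a ha => hi ?_) _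
  · exact Finset.mem_image.2 ⟨a, Finset.mem_univ a, ha⟩
  · exact Finset.mem_image.2 ⟨a, Finset.mem_univ a, ha⟩

/-- The degrees of freedom on the subfaces of a face determine the trace on this face. -/
theorem trace_eq_zero (H : HasFaceSystems k X) {s : ℤ} {ω : V3 → Alt k X} (hω : ω ∈ PPlus s k X)
    {F : Finset ι} (h : ∀ G ⊆ F, FaceDofs b G s ω 0) {x : V3} (hx : ∀ i ∉ F, b.coord i x = 0)
    {v : Fin k → V3} (hv : ∀ j, ∀ i ∉ F, dcoord b i (v j) = 0) : ω x v = 0 := by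
  have h1 : ω ∈ ⨆ G ∈ (Finset.univ : Finset (Finset ι)), faceSpace b G s k X := by
    simpa using PPlus_le_iSup_faceSpace b s hω
  obtain ⟨μ, rfl⟩ := (Submodule.mem_iSup_finset_iff_exists_sum _ _).1 h1
  have key : ∀ n, ∀ G ⊆ F, G.card = n → (μ G : V3 → Alt k X) = 0 := by
    intro n
    induction n using Nat.strong_induction_on with
    | _ n ih =>
      rintro G hGF rfl
      refine face_eq_zero b H (μ G).2 fun l hl c hc hcG ζ hζ => ?_
      rw [← h G hGF l hl c hc hcG ζ hζ]
      refine simplexPairing_congr_trace ζ fun y hy u hu => ?_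
      rw [hcG] at hy hu
      rw [Finset.sum_apply, ContinuousAlternatingMap.sum_apply, Finset.sum_eq_single G]
      · intro G' _ hG'
        by_cases hsub : G' ⊆ G
        · rw [ih G'.card (Finset.card_lt_card (hsub.ssubset_of_ne hG')) G' (hsub.trans hGF) rfl]
          rfl
        · exact faceSpace_trace b hsub (μ G').2 hy hu
      · simp
  rw [Finset.sum_apply, ContinuousAlternatingMap.sum_apply]
  refine Finset.sum_eq_zero fun G _ => ?_
  by_cases hsub : G ⊆ F
  · rw [key _ G hsub rfl]; rfl
  · exact faceSpace_trace b hsub (μ G).2 hx hv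

theorem eq_zero_of_faceDofs (H : HasFaceSystems k X) {s : ℤ} {ω : V3 → Alt k X}
    (hω : ω ∈ PPlus s k X) (h : ∀ G : Finset ι, FaceDofs b G s ω 0) : ω = 0 := by
  funext x
  ext v
  exact trace_eq_zero H hω (F := Finset.univ) (fun G _ => h G) (by simp) (by simp)

/-- On a tetrahedron, the degrees of freedom can be prescribed on every face independently. -/
theorem exists_interpolant (H : HasFaceSystems k X) [∀ l, FiniteDimensional ℝ (Alt l X)] (s : ℤ)
    (η : Finset ι → V3 → Alt k X)
    (hη : ∀ F : Finset ι, ContinuousOn (η F) (convexHull ℝ (b '' F))) :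
    ∃ ω ∈ PPlus s k X, ∀ F, FaceDofs b F s ω (η F) := by
  suffices key : ∀ n, ∃ ω ∈ PPlus s k X, ∀ F : Finset ι, F.card ≤ n → FaceDofs b F s ω (η F) by
    obtain ⟨ω, hω, h⟩ := key 4
    exact ⟨ω, hω, fun F => h F (face_card_le F b)⟩
  intro n
  induction n with
  | zero =>
    refine ⟨0, Submodule.zero_mem _, fun F hF l hl c hc hcF => ?_⟩
    have := Finset.card_image_of_injective Finset.univ hc
    rw [hcF, Finset.card_univ, Fintype.card_fin] at this
    omega
  | succ n ih =>
    obtain ⟨ω, hω, h⟩ := ih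
    have hωc : Continuous ω := (PPlus.contDiff hω (n := 0)).continuous
    have hstep := fun F => face_exists b H F s ((hη F).sub hωc.continuousOn)
    choose μ hμ hμd using hstep
    let S : Finset (Finset ι) := Finset.univ.filter fun F => F.card = n + 1
    have hμP : ∀ F, μ F ∈ PPlus s k X := fun F => faceSpace_le_PPlus b F s (hμ F)
    refine ⟨ω + ∑ F ∈ S, μ F, Submodule.add_mem _ hω (Submodule.sum_mem _ fun F _ => hμP F),
      fun G hG l hl c hc hcG ζ hζ => ?_⟩
    by_cases hGn : G.card = n + 1
    · have e1 : simplexPairing (b ∘ c) (ω + ∑ F ∈ S, μ F) ζ =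
          simplexPairing (b ∘ c) (ω + μ G) ζ := by
        refine simplexPairing_congr_trace ζ fun y hy u hu => ?_
        rw [hcG] at hy hu
        rw [Pi.add_apply, Pi.add_apply, ContinuousAlternatingMap.add_apply,
          ContinuousAlternatingMap.add_apply, Finset.sum_apply, ContinuousAlternatingMap.sum_apply,
          Finset.sum_eq_single_of_mem G (by simp [S, hGn])]
        intro F hF hFG
        have hFc : F.card = n + 1 := (Finset.mem_filter.1 hF).2
        exact faceSpace_trace b (fun hsub => hFG (Finset.eq_of_subset_of_card_le hsub
          (by omega))) (hμ F) hy hu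
      have hηc : ContinuousOnSimplex (b ∘ c) (η G) := (hη G).onSimplex fun a =>
        Set.mem_image_of_mem b (by rw [← hcG]; simp)
      have hζc := PolyMap.onSimplex hζ (b ∘ c)
      rw [e1, simplexPairing_add_left (PPlus.onSimplex hω _) (PPlus.onSimplex (hμP G) _) hζc,
        hμd G l hl c hc hcG ζ hζ]
      have := simplexPairing_sub_left hηc (PPlus.onSimplex hω _) hζc
      change _ + simplexPairing (b ∘ c) (η G - ω) ζ = _
      rw [this]; ring
    · rw [← h G (by omega) l hl c hc hcG ζ hζ]
      refine simplexPairing_congr_trace ζ fun y hy u hu => ?_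
      rw [hcG] at hy hu
      rw [Pi.add_apply, ContinuousAlternatingMap.add_apply, Finset.sum_apply,
          ContinuousAlternatingMap.sum_apply, Finset.sum_eq_zero, add_zero]
      intro F hF
      have hFc : F.card = n + 1 := (Finset.mem_filter.1 hF).2
      exact faceSpace_trace b (fun hsub => by have := Finset.card_le_card hsub; omega) (hμ F) hy hu

end Tetrahedron

/-! ### The divergence theorem on a tetrahedron -/

section Stokes

variable {E : Type*} [NormedAddCommGroup E] [NormedSpace ℝ E] {d : ℕ}

theorem cons_mem_refSimplex {a : ℝ} {s : Fin d → ℝ} :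
    (Fin.cons a s : Fin (d + 1) → ℝ) ∈ refSimplex (d + 1) ↔
      s ∈ refSimplex d ∧ a ∈ Set.Icc 0 (1 - ∑ i, s i) := by
  simp only [refSimplex, Set.mem_ofPred_eq, Fin.forall_fin_succ, Fin.cons_zero, Fin.cons_succ,
    Fin.sum_univ_succ, Set.mem_Icc]
  constructor
  · rintro ⟨⟨h1, h2⟩, h3⟩
    exact ⟨⟨h2, by linarith⟩, h1, by linarith⟩
  · rintro ⟨⟨h1, h2⟩, h3, h4⟩
    exact ⟨⟨h3, h1⟩, by linarith⟩

theorem integral_refSimplex_succ {G : (Fin (d + 1) → ℝ) → E} (hG : Continuous G) :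
    ∫ t in refSimplex (d + 1), G t =
      ∫ s in refSimplex d, ∫ a in (0 : ℝ)..(1 - ∑ i, s i), G (Fin.cons a s) := by
  let e := (MeasurableEquiv.piFinSuccAbove (fun _ : Fin (d + 1) => ℝ) 0).symm
  have he : MeasurePreserving e (volume.prod volume) volume :=
    (volume_preserving_piFinSuccAbove (fun _ : Fin (d + 1) => ℝ) 0).symm _
  have hcons : ∀ p : ℝ × (Fin d → ℝ), e p = Fin.cons p.1 p.2 := fun p => by
    simp only [e, MeasurableEquiv.piFinSuccAbove_symm_apply, Fin.insertNthEquiv_zero]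
    rfl
  have hm : MeasurableSet (refSimplex (d + 1)) := isClosed_refSimplex.measurableSet
  have hint : Integrable ((refSimplex (d + 1)).indicator G) :=
    (hG.continuousOn.integrableOn_compact isCompact_refSimplex).integrable_indicator hm
  rw [← integral_indicator hm, ← he.integral_comp e.measurableEmbedding,
    integral_prod_symm (fun p => (refSimplex (d + 1)).indicator G (e p))
      ((he.integrable_comp_emb e.measurableEmbedding).2 hint),
    ← integral_indicator (isClosed_refSimplex.measurableSet)]
  congr 1
  funext s
  by_cases hs : s ∈ refSimplex d
  · rw [Set.indicator_of_mem hs, intervalIntegral.integral_of_le (by linarith [hs.2]),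
      ← integral_Icc_eq_integral_Ioc, ← integral_indicator measurableSet_Icc]
    congr 1
    funext a
    simp only [hcons, Set.indicator, cons_mem_refSimplex, hs, true_and]
  · rw [Set.indicator_of_notMem hs]
    simp [hcons, Set.indicator, cons_mem_refSimplex, hs]

variable [CompleteSpace E] {g : V3 → E}

theorem integral_fderiv_edge (v : Fin (d + 2) → V3) (hg : ContDiff ℝ 1 g) :
    ∫ t in refSimplex (d + 1), fderiv ℝ g (simplexParam v t) (v 1 - v 0) =
      (∫ s in refSimplex d, g (simplexParam (v ∘ Fin.succAbove 0) s)) -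
        ∫ s in refSimplex d, g (simplexParam (v ∘ Fin.succAbove 1) s) := by
  have hc : Continuous fun x => fderiv ℝ g x (v 1 - v 0) :=
    (hg.continuous_fderiv (by simp)).clm_apply continuous_const
  have hc' := integral_refSimplex_succ (hc.comp (continuous_simplexParam v))
  simp only [Function.comp_apply] at hc'
  rw [hc']
  have hpar : ∀ (a : ℝ) (s : Fin d → ℝ), simplexParam v (Fin.cons a s) =
      simplexParam (v ∘ Fin.succAbove 1) s + a • (v 1 - v 0) := by
    intro a s
    simp only [simplexParam, Fin.sum_univ_succ (n := d), Fin.cons_zero, Fin.cons_succ,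
      Function.comp_apply, Fin.one_succAbove_zero, Fin.one_succAbove_succ, Fin.succ_zero_eq_one]
    abel
  have hend : ∀ s : Fin d → ℝ, simplexParam v (Fin.cons (1 - ∑ i, s i) s) =
      simplexParam (v ∘ Fin.succAbove 0) s := by
    intro s
    rw [simplexParam_eq_sum, simplexParam_eq_sum, Fin.sum_univ_succ]
    simp only [bary_zero, Fin.sum_univ_succ, Fin.cons_zero, Fin.cons_succ, bary_succ,
      Function.comp_apply, Fin.zero_succAbove]
    simp
  have hFTC : ∀ s : Fin d → ℝ, ∫ a in (0 : ℝ)..(1 - ∑ i, s i),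
      fderiv ℝ g (simplexParam v (Fin.cons a s)) (v 1 - v 0) =
        g (simplexParam (v ∘ Fin.succAbove 0) s) - g (simplexParam (v ∘ Fin.succAbove 1) s) := by
    intro s
    rw [intervalIntegral.integral_eq_sub_of_hasDerivAt
      (f := fun a => g (simplexParam v (Fin.cons a s)))]
    · rw [hend, hpar, zero_smul, add_zero]
    · intro a _
      have h1 : HasDerivAt (fun a : ℝ => simplexParam v (Fin.cons a s)) (v 1 - v 0) a := by
        simp only [hpar]
        simpa using ((hasDerivAt_id a).smul_const (v 1 - v 0)).const_add
          (simplexParam (v ∘ Fin.succAbove 1) s)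
      exact ((hg.differentiable (by simp)) _).hasFDerivAt.comp_hasDerivAt a h1
    · refine Continuous.intervalIntegrable ?_ _ _
      simp only [hpar]
      exact hc.comp (by fun_prop)
  have hgc : ∀ u : Fin (d + 1) → V3, IntegrableOn (fun s => g (simplexParam u s)) (refSimplex d) :=
    fun u => (hg.continuous.comp (continuous_simplexParam u)).continuousOn.integrableOn_compact
      isCompact_refSimplex
  simp only [hFTC]
  exact integral_sub (hgc _) (hgc _)

/-- Any two enumerations of a finite set of vertices give the same integral. -/
theorem integral_simplexParam_of_range_eq {v w : Fin (d + 1) → V3} (hv : Function.Injective v)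
    (h : Set.range v = Set.range w) (f : V3 → E) :
    ∫ t in refSimplex d, f (simplexParam v t) = ∫ t in refSimplex d, f (simplexParam w t) := by
  have hex : ∀ a, ∃ a', w a' = v a := fun a => by
    have : v a ∈ Set.range w := h ▸ Set.mem_range_self a
    exact this
  choose π hπ using hex
  have hπi : Function.Injective π := fun a a' e => hv (by rw [← hπ, ← hπ, e])
  have e : v = w ∘ (Equiv.ofBijective π ((Fintype.bijective_iff_injective_and_card π).2
      ⟨hπi, rfl⟩) : Equiv.Perm (Fin (d + 1))) := by
    funext a
    simp [hπ]
  rw [e, integral_simplexParam_perm]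

/-- The difference of the integrals over two facets is the integral of the derivative along the
edge that joins the opposite vertices. -/
theorem integral_fderiv_edge' {v : Fin (d + 2) → V3} (hv : Function.Injective v)
    (hg : ContDiff ℝ 1 g) (p : Fin (d + 2)) :
    ∫ t in refSimplex (d + 1), fderiv ℝ g (simplexParam v t) (v p - v 0) =
      (∫ s in refSimplex d, g (simplexParam (v ∘ Fin.succAbove 0) s)) -
        ∫ s in refSimplex d, g (simplexParam (v ∘ Fin.succAbove p) s) := by
  have hperm : ∀ (π : Equiv.Perm (Fin (d + 2))) (q : Fin (d + 2)),
      ∫ s in refSimplex d, g (simplexParam ((v ∘ π) ∘ Fin.succAbove q) s) =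
        ∫ s in refSimplex d, g (simplexParam (v ∘ Fin.succAbove (π q)) s) := by
    intro π q
    refine integral_simplexParam_of_range_eq ((hv.comp π.injective).comp Fin.succAbove_right_injective)
      ?_ g
    rw [Set.range_comp, Set.range_comp v, Set.image_comp, Fin.range_succAbove, Fin.range_succAbove,
      Set.image_compl_eq π.bijective, Set.image_singleton]
  by_cases hp : p = 0
  · subst hp; simp
  have h0 : Equiv.swap 1 p 0 = 0 := Equiv.swap_apply_of_ne_of_ne (by simp) (Ne.symm hp)
  have h1 := integral_fderiv_edge (v ∘ Equiv.swap 1 p) hg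
  rw [hperm, hperm] at h1
  simp only [Function.comp_apply, h0, Equiv.swap_apply_left] at h1
  rw [← h1]
  exact (integral_simplexParam_perm _ v fun x => fderiv ℝ g x (v p - v 0)).symm

open Classical in
/-- The integral over the facet with the vertex set `F`, in units of twice its area. -/
noncomputable def facetIntegral (F : Finset V3) (f : V3 → E) : E :=
  if h : F.card = 3 then
    ∫ t in refSimplex 2, f (simplexParam (fun i => ((F.equivFinOfCardEq h).symm i : V3)) t)
  else 0

theorem facetIntegral_eq {F : Finset V3} {v : Fin 3 → V3} (hv : Function.Injective v)
    (hF : Set.range v = F) (f : V3 → E) :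
    facetIntegral F f = ∫ t in refSimplex 2, f (simplexParam v t) := by
  have h : F.card = 3 := by
    rw [← Set.ncard_coe_finset, ← hF, Set.ncard_range_of_injective hv]; simp
  rw [facetIntegral, dif_pos h]
  refine integral_simplexParam_of_range_eq (Subtype.val_injective.comp (Equiv.injective _)) ?_ f
  rw [hF]
  ext x
  simp only [Set.mem_range, Finset.mem_coe]
  constructor
  · rintro ⟨a, rfl⟩; exact Subtype.property _
  · intro hi
    exact ⟨F.equivFinOfCardEq h ⟨x, hi⟩, by simp⟩

/-- The determinant of three vectors of `𝕍`. -/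
noncomputable def det3 (u v w : V3) : ℝ := Matrix.det !![u 0, u 1, u 2; v 0, v 1, v 2; w 0, w 1, w 2]

variable {ι : Type} [Fintype ι] (b : AffineBasis ι ℝ V3)

theorem mem_convexHull_range_iff {x : V3} :
    x ∈ convexHull ℝ (Set.range b) ↔ ∀ i, 0 ≤ b.coord i x := by
  rw [b.convexHull_eq_nonneg_coord]; rfl

theorem image_simplexParam {c : Fin (d + 1) → ι} (hc : Function.Bijective c) :
    simplexParam (b ∘ c) '' refSimplex d = convexHull ℝ (Set.range b) := by
  refine Set.Subset.antisymm ?_ fun x hx => ?_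
  · rintro _ ⟨t, ht, rfl⟩
    exact simplexParam_mem_convexHull _ ht fun a => ⟨c a, rfl⟩
  · obtain ⟨t, rfl, ht⟩ := exists_simplexParam_eq b hc.injective (x := x)
      fun i hi => absurd (hc.surjective i) (by simpa using hi)
    refine ⟨t, mem_refSimplex_iff.2 fun a => ?_, rfl⟩
    rw [ht]
    exact (mem_convexHull_range_iff b).1 hx _

theorem simplexParam_injective {c : Fin (d + 1) → ι} (hc : Function.Injective c) :
    Function.Injective (simplexParam (b ∘ c)) := by
  intro s t h
  funext i
  rw [← bary_succ s, ← bary_succ t, ← coord_simplexParam_apply b hc, h,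
    coord_simplexParam_apply b hc]

theorem integral_convexHull_eq_det3 {c : Fin 4 → ι} (hc : Function.Bijective c) (f : V3 → E) :
    ∫ x in convexHull ℝ (Set.range b), f x =
      |det3 (b (c 1) - b (c 0)) (b (c 2) - b (c 0)) (b (c 3) - b (c 0))| •
        ∫ t in refSimplex 3, f (simplexParam (b ∘ c) t) := by
  let M : V3 →ₗ[ℝ] V3 := ∑ i : Fin 3,
    (EuclideanSpace.proj (𝕜 := ℝ) i : V3 →L[ℝ] ℝ).toLinearMap.smulRight (b (c i.succ) - b (c 0))
  have hM : ∀ x : V3, b (c 0) + M x = simplexParam (b ∘ c) (WithLp.ofLp x) := by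
    intro x; simp [M, simplexParam]
  have hdet : LinearMap.det M =
      det3 (b (c 1) - b (c 0)) (b (c 2) - b (c 0)) (b (c 3) - b (c 0)) := by
    rw [← LinearMap.det_toMatrix (EuclideanSpace.basisFun (Fin 3) ℝ).toBasis, det3,
      ← Matrix.det_transpose]
    congr 1
    ext i j
    rw [Matrix.transpose_apply, LinearMap.toMatrix_apply]
    fin_cases i <;> fin_cases j <;> simp [M, Fin.sum_univ_three]
  let A : Set V3 := WithLp.ofLp ⁻¹' refSimplex 3
  have hA : MeasurableSet A :=
    (isClosed_refSimplex.preimage (PiLp.continuous_ofLp 2 _)).measurableSet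
  have himg : (fun x => b (c 0) + M x) '' A = convexHull ℝ (Set.range b) := by
    rw [← image_simplexParam b hc]
    simp only [hM]
    ext x
    constructor
    · rintro ⟨y, hy, rfl⟩; exact ⟨_, hy, rfl⟩
    · rintro ⟨y, hy, rfl⟩; exact ⟨WithLp.toLp 2 y, hy, rfl⟩
  have hinj : Set.InjOn (fun x => b (c 0) + M x) A := by
    intro x _ y _ h
    simp only [hM] at h
    exact WithLp.ofLp_injective 2 (simplexParam_injective b hc.injective h)
  have hder : ∀ x ∈ A, HasFDerivWithinAt (fun x => b (c 0) + M x)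
      (LinearMap.toContinuousLinearMap M) A x := fun x _ =>
    ((LinearMap.toContinuousLinearMap M).hasFDerivWithinAt).const_add _
  rw [← himg, integral_image_eq_integral_abs_det_fderiv_smul volume hA hder hinj, integral_smul,
    LinearMap.det_toContinuousLinearMap, hdet]
  congr 1
  simp only [hM]
  exact (PiLp.volume_preserving_ofLp (Fin 3)).setIntegral_preimage_emb
    (MeasurableEquiv.toLp 2 (Fin 3 → ℝ)).symm.measurableEmbedding
    (fun t => f (simplexParam (b ∘ c) t)) (refSimplex 3)

/-- The volume of a tetrahedron, in units of that of the reference simplex. -/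
noncomputable def tetScale : ℝ :=
  volume.real (convexHull ℝ (Set.range b)) / volume.real (refSimplex 3)

theorem tetScale_pos : 0 < tetScale b := by
  refine div_pos ?_ (ENNReal.toReal_pos volume_refSimplex_ne_zero volume_refSimplex_ne_top)
  refine ENNReal.toReal_pos (ne_of_gt ?_) ?_
  · exact (isOpen_interior.measure_pos volume
      (interior_convexHull_nonempty_iff_affineSpan_eq_top.2 b.tot)).trans_le
      (measure_mono interior_subset)
  · exact ((Set.finite_range b).isCompact_convexHull ℝ).measure_lt_top.ne

theorem tetScale_eq {c : Fin 4 → ι} (hc : Function.Bijective c) : tetScale b =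
    |det3 (b (c 1) - b (c 0)) (b (c 2) - b (c 0)) (b (c 3) - b (c 0))| := by
  have h := integral_convexHull_eq_det3 b hc fun _ => (1 : ℝ)
  have h0 : volume.real (refSimplex 3) ≠ 0 :=
    (ENNReal.toReal_pos volume_refSimplex_ne_zero volume_refSimplex_ne_top).ne'
  simp only [setIntegral_const, smul_eq_mul, mul_one] at h
  rw [tetScale, h, mul_div_cancel_right₀ _ h0]

theorem card_affineBasis (b : AffineBasis ι ℝ V3) : Fintype.card ι = 4 := by
  have : Nonempty ι := b.nonempty
  have h := b.ind.finrank_vectorSpan_add_one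
  rw [← direction_affineSpan, b.tot, AffineSubspace.direction_top, finrank_top] at h
  simpa using h.symm

variable [DecidableEq ι]

open Classical in
/-- The divergence theorem on a tetrahedron. The gradient of a barycentric coordinate is an inner
normal to the opposite facet, of length the area of the facet divided by three times the volume. -/
theorem integral_fderiv_convexHull (hg : ContDiff ℝ 1 g) (w : V3) :
    ∫ x in convexHull ℝ (Set.range b), fderiv ℝ g x w =
      -(tetScale b • ∑ p, dcoord b p w • facetIntegral ((Finset.univ.erase p).image b) g) := by
  let c : Fin 4 ≃ ι := (Fintype.equivFinOfCardEq (card_affineBasis b)).symm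
  rw [integral_convexHull_eq_det3 b c.bijective, ← tetScale_eq b c.bijective, ← smul_neg]
  congr 1
  have hbc : Function.Injective (b ∘ c) := b.ind.injective.comp c.injective
  have hfac : ∀ a : Fin 4, ∫ s in refSimplex 2, g (simplexParam ((b ∘ c) ∘ Fin.succAbove a) s) =
      facetIntegral ((Finset.univ.erase (c a)).image b) g := by
    intro a
    refine (facetIntegral_eq (hbc.comp Fin.succAbove_right_injective) ?_ g).symm
    rw [Set.range_comp, Set.image_comp, Fin.range_succAbove, Set.image_compl_eq c.bijective,
      Set.image_singleton]
    ext; simp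
  have hw : w = ∑ a, dcoord b (c a) w • (b (c a) - b (c 0)) := by
    simp only [smul_sub, Finset.sum_sub_distrib, ← Finset.sum_smul]
    rw [Equiv.sum_comp c (fun i => dcoord b i w • b i), Equiv.sum_comp c (fun i => dcoord b i w),
      sum_dcoord, sum_dcoord_smul, zero_smul, sub_zero]
  have hint : ∀ u : V3, IntegrableOn (fun t => fderiv ℝ g (simplexParam (b ∘ c) t) u)
      (refSimplex 3) := fun u =>
    (((hg.continuous_fderiv (by simp)).clm_apply continuous_const).comp
      (continuous_simplexParam _)).continuousOn.integrableOn_compact isCompact_refSimplex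
  have h1 : ∀ t : Fin 3 → ℝ, fderiv ℝ g (simplexParam (b ∘ c) t) w =
      ∑ a, dcoord b (c a) w • fderiv ℝ g (simplexParam (b ∘ c) t) (b (c a) - b (c 0)) := by
    intro t
    conv_lhs => rw [hw]
    simp only [map_sum, map_smul]
  simp only [h1]
  rw [integral_finsetSum _ fun a _ => by exact (hint _).smul (dcoord b (c a) w)]
  have h2 := fun a => integral_fderiv_edge' hbc hg a
  simp only [Function.comp_apply] at h2
  simp only [Function.comp_def] at h2 hfac ⊢
  simp only [integral_smul, h2, hfac, smul_sub, Finset.sum_sub_distrib, ← Finset.sum_smul]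
  rw [Equiv.sum_comp c (fun i => dcoord b i w), sum_dcoord, zero_smul, zero_sub,
    ← Equiv.sum_comp c]

theorem det3_sub_base (q f₀ f₁ f₂ : V3) :
    det3 (f₀ - q) (f₁ - q) (f₂ - q) = det3 (f₀ - q) (f₁ - f₀) (f₂ - f₀) := by
  simp only [det3, Matrix.det_fin_three, PiLp.sub_apply, Matrix.cons_val', Matrix.cons_val,
    Matrix.of_apply]
  ring

theorem det3_eq_dcoord_mul {c : Fin 4 → ι} (hc : Function.Bijective c) (w : V3) :
    det3 w (b (c 2) - b (c 1)) (b (c 3) - b (c 1)) = dcoord b (c 0) w *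
      det3 (b (c 0) - b (c 1)) (b (c 2) - b (c 1)) (b (c 3) - b (c 1)) := by
  have hw : w = ∑ a, dcoord b (c a) w • (b (c a) - b (c 1)) := by
    simp only [smul_sub, Finset.sum_sub_distrib, ← Finset.sum_smul]
    rw [hc.sum_comp (fun i => dcoord b i w • b i), hc.sum_comp (fun i => dcoord b i w),
      sum_dcoord, sum_dcoord_smul, zero_smul, sub_zero]
  rw [Fin.sum_univ_four, sub_self, smul_zero, add_zero] at hw
  generalize dcoord b (c 0) w = x, dcoord b (c 2) w = y, dcoord b (c 3) w = z at *
  subst hw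
  simp only [det3, Matrix.det_fin_three, PiLp.sub_apply, PiLp.add_apply, PiLp.smul_apply,
    Matrix.cons_val', Matrix.cons_val, Matrix.of_apply, smul_eq_mul]
  ring

/-- Two tetrahedra on opposite sides of a common facet have opposite normals. -/
theorem tetScale_mul_dcoord_add_eq_zero {ι' : Type} [Fintype ι'] [DecidableEq ι']
    (b' : AffineBasis ι' ℝ V3)
    {c : Fin 4 → ι} (hc : Function.Bijective c) {c' : Fin 4 → ι'} (hc' : Function.Bijective c')
    (h : ∀ i : Fin 3, b (c i.succ) = b' (c' i.succ)) (hneg : b.coord (c 0) (b' (c' 0)) < 0)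
    (w : V3) : tetScale b * dcoord b (c 0) w + tetScale b' * dcoord b' (c' 0) w = 0 := by
  have h1 : b' (c' 1) = b (c 1) := (h 0).symm
  have h2 : b' (c' 2) = b (c 2) := (h 1).symm
  have h3 : b' (c' 3) = b (c 3) := (h 2).symm
  have e1 := det3_eq_dcoord_mul b hc w
  have e2 := det3_eq_dcoord_mul b' hc' w
  have e3 := det3_eq_dcoord_mul b hc (b' (c' 0) - b (c 1))
  have hneg' : dcoord b (c 0) (b' (c' 0) - b (c 1)) < 0 := by
    rw [dcoord_sub, b.coord_apply_ne (hc.injective.ne (by decide)), sub_zero]; exact hneg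
  have hflip : ∀ x y u v : V3, det3 (x - y) u v = -det3 (y - x) u v := by
    intro x y u v
    simp only [det3, Matrix.det_fin_three, PiLp.sub_apply, Matrix.cons_val', Matrix.cons_val,
      Matrix.of_apply]
    ring
  rw [tetScale_eq b hc, tetScale_eq b' hc', det3_sub_base, det3_sub_base, h1, h2, h3,
    hflip (b (c 1)), hflip (b (c 1)), abs_neg, abs_neg]
  rw [h1, h2, h3] at e2
  rw [e3] at e2 ⊢
  generalize det3 (b (c 0) - b (c 1)) (b (c 2) - b (c 1)) (b (c 3) - b (c 1)) = D at *
  generalize dcoord b (c 0) (b' (c' 0) - b (c 1)) = y at *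
  rw [abs_mul, abs_of_neg hneg']
  rcases abs_cases D with ⟨hD, -⟩ | ⟨hD, -⟩ <;> rw [hD] <;> linarith

end Stokes

/-! ### The geometry of a triangulation -/

theorem mem_convexHull_iff_coord {ι : Type} [Fintype ι] (b : AffineBasis ι ℝ V3) {G : Set V3}
    (hG : G ⊆ Set.range b) {x : V3} :
    x ∈ convexHull ℝ G ↔ (∀ i, 0 ≤ b.coord i x) ∧ ∀ i, b i ∉ G → b.coord i x = 0 := by
  classical
  constructor
  · intro hx
    refine ⟨(mem_convexHull_range_iff b).1 (convexHull_mono hG hx), fun i hi => ?_⟩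
    have h : convexHull ℝ G ⊆ b.coord i ⁻¹' {0} := by
      refine convexHull_min (fun y hy => ?_) ((convex_singleton 0).affine_preimage _)
      obtain ⟨j, rfl⟩ := hG hy
      have : i ≠ j := by rintro rfl; exact hi hy
      simp [b.coord_apply_ne this]
    exact h hx
  · rintro ⟨h1, h2⟩
    have e := b.linear_combination_coord_eq_self x
    rw [← e]
    have hs : ∑ i ∈ Finset.univ.filter (fun i => b i ∈ G), b.coord i x = 1 := by
      rw [← b.sum_coord_apply_eq_one x]
      refine Finset.sum_subset (Finset.subset_univ _) fun i _ hi => h2 i ?_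
      simpa using hi
    rw [← Finset.sum_subset (Finset.subset_univ (Finset.univ.filter fun i => b i ∈ G))]
    · refine (convex_convexHull ℝ G).sum_mem (fun i _ => h1 i) hs fun i hi => ?_
      exact subset_convexHull ℝ G (by simpa using hi)
    · intro i _ hi
      rw [h2 i (by simpa using hi), zero_smul]

namespace Triangulation

variable {Ω : Set V3} (𝒯 : Triangulation Ω)

instance : Finite 𝒯.Tet :=
  (𝒯.finite.subset fun _ h => h.1 : {T | T ∈ 𝒯.complex.faces ∧ T.card = 4}.Finite)

noncomputable instance : Fintype 𝒯.Tet := Fintype.ofFinite _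

noncomputable instance (T : 𝒯.Tet) : DecidableEq ↥T.1 := Classical.decEq _

/-- The vertices of a tetrahedron as an affine basis. -/
noncomputable def basis (T : 𝒯.Tet) : AffineBasis ↥T.1 ℝ V3 where
  toFun := Subtype.val
  ind' := 𝒯.complex.indep T.2.1
  tot' := by
    have : Nonempty ↥T.1 := (𝒯.complex.nonempty_of_mem_faces T.2.1).to_subtype
    rw [(𝒯.complex.indep T.2.1).affineSpan_eq_top_iff_card_eq_finrank_add_one]
    simp [T.2.2]

variable {𝒯}

@[simp] theorem basis_apply (T : 𝒯.Tet) (i : ↥T.1) : 𝒯.basis T i = i := rfl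

theorem range_basis (T : 𝒯.Tet) : Set.range (𝒯.basis T) = T.1 := Subtype.range_coe

theorem mem_hull_iff {T : 𝒯.Tet} {x : V3} :
    x ∈ convexHull ℝ (T.1 : Set V3) ↔ ∀ i, 0 ≤ (𝒯.basis T).coord i x := by
  rw [← range_basis, mem_convexHull_range_iff]

theorem mem_hull_face_iff {T : 𝒯.Tet} {G : Set V3} (hG : G ⊆ T.1) {x : V3} :
    x ∈ convexHull ℝ G ↔ (∀ i, 0 ≤ (𝒯.basis T).coord i x) ∧
      ∀ i : ↥T.1, (i : V3) ∉ G → (𝒯.basis T).coord i x = 0 :=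
  mem_convexHull_iff_coord (𝒯.basis T) (by rwa [range_basis])

theorem interior_hull (T : 𝒯.Tet) : interior (convexHull ℝ (T.1 : Set V3)) =
    {x | ∀ i, 0 < (𝒯.basis T).coord i x} := by
  rw [← range_basis, (𝒯.basis T).interior_convexHull]

theorem hull_subset_space (T : 𝒯.Tet) : convexHull ℝ (T.1 : Set V3) ⊆ 𝒯.complex.space :=
  𝒯.complex.convexHull_subset_space T.2.1

theorem mem_space_iff {x : V3} :
    x ∈ 𝒯.complex.space ↔ ∃ T : 𝒯.Tet, x ∈ convexHull ℝ (T.1 : Set V3) := by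
  constructor
  · intro hx
    obtain ⟨s, hs, hxs⟩ := 𝒯.complex.mem_space_iff.1 hx
    obtain ⟨t, ht, hst, hc⟩ := 𝒯.pure s hs
    exact ⟨⟨t, ht, hc⟩, convexHull_mono (by exact_mod_cast hst) hxs⟩
  · rintro ⟨T, hT⟩; exact hull_subset_space T hT

theorem interior_hull_subset (T : 𝒯.Tet) : interior (convexHull ℝ (T.1 : Set V3)) ⊆ Ω := by
  conv_rhs => rw [← 𝒯.interior_space]
  exact interior_mono (hull_subset_space T)

theorem isOpen_domain (𝒯 : Triangulation Ω) : IsOpen Ω := by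
  rw [← 𝒯.interior_space]; exact isOpen_interior

theorem exists_mem_hull {x : V3} (hx : x ∈ Ω) : ∃ T : 𝒯.Tet, x ∈ convexHull ℝ (T.1 : Set V3) := by
  rw [← 𝒯.interior_space] at hx
  exact mem_space_iff.1 (interior_subset hx)

theorem isCompact_hull (T : 𝒯.Tet) : IsCompact (convexHull ℝ (T.1 : Set V3)) :=
  T.1.finite_toSet.isCompact_convexHull ℝ

theorem isClosed_hull (T : 𝒯.Tet) : IsClosed (convexHull ℝ (T.1 : Set V3)) :=
  (isCompact_hull T).isClosed

theorem hull_subset_closure (T : 𝒯.Tet) : convexHull ℝ (T.1 : Set V3) ⊆ closure Ω := by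
  have h : (interior (convexHull ℝ (T.1 : Set V3))).Nonempty := by
    rw [interior_convexHull_nonempty_iff_affineSpan_eq_top, ← range_basis]
    exact (𝒯.basis T).tot
  refine subset_closure.trans ?_
  rw [← (convex_convexHull ℝ (T.1 : Set V3)).closure_interior_eq_closure_of_nonempty_interior h]
  exact closure_mono (interior_hull_subset T)

theorem eq_of_subset {T T' : 𝒯.Tet} (h : T.1 ⊆ T'.1) : T = T' :=
  Subtype.ext (Finset.eq_of_subset_of_card_le h (by rw [T.2.2, T'.2.2]))

theorem coord_eq_zero_of_mem_hull {T T' : 𝒯.Tet} {x : V3}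
    (hx : x ∈ convexHull ℝ (T.1 : Set V3)) (hx' : x ∈ convexHull ℝ (T'.1 : Set V3)) (p : ↥T.1)
    (hp : (p : V3) ∉ T'.1) : (𝒯.basis T).coord p x = 0 := by
  have h := 𝒯.complex.inter_subset_convexHull T.2.1 T'.2.1 ⟨hx, hx'⟩
  exact ((mem_hull_face_iff Set.inter_subset_left).1 h).2 p fun h => hp h.2

theorem eq_of_mem_interior {T T' : 𝒯.Tet} {x : V3}
    (hx : x ∈ interior (convexHull ℝ (T.1 : Set V3))) (hx' : x ∈ convexHull ℝ (T'.1 : Set V3)) :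
    T = T' := by
  refine eq_of_subset fun p hp => ?_
  by_contra hp'
  have h1 := coord_eq_zero_of_mem_hull (interior_subset hx) hx' ⟨p, hp⟩ hp'
  rw [interior_hull] at hx
  exact (hx ⟨p, hp⟩).ne' h1

variable (𝒯) in
/-- The facets of the tetrahedra, each given by a tetrahedron and the opposite vertex. -/
def Facet : Type := Σ T : 𝒯.Tet, ↥T.1

/-- The facet of `T` opposite to the vertex `p`. -/
abbrev Facet.mk (T : 𝒯.Tet) (p : ↥T.1) : 𝒯.Facet := Sigma.mk T p

noncomputable instance : Fintype 𝒯.Facet := inferInstanceAs (Fintype (Σ T : 𝒯.Tet, ↥T.1))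

noncomputable instance : DecidableEq 𝒯.Facet := Classical.decEq _

open Classical in
/-- The vertices of a facet. -/
noncomputable def Facet.face (i : 𝒯.Facet) : Finset V3 := i.1.1.erase i.2

/-- The barycentric coordinate of the vertex opposite to a facet. -/
noncomputable def Facet.height (i : 𝒯.Facet) : V3 →ᵃ[ℝ] ℝ := (𝒯.basis i.1).coord i.2

/-- The differential of `Facet.height`, an inner normal covector of the facet. -/
noncomputable def Facet.normal (i : 𝒯.Facet) : V3 →L[ℝ] ℝ := dcoord (𝒯.basis i.1) i.2

theorem Facet.mem_face {i : 𝒯.Facet} {q : V3} : q ∈ i.face ↔ q ≠ i.2 ∧ q ∈ i.1.1 :=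
  Finset.mem_erase

theorem Facet.face_subset (i : 𝒯.Facet) : i.face ⊆ i.1.1 := Finset.erase_subset _ _

theorem Facet.card_face (i : 𝒯.Facet) : i.face.card = 3 := by
  rw [Facet.face, Finset.card_erase_of_mem i.2.2, i.1.2.2]

theorem Facet.mem_hull_iff {i : 𝒯.Facet} {x : V3} : x ∈ convexHull ℝ (i.face : Set V3) ↔
    x ∈ convexHull ℝ (i.1.1 : Set V3) ∧ i.height x = 0 := by
  rw [mem_hull_face_iff (T := i.1) (by exact_mod_cast i.face_subset), Triangulation.mem_hull_iff]
  refine and_congr_right fun _ => ⟨fun h => h i.2 ?_, fun h j hj => ?_⟩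
  · simp [Facet.face]
  · have : j = i.2 := by
      by_contra hne
      exact hj (Facet.mem_face.2 ⟨fun h => hne (Subtype.ext h), j.2⟩)
    rw [this]; exact h

/-- The relative interior of a facet. -/
def Facet.relInterior (i : 𝒯.Facet) : Set V3 :=
  {x | i.height x = 0 ∧ ∀ j, j ≠ i.2 → 0 < (𝒯.basis i.1).coord j x}

theorem Facet.relInterior_subset (i : 𝒯.Facet) :
    i.relInterior ⊆ convexHull ℝ (i.face : Set V3) := by
  rintro x ⟨h0, h1⟩
  refine Facet.mem_hull_iff.2 ⟨Triangulation.mem_hull_iff.2 fun j => ?_, h0⟩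
  by_cases hj : j = i.2
  · subst hj; exact h0.ge
  · exact (h1 j hj).le

theorem Facet.relInterior_nonempty (i : 𝒯.Facet) : i.relInterior.Nonempty := by
  obtain ⟨x, hx⟩ := exists_coord_eq (𝒯.basis i.1) (fun j => if j = i.2 then 0 else 1 / 3) (by
    have h : ∀ j : ↥i.1.1, (if j = i.2 then 0 else 1 / 3 : ℝ) =
        1 / 3 - if j = i.2 then 1 / 3 else 0 := fun j => by split_ifs <;> norm_num
    simp only [h, Finset.sum_sub_distrib, Finset.sum_ite_eq', Finset.mem_univ, if_true,
      Finset.sum_const, Finset.card_univ, Fintype.card_coe, i.1.2.2]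
    norm_num)
  refine ⟨x, by simp [Facet.height, hx], fun j hj => ?_⟩
  simp [hx, hj]

theorem Facet.lineMap_mem_relInterior {i : 𝒯.Facet} {x y : V3} (hx : x ∈ i.relInterior)
    (hy : y ∈ convexHull ℝ (i.face : Set V3)) {ε : ℝ} (h0 : 0 < ε) (h1 : ε ≤ 1) :
    AffineMap.lineMap y x ε ∈ i.relInterior := by
  rw [Facet.mem_hull_iff, Triangulation.mem_hull_iff] at hy
  refine ⟨?_, fun j hj => ?_⟩
  · rw [AffineMap.apply_lineMap, hx.1, hy.2, AffineMap.lineMap_same_apply]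
  · have h2 := hx.2 j hj
    have h3 := hy.1 j
    rw [AffineMap.apply_lineMap, AffineMap.lineMap_apply_module, smul_eq_mul, smul_eq_mul]
    have : 0 ≤ (1 - ε) * (𝒯.basis i.1).coord j y := mul_nonneg (by linarith) h3
    have : 0 < ε * (𝒯.basis i.1).coord j x := mul_pos h0 h2
    linarith

/-- A simplex that meets the relative interior of a facet contains this facet. -/
theorem Facet.face_subset_of_mem {i : 𝒯.Facet} {x : V3} (hx : x ∈ i.relInterior) {s : Finset V3}
    (hs : s ∈ 𝒯.complex.faces) (hxs : x ∈ convexHull ℝ (s : Set V3)) : i.face ⊆ s := by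
  intro q hq
  have h1 := (Facet.mem_hull_iff.1 (i.relInterior_subset hx)).1
  have h := 𝒯.complex.inter_subset_convexHull i.1.2.1 hs ⟨h1, hxs⟩
  by_contra hqs
  obtain ⟨hq1, hq2⟩ := Facet.mem_face.1 hq
  have h2 := ((mem_hull_face_iff (T := i.1) Set.inter_subset_left).1 h).2 ⟨q, hq2⟩
    fun h => hqs h.2
  exact (hx.2 ⟨q, hq2⟩ fun e => hq1 (congrArg Subtype.val e)).ne' h2

theorem Facet.fst_ne {i j : 𝒯.Facet} (hij : i ≠ j) (h : i.face = j.face) : i.1 ≠ j.1 := by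
  obtain ⟨T, p⟩ := i
  obtain ⟨T', q⟩ := j
  rintro hT
  change T = T' at hT
  subst hT
  refine hij ?_
  congr 1
  by_contra hpq
  have h1 : (q : V3) ∈ Facet.face (⟨T, p⟩ : 𝒯.Facet) :=
    Facet.mem_face.2 ⟨fun e => hpq (Subtype.ext e.symm), q.2⟩
  rw [h] at h1
  exact (Facet.mem_face.1 h1).1 rfl

theorem Facet.exists_of_subset {i : 𝒯.Facet} {T : 𝒯.Tet} (h : i.face ⊆ T.1) :
    ∃ j : 𝒯.Facet, j.1 = T ∧ j.face = i.face := by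
  classical
  have hc : (T.1 \ i.face).card = 1 := by
    rw [Finset.card_sdiff_of_subset h, T.2.2, i.card_face]
  obtain ⟨p, hp⟩ := Finset.card_eq_one.1 hc
  have hpT : p ∈ T.1 := by
    have : p ∈ T.1 \ i.face := by rw [hp]; simp
    exact (Finset.mem_sdiff.1 this).1
  refine ⟨⟨T, p, hpT⟩, rfl, ?_⟩
  change T.1.erase p = _
  rw [← Finset.sdiff_singleton_eq_erase, ← hp, Finset.sdiff_sdiff_eq_self h]

/-- Two tetrahedra with a common facet lie on opposite sides of it. -/
theorem Facet.height_neg {i j : 𝒯.Facet} (hij : i ≠ j) (h : i.face = j.face) :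
    i.height j.2 < 0 := by
  by_contra hneg
  push Not at hneg
  obtain ⟨x, hx⟩ := i.relInterior_nonempty
  have hT := Facet.fst_ne hij h
  have hq : (j.2 : V3) ∉ i.1.1 := by
    intro hq
    refine hT (eq_of_subset fun q hq' => ?_).symm
    by_cases e : q = j.2
    · rw [e]; exact hq
    · exact i.face_subset (h ▸ Facet.mem_face.2 ⟨e, hq'⟩)
  -- a point close to `x` on the segment from `x` to the vertex of the second tetrahedron
  have hev : ∀ᶠ ε in nhdsWithin (0 : ℝ) (Set.Ioi 0), ∀ k : ↥i.1.1, k ≠ i.2 →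
      0 < (𝒯.basis i.1).coord k (AffineMap.lineMap x (j.2 : V3) ε) := by
    refine Filter.eventually_all.2 fun k => ?_
    by_cases hk : k = i.2
    · exact .of_forall fun _ h => absurd hk h
    have hcont : Continuous fun ε : ℝ =>
        (𝒯.basis i.1).coord k (AffineMap.lineMap x (j.2 : V3) ε) :=
      (continuous_coord _ k).comp AffineMap.lineMap_continuous
    have h0 : 0 < (𝒯.basis i.1).coord k (AffineMap.lineMap x (j.2 : V3) (0 : ℝ)) := by
      simpa using hx.2 k hk
    exact ((hcont.tendsto 0).mono_left nhdsWithin_le_nhds).eventually_const_lt h0 |>.mono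
      fun ε hε _ => hε
  obtain ⟨ε, hε, hε0, hε1⟩ := (hev.and (Ioc_mem_nhdsGT (zero_lt_one' ℝ))).exists
  have hxj := (Facet.mem_hull_iff.1 (h ▸ i.relInterior_subset hx))
  have hi : AffineMap.lineMap x (j.2 : V3) ε ∈ convexHull ℝ (i.1.1 : Set V3) := by
    refine Triangulation.mem_hull_iff.2 fun k => ?_
    by_cases hk : k = i.2
    · subst hk
      change 0 ≤ i.height _
      rw [AffineMap.apply_lineMap, hx.1, AffineMap.lineMap_apply_module]
      have := mul_nonneg hε0.le hneg
      simpa using this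
    · exact (hε k hk).le
  have hj : AffineMap.lineMap x (j.2 : V3) ε ∈ convexHull ℝ (j.1.1 : Set V3) :=
    (convex_convexHull ℝ _).segment_subset hxj.1 (subset_convexHull ℝ _ j.2.2)
      (segment_eq_image_lineMap ℝ x (j.2 : V3) ▸ ⟨ε, ⟨hε0.le, hε1⟩, rfl⟩)
  have := coord_eq_zero_of_mem_hull hj hi j.2 hq
  change j.height _ = 0 at this
  rw [AffineMap.apply_lineMap, hxj.2, AffineMap.lineMap_apply_module] at this
  have h1 : j.height j.2 = 1 := (𝒯.basis j.1).coord_apply_eq j.2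
  rw [h1] at this
  simp at this
  exact hε0.ne' this

/-- The volume of the tetrahedron of a facet. -/
noncomputable def Facet.scale (i : 𝒯.Facet) : ℝ := tetScale (𝒯.basis i.1)

theorem Facet.scale_pos (i : 𝒯.Facet) : 0 < i.scale := tetScale_pos _

theorem Facet.scale_mul_normal {i j : 𝒯.Facet} (hij : i ≠ j) (h : i.face = j.face) (w : V3) :
    i.scale * i.normal w + j.scale * j.normal w = 0 := by
  let e := i.face.equivFinOfCardEq i.card_face
  have he : ∀ k : 𝒯.Facet, ∀ hk : i.face = k.face, Function.Bijective
      (Fin.cons k.2 fun a => ⟨(e.symm a : V3), k.face_subset (hk ▸ (e.symm a).2)⟩ :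
        Fin 4 → ↥k.1.1) := by
    intro k hk
    rw [Fintype.bijective_iff_injective_and_card]
    refine ⟨Fin.cons_injective_iff.2 ⟨?_, fun a a' h => ?_⟩, by simp [k.1.2.2]⟩
    · rintro ⟨a, ha⟩
      have h1 : (e.symm a : V3) ∈ k.face := hk ▸ (e.symm a).2
      exact (Facet.mem_face.1 h1).1 (congrArg Subtype.val ha)
    · exact e.symm.injective (Subtype.ext (congrArg (fun z : ↥k.1.1 => (z : V3)) h))
  exact tetScale_mul_dcoord_add_eq_zero (𝒯.basis i.1) (𝒯.basis j.1) (he i rfl) (he j h)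
    (fun a => rfl) (Facet.height_neg hij h) w

/-- A facet belongs to at most two tetrahedra. -/
theorem Facet.eq_or_eq_or_eq {i j k : 𝒯.Facet} (hij : i.face = j.face) (hik : i.face = k.face) :
    i = j ∨ i = k ∨ j = k := by
  by_contra hne
  push Not at hne
  obtain ⟨h1, h2, h3⟩ := hne
  obtain ⟨x, hx⟩ := i.relInterior_nonempty
  have hxi := i.relInterior_subset hx
  have e := Facet.scale_mul_normal h1 hij (k.2 - x)
  have hi : i.normal (k.2 - x) < 0 := by
    rw [Facet.normal, dcoord_sub]
    have := Facet.height_neg h2 hik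
    have h0 := hx.1
    rw [Facet.height] at this h0
    linarith
  have hj : j.normal (k.2 - x) < 0 := by
    rw [Facet.normal, dcoord_sub]
    have := Facet.height_neg h3 (hij.symm.trans hik)
    have h0 := (Facet.mem_hull_iff.1 (hij ▸ hxi)).2
    rw [Facet.height] at this h0
    linarith
  nlinarith [mul_neg_of_pos_of_neg i.scale_pos hi, mul_neg_of_pos_of_neg j.scale_pos hj]

/-- A facet that meets the domain belongs to two tetrahedra. -/
theorem Facet.exists_ne {i : 𝒯.Facet} {x : V3} (hx : x ∈ convexHull ℝ (i.face : Set V3))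
    (hxΩ : x ∈ Ω) : ∃ j : 𝒯.Facet, i ≠ j ∧ i.face = j.face := by
  obtain ⟨z, hz⟩ := i.relInterior_nonempty
  obtain ⟨y, hyi, hyΩ⟩ : ∃ y ∈ i.relInterior, y ∈ Ω := by
    have hev : ∀ᶠ ε in nhdsWithin (0 : ℝ) (Set.Ioi 0), AffineMap.lineMap x z ε ∈ Ω := by
      have hcont : Continuous fun ε : ℝ => AffineMap.lineMap x z ε := AffineMap.lineMap_continuous
      refine ((hcont.tendsto 0).mono_left nhdsWithin_le_nhds).eventually ?_
      simp only [AffineMap.lineMap_apply_zero]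
      exact 𝒯.isOpen_domain.mem_nhds hxΩ
    obtain ⟨ε, hε, hε0, hε1⟩ := (hev.and (Ioc_mem_nhdsGT (zero_lt_one' ℝ))).exists
    exact ⟨_, Facet.lineMap_mem_relInterior hz hx hε0 hε1, hε⟩
  -- a point of the domain beyond the facet, close to `y`
  have hU : IsOpen (Ω \ ⋃ T ∈ {T : 𝒯.Tet | y ∉ convexHull ℝ (T.1 : Set V3)},
      convexHull ℝ (T.1 : Set V3)) :=
    𝒯.isOpen_domain.sdiff (Set.Finite.isClosed_biUnion (Set.toFinite _) fun T _ => isClosed_hull T)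
  have hyU : y ∈ Ω \ ⋃ T ∈ {T : 𝒯.Tet | y ∉ convexHull ℝ (T.1 : Set V3)},
      convexHull ℝ (T.1 : Set V3) := by
    refine ⟨hyΩ, fun h => ?_⟩
    obtain ⟨T, hT, hy⟩ := Set.mem_iUnion₂.1 h
    exact hT hy
  have hev : ∀ᶠ ε in nhdsWithin (0 : ℝ) (Set.Iio 0), AffineMap.lineMap y (i.2 : V3) ε ∈
      Ω \ ⋃ T ∈ {T : 𝒯.Tet | y ∉ convexHull ℝ (T.1 : Set V3)}, convexHull ℝ (T.1 : Set V3) := by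
    have hcont : Continuous fun ε : ℝ => AffineMap.lineMap y (i.2 : V3) ε :=
      AffineMap.lineMap_continuous
    refine ((hcont.tendsto 0).mono_left nhdsWithin_le_nhds).eventually ?_
    simp only [AffineMap.lineMap_apply_zero]
    exact hU.mem_nhds hyU
  obtain ⟨ε, ⟨hεΩ, hε⟩, hε0⟩ := (hev.and self_mem_nhdsWithin).exists
  obtain ⟨T, hT⟩ := exists_mem_hull (𝒯 := 𝒯) hεΩ
  have hyT : y ∈ convexHull ℝ (T.1 : Set V3) := by
    by_contra hyT
    exact hε (Set.mem_iUnion₂.2 ⟨T, hyT, hT⟩)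
  obtain ⟨j, rfl, hj⟩ := Facet.exists_of_subset (i := i) (T := T)
    (Facet.face_subset_of_mem hyi T.2.1 hyT)
  refine ⟨j, ?_, hj.symm⟩
  rintro rfl
  have h1 : 0 ≤ i.height _ := Triangulation.mem_hull_iff.1 hT i.2
  have h2 : i.height i.2 = 1 := (𝒯.basis i.1).coord_apply_eq i.2
  rw [AffineMap.apply_lineMap, hyi.1, AffineMap.lineMap_apply_module, h2] at h1
  simp at h1
  exact absurd hε0 (not_lt.2 h1)

end Triangulation

/-! ### Piecewise smooth forms and their weak exterior derivative -/

section NormalWedge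

variable {k : ℕ} {X : Type} [NormedAddCommGroup X] [NormedSpace ℝ X]

/-- The exterior product of a linear form and an alternating form. -/
noncomputable def normalWedge (f : V3 →L[ℝ] ℝ) (α : Alt k X) : Alt (k + 1) X :=
  ContinuousAlternatingMap.alternatizeUncurryFin (f.smulRight α)

theorem normalWedge_apply (f : V3 →L[ℝ] ℝ) (α : Alt k X) (v : Fin (k + 1) → V3) :
    normalWedge f α v = ∑ j : Fin (k + 1), ((-1 : ℝ) ^ (j : ℕ) * f (v j)) • α (j.removeNth v) := by
  rw [normalWedge, ContinuousAlternatingMap.alternatizeUncurryFin_apply]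
  refine Finset.sum_congr rfl fun j _ => ?_
  rw [ContinuousLinearMap.smulRight_apply, ContinuousAlternatingMap.smul_apply, mul_smul]
  rcases neg_one_pow_eq_or ℤ (j : ℕ) with h | h <;> rcases neg_one_pow_eq_or ℝ (j : ℕ) with h' | h'
  · rw [h, h', one_smul, one_smul]
  · exfalso
    have := congrArg (Int.cast : ℤ → ℝ) h
    push_cast at this
    rw [this] at h'; norm_num at h'
  · exfalso
    have := congrArg (Int.cast : ℤ → ℝ) h
    push_cast at this
    rw [this] at h'; norm_num at h'
  · rw [h, h', neg_smul, neg_smul, one_smul, one_smul]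

theorem normalWedge_sub (f : V3 →L[ℝ] ℝ) (α β : Alt k X) :
    normalWedge f (α - β) = normalWedge f α - normalWedge f β := by
  ext v
  simp [normalWedge_apply, smul_sub, Finset.sum_sub_distrib]

theorem smul_normalWedge_add {f g : V3 →L[ℝ] ℝ} {c c' : ℝ} (h : ∀ w, c * f w + c' * g w = 0)
    (α β : Alt k X) (v : Fin (k + 1) → V3) :
    c • normalWedge f α v + c' • normalWedge g β v = c • normalWedge f (α - β) v := by
  have h' : c • normalWedge f β v + c' • normalWedge g β v = 0 := by
    simp only [normalWedge_apply, Finset.smul_sum, ← Finset.sum_add_distrib, smul_smul, ← add_smul]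
    refine Finset.sum_eq_zero fun j _ => ?_
    rw [show c * ((-1) ^ (j : ℕ) * f (v j)) + c' * ((-1) ^ (j : ℕ) * g (v j)) =
      (-1) ^ (j : ℕ) * (c * f (v j) + c' * g (v j)) by ring, h, mul_zero, zero_smul]
  rw [normalWedge_sub, ContinuousAlternatingMap.sub_apply, smul_sub, ← sub_eq_zero, ← h']
  abel

theorem continuous_normalWedge {f : V3 →L[ℝ] ℝ} {ω : V3 → Alt k X} (hω : Continuous ω)
    (v : Fin (k + 1) → V3) : Continuous fun x => normalWedge f (ω x) v := by
  simp only [normalWedge_apply]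
  refine continuous_finsetSum _ fun j _ => continuous_const.smul ?_
  exact (ContinuousAlternatingMap.apply ℝ V3 X (j.removeNth v)).continuous.comp hω

/-- An alternating form vanishes on a plane if its product with the normal covector vanishes. -/
theorem apply_eq_zero_of_normalWedge {f : V3 →L[ℝ] ℝ} {α : Alt k X} (h : normalWedge f α = 0)
    {n : V3} (hn : f n = 1) {v : Fin k → V3} (hv : ∀ j, f (v j) = 0) : α v = 0 := by
  have h1 := congrArg (fun β : Alt (k + 1) X => β (Fin.cons n v)) h
  simp only [normalWedge_apply, Fin.sum_univ_succ, Fin.cons_succ, hv, mul_zero, zero_smul,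
    Finset.sum_const_zero, add_zero, Fin.cons_zero, hn, Fin.val_zero, pow_zero, mul_one,
    one_smul] at h1
  rw [Fin.removeNth_zero, Fin.tail_cons] at h1
  exact h1

theorem normalWedge_eq_zero {ι : Type} [Fintype ι] [DecidableEq ι] (b : AffineBasis ι ℝ V3) (p : ι)
    {α : Alt k X} (h : ∀ v : Fin k → V3, (∀ j, dcoord b p (v j) = 0) → α v = 0) :
    normalWedge (dcoord b p) α = 0 := by
  have : Nontrivial ι := Fintype.one_lt_card_iff_nontrivial.1 (by rw [card_affineBasis b]; simp)
  obtain ⟨q, hq⟩ := exists_ne p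
  refine ContinuousAlternatingMap.toAlternatingMap_injective
    (Module.Basis.ext_alternating (b.basisOf q) fun u hu => ?_)
  change normalWedge (dcoord b p) α (fun i => b.basisOf q (u i)) = 0
  have hd : ∀ j, dcoord b p (b.basisOf q (u j)) = if (u j : ι) = p then 1 else 0 := by
    intro j
    rw [b.basisOf_apply, vsub_eq_sub, dcoord_sub, b.coord_apply_ne hq.symm, sub_zero,
      b.coord_apply]
    simp [eq_comm]
  rw [normalWedge_apply]
  refine Finset.sum_eq_zero fun j _ => ?_
  rw [hd]
  split_ifs with hj
  · rw [h _ fun a => ?_, smul_zero]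
    change dcoord b p (b.basisOf q (u (j.succAbove a))) = 0
    rw [hd, if_neg]
    intro ha
    exact Fin.succAbove_ne j a (hu (Subtype.ext (ha.trans hj.symm)))
  · rw [mul_zero, zero_smul]

end NormalWedge

section FacetIntegral

variable {E : Type*} [NormedAddCommGroup E] [NormedSpace ℝ E]

theorem facetIntegral_congr {F : Finset V3} {f g : V3 → E}
    (h : ∀ x ∈ convexHull ℝ (F : Set V3), f x = g x) : facetIntegral F f = facetIntegral F g := by
  unfold facetIntegral
  split_ifs with hF
  · refine setIntegral_congr_fun isClosed_refSimplex.measurableSet fun t ht => h _ ?_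
    exact simplexParam_mem_convexHull _ ht fun a => Subtype.property _
  · rfl

theorem facetIntegral_eq_zero {F : Finset V3} {f : V3 → E}
    (h : ∀ x ∈ convexHull ℝ (F : Set V3), f x = 0) : facetIntegral F f = 0 := by
  rw [facetIntegral_congr h]
  simp [facetIntegral]

theorem facetIntegral_smul (F : Finset V3) (c : ℝ) (f : V3 → E) :
    facetIntegral F (fun x => c • f x) = c • facetIntegral F f := by
  unfold facetIntegral
  split_ifs with hF
  · exact integral_smul c _
  · rw [smul_zero]

theorem integrableOn_simplexParam {d : ℕ} {f : V3 → E} (hf : Continuous f) (v : Fin (d + 1) → V3) :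
    IntegrableOn (fun t => f (simplexParam v t)) (refSimplex d) :=
  (hf.comp (continuous_simplexParam v)).continuousOn.integrableOn_compact isCompact_refSimplex

theorem facetIntegral_add (F : Finset V3) {f g : V3 → E} (hf : Continuous f) (hg : Continuous g) :
    facetIntegral F (fun x => f x + g x) = facetIntegral F f + facetIntegral F g := by
  unfold facetIntegral
  split_ifs with hF
  · exact integral_add (integrableOn_simplexParam hf _) (integrableOn_simplexParam hg _)
  · rw [add_zero]

theorem facetIntegral_sum {κ : Type*} (s : Finset κ) (F : Finset V3) {f : κ → V3 → E}
    (hf : ∀ j, Continuous (f j)) :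
    facetIntegral F (fun x => ∑ j ∈ s, f j x) = ∑ j ∈ s, facetIntegral F (f j) := by
  classical
  induction s using Finset.induction_on with
  | empty => simpa using facetIntegral_eq_zero (F := F) (f := fun _ => (0 : E)) fun _ _ => rfl
  | insert a s ha ih =>
    simp only [Finset.sum_insert ha]
    rw [facetIntegral_add _ (hf a) (continuous_finsetSum _ fun j _ => hf j), ih]

end FacetIntegral

namespace Triangulation

variable {Ω : Set V3} {𝒯 : Triangulation Ω} {k : ℕ} {X : Type} [NormedAddCommGroup X]
  [NormedSpace ℝ X]

/-- The integrand of the boundary terms in the integration by parts on the tetrahedron of a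
facet. -/
noncomputable def Facet.boundaryTerm (i : 𝒯.Facet) (ω : 𝒯.Piecewise k X) (φ : V3 → ℝ)
    (v : Fin (k + 1) → V3) : X :=
  i.scale • facetIntegral i.face fun x => φ x • normalWedge i.normal (ω i.1 x) v

theorem ae_hull_mem_interior (T : 𝒯.Tet) :
    (interior (convexHull ℝ (T.1 : Set V3)) : Set V3) =ᵐ[volume] convexHull ℝ (T.1 : Set V3) :=
  interior_ae_eq_of_null_frontier ((convex_convexHull ℝ _).addHaar_frontier volume)

theorem ae_domain_eq (𝒯 : Triangulation Ω) :
    Ω =ᵐ[volume] ⋃ T : 𝒯.Tet, interior (convexHull ℝ (T.1 : Set V3)) := by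
  refine Filter.EventuallyLE.antisymm ?_
    (LE.le.eventuallyLE (Set.iUnion_subset fun T => interior_hull_subset T))
  have h1 : (⋃ T : 𝒯.Tet, convexHull ℝ (T.1 : Set V3) : Set V3) =ᵐ[volume]
      ⋃ T : 𝒯.Tet, interior (convexHull ℝ (T.1 : Set V3)) :=
    Filter.EventuallyEq.countable_iUnion fun T => (ae_hull_mem_interior T).symm
  refine Filter.EventuallyLE.trans (LE.le.eventuallyLE fun x hx => ?_) h1.le
  exact Set.mem_iUnion.2 (exists_mem_hull hx)

theorem integral_domain_eq_sum {f : V3 → X} {g : 𝒯.Tet → V3 → X} (hg : ∀ T, Continuous (g T))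
    (h : ∀ T, f =ᵐ[volume.restrict (convexHull ℝ (T.1 : Set V3))] g T) :
    ∫ x in Ω, f x = ∑ T, ∫ x in convexHull ℝ (T.1 : Set V3), g T x := by
  rw [setIntegral_congr_set (ae_domain_eq 𝒯), integral_iUnion_fintype]
  · refine Finset.sum_congr rfl fun T _ => ?_
    rw [setIntegral_congr_set (ae_hull_mem_interior T)]
    exact integral_congr_ae (h T)
  · exact fun T => isOpen_interior.measurableSet
  · intro T T' hne
    rw [Function.onFun, Set.disjoint_left]
    exact fun x hx hx' => hne (eq_of_mem_interior hx (interior_subset hx'))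
  · intro T
    refine IntegrableOn.mono_set ?_ interior_subset
    exact ((hg T).continuousOn.integrableOn_compact (isCompact_hull T)).congr (h T).symm

variable [CompleteSpace X]

/-- Integration by parts on a tetrahedron. -/
theorem integral_hull_eq (ω : 𝒯.Piecewise k X) (T : 𝒯.Tet) (hω : ContDiff ℝ 1 (ω T)) {φ : V3 → ℝ}
    (hφ : ContDiff ℝ 1 φ) (v : Fin (k + 1) → V3) :
    ∫ x in convexHull ℝ (T.1 : Set V3), (φ x • extDeriv (ω T) x v + ∑ j : Fin (k + 1),
        ((-1 : ℝ) ^ (j : ℕ) * fderiv ℝ φ x (v j)) • ω T x (j.removeNth v)) =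
      -∑ p : ↥T.1, (Facet.mk T p).boundaryTerm ω φ v := by
  classical
  let g : Fin (k + 1) → V3 → X := fun j x => φ x • ω T x (j.removeNth v)
  have happ : ∀ u : Fin k → V3, ContDiff ℝ 1 fun x => ω T x u := fun u =>
    (ContinuousAlternatingMap.apply ℝ V3 X u).contDiff.comp hω
  have hg : ∀ j, ContDiff ℝ 1 (g j) := fun j => hφ.smul (happ _)
  have hd : ∀ j x, fderiv ℝ (g j) x (v j) = φ x • fderiv ℝ (ω T) x (v j) (j.removeNth v) +
      fderiv ℝ φ x (v j) • ω T x (j.removeNth v) := by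
    intro j x
    have h1 : HasFDerivAt (fun x => ω T x (j.removeNth v)) _ x :=
      (ContinuousAlternatingMap.apply ℝ V3 X (j.removeNth v)).hasFDerivAt.comp x
        (hω.differentiable (by simp) x).hasFDerivAt
    have h2 := ((hφ.differentiable (by simp) x).hasFDerivAt.smul h1).fderiv
    change fderiv ℝ (g j) x = _ at h2
    rw [h2]
    simp
  have hsgn : ∀ (j : ℕ) (y : X), ((-1 : ℤ) ^ j) • y = ((-1 : ℝ) ^ j) • y := by
    intro j y
    rw [← Int.cast_smul_eq_zsmul ℝ]
    push_cast; rfl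
  have hint : ∀ x, φ x • extDeriv (ω T) x v + ∑ j : Fin (k + 1),
      ((-1 : ℝ) ^ (j : ℕ) * fderiv ℝ φ x (v j)) • ω T x (j.removeNth v) =
        ∑ j : Fin (k + 1), (-1 : ℝ) ^ (j : ℕ) • fderiv ℝ (g j) x (v j) := by
    intro x
    rw [extDeriv, ContinuousAlternatingMap.alternatizeUncurryFin_apply, Finset.smul_sum,
      ← Finset.sum_add_distrib]
    refine Finset.sum_congr rfl fun j _ => ?_
    rw [hd, hsgn, smul_add, smul_comm (φ x), mul_smul]
  simp only [hint]
  have hI : ∀ j : Fin (k + 1), IntegrableOn (fun x => (-1 : ℝ) ^ (j : ℕ) • fderiv ℝ (g j) x (v j))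
      (convexHull ℝ (T.1 : Set V3)) := fun j =>
    (((hg j).continuous_fderiv (by simp)).clm_apply continuous_const |>.const_smul
      _).continuousOn.integrableOn_compact (isCompact_hull T)
  rw [integral_finsetSum _ fun j _ => hI j]
  have hst : ∀ j, ∫ x in convexHull ℝ (T.1 : Set V3), fderiv ℝ (g j) x (v j) =
      -∑ p : ↥T.1, (Facet.mk T p).scale • ((Facet.mk T p).normal (v j) •
        facetIntegral ((Facet.mk T p).face) (g j)) := by
    intro j
    have h := integral_fderiv_convexHull (𝒯.basis T) (hg j) (v j)
    rw [range_basis] at h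
    rw [h, Finset.smul_sum]
    congr 1
    refine Finset.sum_congr rfl fun p _ => ?_
    have hface : (Finset.univ.erase p).image (𝒯.basis T) = (Facet.mk T p).face := by
      ext x
      simp only [Finset.mem_image, Finset.mem_erase, Finset.mem_univ, and_true, Facet.mem_face]
      constructor
      · rintro ⟨q, hq, rfl⟩
        exact ⟨fun e => hq (Subtype.ext e), q.2⟩
      · rintro ⟨hq, hx⟩
        exact ⟨⟨x, hx⟩, fun e => hq (congrArg Subtype.val e), rfl⟩
    rw [hface]; rfl
  simp only [integral_smul, hst, smul_neg, Finset.sum_neg_distrib, Finset.smul_sum]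
  rw [Finset.sum_comm]
  congr 1
  refine Finset.sum_congr rfl fun p _ => ?_
  rw [Facet.boundaryTerm]
  simp only [normalWedge_apply, Finset.smul_sum]
  rw [facetIntegral_sum, Finset.smul_sum]
  · refine Finset.sum_congr rfl fun j _ => ?_
    rw [show (fun x => φ x • ((-1 : ℝ) ^ (j : ℕ) * (Facet.mk T p).normal (v j)) •
        ω T x (j.removeNth v)) = fun x => ((-1 : ℝ) ^ (j : ℕ) * (Facet.mk T p).normal (v j)) • g j x
      from funext fun x => smul_comm _ _ _, facetIntegral_smul, smul_smul, smul_smul, smul_smul]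
    congr 1
    ring
  · exact fun j => hφ.continuous.smul (continuous_const.smul (happ _).continuous)

end Triangulation

/-! ### Membership in `H Λᵏ` and traces on facets -/

/-- A sum vanishes if the terms cancel in pairs, and the unpaired ones vanish. -/
theorem sum_eq_zero_of_pairs {I J E : Type*} [Fintype I] [DecidableEq I] [AddCommGroup E]
    (face : I → J) (B : I → E) (h1 : ∀ i j, i ≠ j → face i = face j → B i + B j = 0)
    (h2 : ∀ i, (∀ j, i ≠ j → face i ≠ face j) → B i = 0)
    (h3 : ∀ i j k, face i = face j → face i = face k → i = j ∨ i = k ∨ j = k) :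
    ∑ i, B i = 0 := by
  classical
  let g : I → I := fun i => if h : ∃ j, i ≠ j ∧ face i = face j then h.choose else i
  have hg : ∀ i, (∃ j, i ≠ j ∧ face i = face j) → i ≠ g i ∧ face i = face (g i) := by
    intro i h
    simp only [g, dif_pos h]
    exact h.choose_spec
  have hg' : ∀ i, (¬ ∃ j, i ≠ j ∧ face i = face j) → g i = i := fun i h => by
    simp only [g, dif_neg h]
  have hB : ∀ i, (¬ ∃ j, i ≠ j ∧ face i = face j) → B i = 0 := fun i h =>
    h2 i fun j hj e => h ⟨j, hj, e⟩
  refine Finset.sum_involution (fun i _ => g i) (fun i _ => ?_) (fun i _ hi => ?_)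
    (fun i _ => Finset.mem_univ _) fun i _ => ?_
  · by_cases h : ∃ j, i ≠ j ∧ face i = face j
    · exact h1 _ _ (hg i h).1 (hg i h).2
    · rw [hg' i h, hB i h, add_zero]
  · have h : ∃ j, i ≠ j ∧ face i = face j := by
      by_contra h
      exact hi (hB i h)
    exact (hg i h).1.symm
  · by_cases h : ∃ j, i ≠ j ∧ face i = face j
    · have h4 := hg i h
      have h5 := hg (g i) ⟨i, h4.1.symm, h4.2.symm⟩
      rcases h3 i (g i) (g (g i)) h4.2 (h4.2.trans h5.2) with h6 | h6 | h6
      · exact absurd h6 h4.1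
      · exact h6.symm
      · exact absurd h6 h5.1
    · rw [hg' i h, hg' i h]

namespace Triangulation

variable {Ω : Set V3} {𝒯 : Triangulation Ω} {k : ℕ} {X : Type} [NormedAddCommGroup X]
  [NormedSpace ℝ X]

variable (𝒯) in
/-- The function on `Ω` with the given restrictions to the tetrahedra. -/
noncomputable def glue (ω : 𝒯.Piecewise k X) (x : V3) : Alt k X :=
  ∑ T : 𝒯.Tet, (interior (convexHull ℝ (T.1 : Set V3))).indicator (ω T) x

theorem glue_ae_eq (ω : 𝒯.Piecewise k X) (T : 𝒯.Tet) :
    𝒯.glue ω =ᵐ[volume.restrict (convexHull ℝ (T.1 : Set V3))] ω T := by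
  rw [← Measure.restrict_congr_set (ae_hull_mem_interior T)]
  refine (ae_restrict_iff' isOpen_interior.measurableSet).2 (.of_forall fun x hx => ?_)
  rw [glue, Finset.sum_eq_single T]
  · rw [Set.indicator_of_mem hx]
  · intro T' _ hne
    exact Set.indicator_of_notMem (fun hx' => hne (eq_of_mem_interior hx' (interior_subset hx))) _
  · simp

theorem memLp_restrict_of_isCompact {E : Type*} [NormedAddCommGroup E] {U K : Set V3}
    (hU : IsOpen U) (hK : IsCompact K) (hUK : U ⊆ K) {f : V3 → E} (hf : Continuous f) :
    MemLp f 2 (volume.restrict U) := by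
  have : IsFiniteMeasure (volume.restrict U) := ⟨by
    rw [Measure.restrict_apply_univ]
    exact (measure_mono hUK).trans_lt hK.measure_lt_top⟩
  obtain ⟨C, hC⟩ := hK.exists_bound_of_continuousOn hf.continuousOn
  refine MemLp.of_bound hf.aestronglyMeasurable C ?_
  exact (ae_restrict_iff' hU.measurableSet).2 (.of_forall fun x hx => hC x (hUK hx))

theorem memLp_indicator_of_isCompact {E : Type*} [NormedAddCommGroup E] {U K : Set V3}
    (hU : IsOpen U) (hK : IsCompact K) (hUK : U ⊆ K) {f : V3 → E} (hf : Continuous f) :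
    MemLp (U.indicator f) 2 volume :=
  (memLp_indicator_iff_restrict hU.measurableSet).2 (memLp_restrict_of_isCompact hU hK hUK hf)

theorem memLp_sum {E κ : Type*} [NormedAddCommGroup E] [Fintype κ] (f : κ → V3 → E)
    {μ : Measure V3} (h : ∀ T, MemLp (f T) 2 μ) : MemLp (fun x => ∑ T, f T x) 2 μ :=
  memLp_finsetSum Finset.univ fun T _ => h T

theorem memLp_glue {ω : 𝒯.Piecewise k X} (hω : ∀ T, Continuous (ω T)) :
    MemLp (𝒯.glue ω) 2 (volume.restrict Ω) := by
  have h := memLp_sum (fun T : 𝒯.Tet => (interior (convexHull ℝ (T.1 : Set V3))).indicator (ω T))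
    (μ := volume.restrict Ω) fun T => (memLp_indicator_of_isCompact isOpen_interior
      (isCompact_hull T) interior_subset (hω T)).restrict Ω
  exact h

theorem isFiniteMeasure_domain (𝒯 : Triangulation Ω) : IsFiniteMeasure (volume.restrict Ω) := by
  refine ⟨?_⟩
  rw [Measure.restrict_apply_univ]
  have h : Ω ⊆ ⋃ T : 𝒯.Tet, convexHull ℝ (T.1 : Set V3) := fun x hx =>
    Set.mem_iUnion.2 (exists_mem_hull hx)
  exact (measure_mono h).trans_lt (isCompact_iUnion fun T => isCompact_hull T).measure_lt_top

/-- The boundary terms of a piecewise form cancel in all integrations by parts against test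
functions. -/
def BoundaryTermsCancel (ω : 𝒯.Piecewise k X) : Prop :=
  ∀ φ : V3 → ℝ, ContDiff ℝ ((⊤ : ℕ∞) : WithTop ℕ∞) φ → HasCompactSupport φ → tsupport φ ⊆ Ω →
    ∀ v : Fin (k + 1) → V3, ∑ i : 𝒯.Facet, i.boundaryTerm ω φ v = 0

/-- The traces of a piecewise form from both sides of a facet agree. -/
def TracesMatch (ω : 𝒯.Piecewise k X) : Prop :=
  ∀ i j : 𝒯.Facet, i.face = j.face → ∀ x ∈ convexHull ℝ (i.face : Set V3), ∀ v : Fin k → V3,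
    (∀ a, i.normal (v a) = 0) → ω i.1 x v = ω j.1 x v

theorem boundaryTerm_add {ω : 𝒯.Piecewise k X} (hω : ∀ T, Continuous (ω T)) {i j : 𝒯.Facet}
    (hij : i ≠ j) (h : i.face = j.face) {φ : V3 → ℝ} (hφ : Continuous φ) (v : Fin (k + 1) → V3) :
    i.boundaryTerm ω φ v + j.boundaryTerm ω φ v =
      i.scale • facetIntegral i.face fun x =>
        φ x • normalWedge i.normal (ω i.1 x - ω j.1 x) v := by
  rw [Facet.boundaryTerm, Facet.boundaryTerm, ← h, ← facetIntegral_smul, ← facetIntegral_smul,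
    ← facetIntegral_smul, ← facetIntegral_add]
  · refine facetIntegral_congr fun x _ => ?_
    rw [smul_comm _ (φ x), smul_comm _ (φ x), smul_comm _ (φ x), ← smul_add,
      smul_normalWedge_add (Facet.scale_mul_normal hij h)]
  · exact (hφ.smul (continuous_normalWedge (hω _) v)).const_smul _
  · exact (hφ.smul (continuous_normalWedge (hω _) v)).const_smul _

theorem TracesMatch.boundaryTermsCancel {ω : 𝒯.Piecewise k X} (hω : ∀ T, Continuous (ω T))
    (h : TracesMatch ω) : BoundaryTermsCancel ω := by
  intro φ hφ _ hsupp v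
  refine sum_eq_zero_of_pairs Facet.face _ (fun i j hij hf => ?_) (fun i hi => ?_)
    fun i j k => Facet.eq_or_eq_or_eq
  · rw [boundaryTerm_add hω hij hf hφ.continuous, facetIntegral_eq_zero, smul_zero]
    intro x hx
    have : normalWedge i.normal (ω i.1 x - ω j.1 x) = 0 := by
      refine normalWedge_eq_zero _ _ fun u hu => ?_
      rw [ContinuousAlternatingMap.sub_apply, h i j hf x hx u hu, sub_self]
    rw [this]
    simp
  · rw [Facet.boundaryTerm, facetIntegral_eq_zero, smul_zero]
    intro x hx
    have : φ x = 0 := by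
      by_contra h0
      obtain ⟨j, hij, hf⟩ := Facet.exists_ne hx (hsupp (subset_tsupport φ h0))
      exact hi j hij hf
    rw [this, zero_smul]

section WeakDerivative

variable [CompleteSpace X]

theorem continuous_extDeriv {ω : V3 → Alt k X} (hω : ContDiff ℝ 1 ω) : Continuous (extDeriv ω) :=
  (ContinuousAlternatingMap.alternatizeUncurryFinCLM ℝ V3 X).continuous.comp
    (hω.continuous_fderiv (by simp))

theorem integral_by_parts {ω : 𝒯.Piecewise k X} (hω : ∀ T, ContDiff ℝ 1 (ω T)) {u : V3 → Alt k X}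
    (hu : ∀ T : 𝒯.Tet, u =ᵐ[volume.restrict (convexHull ℝ (T.1 : Set V3))] ω T)
    {v : Fin (k + 1) → V3} {η : V3 → Alt (k + 1) X}
    (hη : ∀ T : 𝒯.Tet, (fun x => η x v) =ᵐ[volume.restrict (convexHull ℝ (T.1 : Set V3))]
      fun x => extDeriv (ω T) x v) {φ : V3 → ℝ} (hφ : ContDiff ℝ 1 φ) :
    ∫ x in Ω, φ x • η x v = (-∫ x in Ω, ∑ j : Fin (k + 1),
        ((-1 : ℝ) ^ (j : ℕ) * fderiv ℝ φ x (v j)) • u x (j.removeNth v)) -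
      ∑ i : 𝒯.Facet, i.boundaryTerm ω φ v := by
  have hc1 : ∀ T, Continuous fun x => φ x • extDeriv (ω T) x v := fun T =>
    hφ.continuous.smul ((ContinuousAlternatingMap.apply ℝ V3 X v).continuous.comp
      (continuous_extDeriv (hω T)))
  have hc2 : ∀ T, Continuous fun x => ∑ j : Fin (k + 1),
      ((-1 : ℝ) ^ (j : ℕ) * fderiv ℝ φ x (v j)) • ω T x (j.removeNth v) := fun T =>
    continuous_finsetSum _ fun j _ => (continuous_const.mul
      ((hφ.continuous_fderiv (by simp)).clm_apply continuous_const)).smul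
      ((ContinuousAlternatingMap.apply ℝ V3 X _).continuous.comp (hω T).continuous)
  rw [integral_domain_eq_sum hc1 fun T => (hη T).mono fun x hx => by simp only [hx],
    integral_domain_eq_sum hc2 fun T => (hu T).mono fun x hx => by simp only [hx]]
  have h1 : ∑ i : 𝒯.Facet, i.boundaryTerm ω φ v =
      ∑ T : 𝒯.Tet, ∑ p : ↥T.1, (Facet.mk T p).boundaryTerm ω φ v :=
    Fintype.sum_sigma (fun i : Σ T : 𝒯.Tet, ↥T.1 => Facet.boundaryTerm (𝒯 := 𝒯) i ω φ v)
  rw [h1, eq_sub_iff_add_eq, ← sub_eq_zero, sub_neg_eq_add, ← Finset.sum_add_distrib,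
    ← Finset.sum_add_distrib]
  refine Finset.sum_eq_zero fun T _ => ?_
  have h2 := integral_hull_eq ω T (hω T) hφ v
  rw [integral_add ((hc1 T).continuousOn.integrableOn_compact (isCompact_hull T))
    ((hc2 T).continuousOn.integrableOn_compact (isCompact_hull T))] at h2
  rw [add_right_comm, h2, neg_add_cancel]

theorem BoundaryTermsCancel.mem_PPlusSpace {ω : 𝒯.Piecewise k X} {r : ℤ}
    (hω : ∀ T, ω T ∈ PPlus r k X) (h : BoundaryTermsCancel ω) : ω ∈ 𝒯.PPlusSpace r k X := by
  have hω1 : ∀ T, ContDiff ℝ 1 (ω T) := fun T => PPlus.contDiff (hω T) (n := 1)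
  refine ⟨hω, 𝒯.glue ω, ⟨memLp_glue fun T => (hω1 T).continuous,
    𝒯.glue fun T => extDeriv (ω T), memLp_glue fun T => continuous_extDeriv (hω1 T), ?_⟩,
    glue_ae_eq ω⟩
  intro φ hφ hφc hsupp v
  rw [integral_by_parts hω1 (glue_ae_eq ω) (fun T => ?_) (hφ.of_le (by exact_mod_cast le_top)),
    h φ hφ hφc hsupp v, sub_zero]
  exact (glue_ae_eq (fun T => extDeriv (ω T)) T).mono fun x hx => by simp only [hx]

theorem Facet.not_mem_interior {i : 𝒯.Facet} {x : V3} (hx : x ∈ convexHull ℝ (i.face : Set V3))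
    (T : 𝒯.Tet) : x ∉ interior (convexHull ℝ (T.1 : Set V3)) := by
  intro hxT
  rw [Facet.mem_hull_iff] at hx
  obtain rfl := eq_of_mem_interior hxT hx.1
  rw [interior_hull] at hxT
  exact (hxT i.2).ne' hx.2

/-- On each tetrahedron, the weak exterior derivative is the classical one, so that the boundary
terms have to cancel. -/
theorem boundaryTermsCancel_of_mem_PPlusSpace {ω : 𝒯.Piecewise k X} {r : ℤ}
    (h : ω ∈ 𝒯.PPlusSpace r k X) : BoundaryTermsCancel ω := by
  obtain ⟨hω, u, ⟨-, η, hη, hweak⟩, hu⟩ := h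
  have hω1 : ∀ T, ContDiff ℝ 1 (ω T) := fun T => PPlus.contDiff (hω T) (n := 1)
  have : IsFiniteMeasure (volume.restrict Ω) := 𝒯.isFiniteMeasure_domain
  intro φ hφ hφc hsupp v
  have hglue : ∀ T : 𝒯.Tet, (fun x => 𝒯.glue (fun T => extDeriv (ω T)) x v)
      =ᵐ[volume.restrict (convexHull ℝ (T.1 : Set V3))] fun x => extDeriv (ω T) x v := fun T =>
    (glue_ae_eq (fun T => extDeriv (ω T)) T).mono fun x hx => by simp only [hx]
  have hηi : IntegrableOn (fun x => η x v) Ω :=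
    (ContinuousAlternatingMap.apply ℝ V3 X v).integrable_comp (hη.integrable one_le_two)
  have hgi : IntegrableOn (fun x => 𝒯.glue (fun T => extDeriv (ω T)) x v) Ω :=
    (ContinuousAlternatingMap.apply ℝ V3 X v).integrable_comp
      ((memLp_glue fun T => continuous_extDeriv (hω1 T)).integrable one_le_two)
  have hηeq : ∀ T : 𝒯.Tet, (fun x => η x v) =ᵐ[volume.restrict (convexHull ℝ (T.1 : Set V3))]
      fun x => extDeriv (ω T) x v := by
    intro T
    refine Filter.EventuallyEq.trans ?_ (hglue T)
    rw [← Measure.restrict_congr_set (ae_hull_mem_interior T)]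
    have h0 := isOpen_interior.ae_eq_zero_of_integral_contDiff_smul_eq_zero
      (μ := volume) (U := interior (convexHull ℝ (T.1 : Set V3)))
      (f := fun x => η x v - 𝒯.glue (fun T => extDeriv (ω T)) x v)
      (((hηi.sub hgi).mono_set (interior_hull_subset T)).locallyIntegrableOn) ?_
    · refine (ae_restrict_iff' isOpen_interior.measurableSet).2 (h0.mono fun x hx hxT => ?_)
      exact sub_eq_zero.1 (hx hxT)
    · intro g hg hgc hgsupp
      have hgΩ := hgsupp.trans (interior_hull_subset T)
      obtain ⟨C, hC⟩ := hgc.exists_bound_of_continuous hg.continuous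
      have hb : ∀ᵐ x ∂(volume.restrict Ω), ‖g x‖ ≤ C := .of_forall hC
      have hgm : AEStronglyMeasurable g (volume.restrict Ω) := hg.continuous.aestronglyMeasurable
      have e1 := hweak g hg hgc hgΩ v
      have e2 := integral_by_parts hω1 hu hglue (hg.of_le (by exact_mod_cast le_top))
      have e3 : ∑ i : 𝒯.Facet, i.boundaryTerm ω g v = 0 := by
        refine Finset.sum_eq_zero fun i _ => ?_
        rw [Facet.boundaryTerm, facetIntegral_eq_zero, smul_zero]
        intro x hx
        have : g x = 0 := by
          by_contra h0
          exact Facet.not_mem_interior hx T (hgsupp (subset_tsupport g h0))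
        rw [this, zero_smul]
      rw [e3, sub_zero, ← e1] at e2
      rw [← setIntegral_eq_integral_of_forall_compl_eq_zero (s := Ω)]
      · simp only [smul_sub]
        have e4 := integral_sub (Integrable.bdd_smul hηi C hgm hb)
          (Integrable.bdd_smul hgi C hgm hb)
        simp only [Pi.smul_apply'] at e4
        rw [e4, e2, sub_self]
      · intro x hx
        have : g x = 0 := by
          by_contra h0
          exact hx (hgΩ (subset_tsupport g h0))
        rw [this, zero_smul]
  have e1 := hweak φ hφ hφc hsupp v
  rw [integral_by_parts hω1 hu hηeq (hφ.of_le (by exact_mod_cast le_top))] at e1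
  simpa using e1

end WeakDerivative

end Triangulation

namespace Triangulation

variable {Ω : Set V3} {𝒯 : Triangulation Ω} {k : ℕ} {X : Type} [NormedAddCommGroup X]
  [NormedSpace ℝ X]

theorem Facet.relInterior_subset_of_face_eq {i j : 𝒯.Facet} (h : i.face = j.face) :
    i.relInterior ⊆ j.relInterior := by
  intro x hx
  have hxj := Facet.mem_hull_iff.1 (h ▸ i.relInterior_subset hx)
  refine ⟨hxj.2, fun q hq => lt_of_le_of_ne (Triangulation.mem_hull_iff.1 hxj.1 q) fun h0 => ?_⟩
  -- otherwise `x` would lie in the hull of the remaining vertices of the facet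
  have hqf : (q : V3) ∈ i.face := h ▸ Facet.mem_face.2 ⟨fun e => hq (Subtype.ext e), q.2⟩
  have h1 : x ∈ convexHull ℝ ((i.face : Set V3) \ {(q : V3)}) := by
    refine (mem_hull_face_iff (T := j.1) ?_).2 ⟨Triangulation.mem_hull_iff.1 hxj.1, fun q' hq' => ?_⟩
    · rw [h]
      exact Set.sdiff_subset.trans (by exact_mod_cast j.face_subset)
    · by_cases e : q' = q
      · rw [e]; exact h0.symm
      by_cases e' : q' = j.2
      · rw [e']; exact hxj.2
      exfalso
      refine hq' ⟨?_, fun h => e (Subtype.ext h)⟩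
      rw [h]
      exact Facet.mem_face.2 ⟨fun h => e' (Subtype.ext h), q'.2⟩
  have h2 := ((mem_hull_face_iff (T := i.1)
    (Set.sdiff_subset.trans (by exact_mod_cast i.face_subset))).1 h1).2
    ⟨q, i.face_subset hqf⟩ (fun h => h.2 rfl)
  exact (hx.2 ⟨q, i.face_subset hqf⟩ fun e =>
    (Facet.mem_face.1 hqf).1 (congrArg Subtype.val e)).ne' h2

/-- Close to a relative interior point of a facet of two tetrahedra, the domain consists of these
tetrahedra, and there are no points of other facets. -/
theorem Facet.exists_nhds {i j : 𝒯.Facet} (hij : i ≠ j) (h : i.face = j.face) {x : V3}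
    (hx : x ∈ i.relInterior) : ∃ U : Set V3, IsOpen U ∧ x ∈ U ∧ U ⊆ Ω ∧
      ∀ l : 𝒯.Facet, l ≠ i → l ≠ j → ∀ y ∈ U, y ∉ convexHull ℝ (l.face : Set V3) := by
  have hxj := Facet.relInterior_subset_of_face_eq h hx
  let P : 𝒯.Facet → Set V3 := fun l => ⋂ q ∈ {q | q ≠ l.2}, {y | 0 < (𝒯.basis l.1).coord q y}
  have hP : ∀ l, IsOpen (P l) := fun l => Set.Finite.isOpen_biInter (Set.toFinite _) fun q _ =>
    isOpen_lt continuous_const (continuous_coord _ q)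
  have hPm : ∀ l y, y ∈ P l ↔ ∀ q, q ≠ l.2 → 0 < (𝒯.basis l.1).coord q y := by
    intro l y; simp [P]
  let N : Set V3 := ⋃ l ∈ {l : 𝒯.Facet | l.face ≠ i.face}, convexHull ℝ (l.face : Set V3)
  have hN : IsClosed N := Set.Finite.isClosed_biUnion (Set.toFinite _) fun l _ =>
    (l.face.finite_toSet.isCompact_convexHull ℝ).isClosed
  have hUo : IsOpen ((P i ∩ P j) \ N) := ((hP i).inter (hP j)).sdiff hN
  refine ⟨(P i ∩ P j) \ N, hUo, ⟨⟨(hPm i x).2 hx.2, (hPm j x).2 hxj.2⟩, fun hxN => ?_⟩, ?_, ?_⟩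
  · obtain ⟨l, hl, hxl⟩ := Set.mem_iUnion₂.1 hxN
    have h1 : l.face ∈ 𝒯.complex.faces := 𝒯.complex.down_closed l.1.2.1 l.face_subset
      (Finset.card_pos.1 (by rw [l.card_face]; norm_num))
    have h2 := Facet.face_subset_of_mem hx h1 hxl
    exact hl (Finset.eq_of_subset_of_card_le h2 (by rw [l.card_face, i.card_face])).symm
  · rw [← 𝒯.interior_space]
    refine interior_maximal (fun y hy => ?_) hUo
    rw [Triangulation.mem_space_iff]
    have hyi := (hPm i y).1 hy.1.1
    have hyj := (hPm j y).1 hy.1.2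
    by_cases h0 : 0 ≤ i.height y
    · refine ⟨i.1, Triangulation.mem_hull_iff.2 fun q => ?_⟩
      by_cases hq : q = i.2
      · rw [hq]; exact h0
      · exact (hyi q hq).le
    · refine ⟨j.1, Triangulation.mem_hull_iff.2 fun q => ?_⟩
      by_cases hq : q = j.2
      · rw [hq]
        have e := Facet.scale_mul_normal hij h (y - x)
        rw [Facet.normal, Facet.normal, dcoord_sub, dcoord_sub] at e
        have e1 : (𝒯.basis i.1).coord i.2 x = 0 := hx.1
        have e2 : (𝒯.basis j.1).coord j.2 x = 0 := hxj.1
        have e3 : (𝒯.basis i.1).coord i.2 y < 0 := not_le.1 h0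
        rw [e1, e2, sub_zero, sub_zero] at e
        have e4 := mul_neg_of_pos_of_neg i.scale_pos e3
        have e5 : 0 < j.scale * (𝒯.basis j.1).coord j.2 y := by linarith
        exact (pos_of_mul_pos_right e5 j.scale_pos.le).le
      · exact (hyj q hq).le
  · intro l hli hlj y hy hyl
    refine hy.2 (Set.mem_iUnion₂.2 ⟨l, fun e => ?_, hyl⟩)
    rcases Facet.eq_or_eq_or_eq h e.symm with h1 | h1 | h1
    · exact hij h1
    · exact hli h1.symm
    · exact hlj h1.symm

theorem Facet.exists_simplexParam {i : 𝒯.Facet} (f : V3 → ℝ) :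
    ∃ v : Fin 3 → V3, facetIntegral i.face f = ∫ t in refSimplex 2, f (simplexParam v t) ∧
      (∀ a, v a ∈ i.face) ∧ ∀ x ∈ i.relInterior, ∃ t ∈ refInterior 2, simplexParam v t = x := by
  let e := i.face.equivFinOfCardEq i.card_face
  let c : Fin 3 → ↥i.1.1 := fun a => ⟨(e.symm a : V3), i.face_subset (e.symm a).2⟩
  have hc : Function.Injective c := fun a a' h =>
    e.symm.injective (Subtype.ext (congrArg (fun z : ↥i.1.1 => (z : V3)) h))
  have hrange : Set.range (𝒯.basis i.1 ∘ c) = i.face := by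
    ext x
    simp only [Set.mem_range, Finset.mem_coe]
    constructor
    · rintro ⟨a, rfl⟩; exact (e.symm a).2
    · intro hx
      exact ⟨e ⟨x, hx⟩, by simp [c]⟩
  refine ⟨𝒯.basis i.1 ∘ c, facetIntegral_eq ((𝒯.basis i.1).ind.injective.comp hc) hrange f,
    fun a => (e.symm a).2, fun x hx => ?_⟩
  have h0 : ∀ q : ↥i.1.1, (∀ a, c a ≠ q) → (𝒯.basis i.1).coord q x = 0 := by
    intro q hq
    by_contra h0
    have hq2 : (q : V3) ∈ i.face := by
      refine Facet.mem_face.2 ⟨fun h => h0 ?_, q.2⟩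
      rw [Subtype.ext h]; exact hx.1
    exact hq (e ⟨q, hq2⟩) (Subtype.ext (by simp [c]))
  obtain ⟨t, ht, htc⟩ := exists_simplexParam_eq (𝒯.basis i.1) hc h0
  refine ⟨t, fun a => ?_, ht⟩
  rw [htc]
  refine hx.2 _ fun h => ?_
  exact (Facet.mem_face.1 (e.symm a).2).1 (congrArg Subtype.val h)

/-- A continuous function vanishes on a facet if its products with all test functions
supported near a relative interior point have vanishing integrals. -/
theorem Facet.eq_zero_of_facetIntegral [CompleteSpace X] {i : 𝒯.Facet} {J : V3 → X}
    (hJ : Continuous J) {x : V3} (hx : x ∈ i.relInterior) {U : Set V3} (hU : IsOpen U) (hxU : x ∈ U)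
    (h : ∀ φ : V3 → ℝ, ContDiff ℝ ((⊤ : ℕ∞) : WithTop ℕ∞) φ → HasCompactSupport φ →
      tsupport φ ⊆ U → facetIntegral i.face (fun y => φ y • J y) = 0) : J x = 0 := by
  by_contra hne
  obtain ⟨f, hf⟩ := SeparatingDual.exists_eq_one (R := ℝ) hne
  have hV : IsOpen (U ∩ {y | 0 < f (J y)}) :=
    hU.inter (isOpen_lt continuous_const (f.continuous.comp hJ))
  obtain ⟨φ, hφs, hφc, hφ, hφr, hφx⟩ := exists_contDiff_tsupport_subset (n := ⊤)
    (hV.mem_nhds ⟨hxU, by simp [hf]⟩)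
  have h1 := congrArg f (h φ hφ hφc (hφs.trans Set.inter_subset_left))
  have h2 : f (facetIntegral i.face fun y => φ y • J y) =
      facetIntegral i.face fun y => φ y * f (J y) := by
    unfold facetIntegral
    rw [dif_pos i.card_face, dif_pos i.card_face, ← f.integral_comp_comm]
    · simp
    · exact integrableOn_simplexParam (hφ.continuous.smul hJ) _
  rw [h2, map_zero] at h1
  obtain ⟨v, hv, -, hvt⟩ := i.exists_simplexParam fun y => φ y * f (J y)
  obtain ⟨t, ht, rfl⟩ := hvt x hx
  rw [hv] at h1
  have hcont : Continuous fun t => φ (simplexParam v t) * f (J (simplexParam v t)) :=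
    (hφ.continuous.mul (f.continuous.comp hJ)).comp (continuous_simplexParam v)
  have h3 := eq_zero_of_integral_refSimplex hcont.continuousOn (fun s _ => ?_) h1 ht
  · simp only [hφx, hf, one_mul] at h3
    exact one_ne_zero h3
  · by_cases h0 : φ (simplexParam v s) = 0
    · rw [h0, zero_mul]
    · exact mul_nonneg (hφr ⟨_, rfl⟩).1 (hφs (subset_tsupport φ h0)).2.le

/-- If the boundary terms cancel, then the traces on the facets match: test functions supported
close to a relative interior point of a facet isolate the jump across this facet. -/
theorem BoundaryTermsCancel.tracesMatch [CompleteSpace X] {ω : 𝒯.Piecewise k X}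
    (hω : ∀ T, Continuous (ω T)) (h : BoundaryTermsCancel ω) : TracesMatch ω := by
  intro i j hf x hx v hv
  by_cases hij : i = j
  · rw [hij]
  obtain ⟨z, hz⟩ := i.relInterior_nonempty
  have hn : i.normal (i.2 - z) = 1 := by
    have h0 : (𝒯.basis i.1).coord i.2 z = 0 := hz.1
    have h1 : (𝒯.basis i.1).coord i.2 (i.2 : V3) = 1 := (𝒯.basis i.1).coord_apply_eq i.2
    rw [Facet.normal, dcoord_sub, h0, h1, sub_zero]
  have hJ : ∀ u, Continuous fun y => normalWedge i.normal (ω i.1 y - ω j.1 y) u := fun u =>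
    continuous_normalWedge ((hω _).sub (hω _)) u
  have hrel : ∀ u, ∀ y ∈ i.relInterior, normalWedge i.normal (ω i.1 y - ω j.1 y) u = 0 := by
    intro u y hy
    obtain ⟨U, hUo, hyU, hUΩ, hU⟩ := Facet.exists_nhds hij hf hy
    refine Facet.eq_zero_of_facetIntegral (hJ u) hy hUo hyU fun φ hφ hφc hφs => ?_
    have h1 := h φ hφ hφc (hφs.trans hUΩ) u
    rw [← Finset.sum_subset (Finset.subset_univ {i, j}), Finset.sum_pair hij,
      boundaryTerm_add hω hij hf hφ.continuous] at h1
    · exact (smul_eq_zero.1 h1).resolve_left i.scale_pos.ne'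
    · intro l _ hl
      have hl' : l ≠ i ∧ l ≠ j := by simpa using hl
      rw [Facet.boundaryTerm, facetIntegral_eq_zero, smul_zero]
      intro y' hy'
      have : φ y' = 0 := by
        by_contra h0
        exact hU l hl'.1 hl'.2 y' (hφs (subset_tsupport φ h0)) hy'
      rw [this, zero_smul]
  have hx0 : normalWedge i.normal (ω i.1 x - ω j.1 x) = 0 := by
    ext u
    have hcont : Continuous fun ε : ℝ => normalWedge i.normal
        (ω i.1 (AffineMap.lineMap x z ε) - ω j.1 (AffineMap.lineMap x z ε)) u :=
      (hJ u).comp AffineMap.lineMap_continuous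
    have h1 := (hcont.tendsto 0).mono_left (nhdsWithin_le_nhds (s := Set.Ioi 0))
    have h2 := tendsto_nhds_unique h1 (tendsto_const_nhds.congr' ?_ :
      Filter.Tendsto _ _ (nhds (0 : X)))
    · simpa using h2
    · filter_upwards [Ioc_mem_nhdsGT (zero_lt_one' ℝ)] with ε hε
      exact (hrel u _ (Facet.lineMap_mem_relInterior hz hx hε.1 hε.2)).symm
  have := apply_eq_zero_of_normalWedge hx0 hn hv
  rwa [ContinuousAlternatingMap.sub_apply, sub_eq_zero] at this

/-- A piecewise form belongs to `H Λᵏ(Ω; X)` if and only if its traces match. -/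
theorem mem_PPlusSpace_iff [CompleteSpace X] {ω : 𝒯.Piecewise k X} {r : ℤ} :
    ω ∈ 𝒯.PPlusSpace r k X ↔ (∀ T, ω T ∈ PPlus r k X) ∧ TracesMatch ω := by
  have hc : (∀ T, ω T ∈ PPlus r k X) → ∀ T, Continuous (ω T) := fun h T =>
    (PPlus.contDiff (h T) (n := 0)).continuous
  exact ⟨fun h => ⟨h.1, (boundaryTermsCancel_of_mem_PPlusSpace h).tracesMatch (hc h.1)⟩,
    fun h => (h.2.boundaryTermsCancel (hc h.1)).mem_PPlusSpace h.1⟩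

end Triangulation

/-! ### The operator `S` -/

section Alternating

variable {X : Type} [NormedAddCommGroup X] [NormedSpace ℝ X]

theorem alt_ext {k : ℕ} {ω η : Alt k X} (h : ∀ r : Fin k → Fin 3, Function.Injective r →
    ω (fun i => EuclideanSpace.basisFun (Fin 3) ℝ (r i)) =
      η (fun i => EuclideanSpace.basisFun (Fin 3) ℝ (r i))) : ω = η := by
  refine ContinuousAlternatingMap.toAlternatingMap_injective
    (Module.Basis.ext_alternating (EuclideanSpace.basisFun (Fin 3) ℝ).toBasis fun r hr => ?_)
  simpa using h r hr

theorem finiteDimensional_alt [FiniteDimensional ℝ X] (k : ℕ) :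
    FiniteDimensional ℝ (Alt k X) := by
  let L : Alt k X →ₗ[ℝ] ((Fin k → Fin 3) → X) :=
    { toFun := fun ω r => ω fun i => EuclideanSpace.basisFun (Fin 3) ℝ (r i)
      map_add' := fun ω η => rfl
      map_smul' := fun c ω => rfl }
  exact Module.Finite.of_injective L fun ω η h => alt_ext fun r _ => congrFun h r

theorem alt_two_ext {ω η : Alt 2 X} (h : ∀ p q : Fin 3, p < q →
    ω ![EuclideanSpace.basisFun (Fin 3) ℝ p, EuclideanSpace.basisFun (Fin 3) ℝ q] =
      η ![EuclideanSpace.basisFun (Fin 3) ℝ p, EuclideanSpace.basisFun (Fin 3) ℝ q]) : ω = η := by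
  refine alt_ext fun r hr => ?_
  have e : (fun i => EuclideanSpace.basisFun (Fin 3) ℝ (r i)) =
      ![EuclideanSpace.basisFun (Fin 3) ℝ (r 0), EuclideanSpace.basisFun (Fin 3) ℝ (r 1)] := by
    funext i; fin_cases i <;> rfl
  have hsw : ∀ (α : Alt 2 X) (x y : V3), α ![x, y] = -α ![y, x] := by
    intro α x y
    have h1 : α (![y, x] ∘ Equiv.swap 0 1) = -α ![y, x] := α.map_swap ![y, x] (by decide)
    rw [← h1]
    congr 1
    funext i; fin_cases i <;> rfl
  rw [e]
  rcases lt_trichotomy (r 0) (r 1) with h1 | h1 | h1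
  · exact h _ _ h1
  · exact absurd (hr h1) (by decide)
  · rw [hsw ω, hsw η, h _ _ h1]

end Alternating

section SAdjoint

/-- The operator `S` as a linear map. -/
noncomputable def SLin (k : ℕ) : Alt k V3 →ₗ[ℝ] Alt (k + 1) Skew where
  toFun := S
  map_add' ω η := by
    ext v : 1
    simp only [S_apply, ContinuousAlternatingMap.add_apply, map_add, smul_add,
      Finset.sum_add_distrib]
  map_smul' c ω := by
    ext v : 1
    simp only [S_apply, ContinuousAlternatingMap.smul_apply, map_smul, Finset.smul_sum,
      RingHom.id_apply]
    exact Finset.sum_congr rfl fun j _ => smul_comm _ _ _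

@[simp] theorem SLin_apply {k : ℕ} (ω : Alt k V3) : SLin k ω = S ω := rfl

/-- The operator adjoint to `S` with respect to the wedge product: up to the sign, it is formed like
`S`, with the adjoints of the maps `K_v`. -/
noncomputable def SAdj (l : ℕ) : Alt l Skew →ₗ[ℝ] Alt (l + 1) V3 where
  toFun ζ := -ContinuousAlternatingMap.alternatizeUncurryFin
    (LinearMap.toContinuousLinearMap
      { toFun := fun v => (ContinuousLinearMap.adjoint (KMap v)).compContinuousAlternatingMap ζ
        map_add' := by intro v w; ext u : 1; simp
        map_smul' := by intro c v; ext u : 1; simp })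
  map_add' ζ ξ := by
    ext v : 1
    simp only [ContinuousAlternatingMap.neg_apply, ContinuousAlternatingMap.add_apply,
      ContinuousAlternatingMap.alternatizeUncurryFin_apply, LinearMap.coe_toContinuousLinearMap',
      LinearMap.coe_mk, AddHom.coe_mk, ContinuousLinearMap.compContinuousAlternatingMap_coe,
      Function.comp_apply, map_add, smul_add, Finset.sum_add_distrib]
    abel
  map_smul' c ζ := by
    ext v : 1
    simp only [ContinuousAlternatingMap.neg_apply, ContinuousAlternatingMap.smul_apply,
      ContinuousAlternatingMap.alternatizeUncurryFin_apply, LinearMap.coe_toContinuousLinearMap',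
      LinearMap.coe_mk, AddHom.coe_mk, ContinuousLinearMap.compContinuousAlternatingMap_coe,
      Function.comp_apply, map_smul, Finset.smul_sum, RingHom.id_apply, smul_neg]
    congr 1
    exact Finset.sum_congr rfl fun j _ => smul_comm _ _ _

theorem SAdj_apply {l : ℕ} (ζ : Alt l Skew) (v : Fin (l + 1) → V3) :
    SAdj l ζ v = -∑ j : Fin (l + 1),
      (-1 : ℤ) ^ (j : ℕ) • ContinuousLinearMap.adjoint (KMap (v j)) (ζ (j.removeNth v)) := by
  simp [SAdj, ContinuousAlternatingMap.alternatizeUncurryFin_apply]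

theorem S_one_apply (ω : Alt 1 V3) (x y : V3) :
    S ω ![x, y] = KMap x (ω ![y]) - KMap y (ω ![x]) := by
  rw [S_apply, Fin.sum_univ_two]
  have h0 : (0 : Fin 2).removeNth ![x, y] = ![y] := by funext i; fin_cases i; rfl
  have h1 : (1 : Fin 2).removeNth ![x, y] = ![x] := by funext i; fin_cases i; rfl
  rw [h0, h1]
  simp [sub_eq_add_neg]

theorem SAdj_zero_apply (ζ : Alt 0 Skew) (x : V3) :
    SAdj 0 ζ ![x] = -ContinuousLinearMap.adjoint (KMap x) (ζ ![]) := by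
  rw [SAdj_apply, Fin.sum_univ_one]
  have h0 : (0 : Fin 1).removeNth ![x] = ![] := Subsingleton.elim _ _
  rw [h0]
  simp

theorem SAdj_one_apply (ζ : Alt 1 Skew) (x y : V3) :
    SAdj 1 ζ ![x, y] = ContinuousLinearMap.adjoint (KMap y) (ζ ![x]) -
      ContinuousLinearMap.adjoint (KMap x) (ζ ![y]) := by
  rw [SAdj_apply, Fin.sum_univ_two]
  have h0 : (0 : Fin 2).removeNth ![x, y] = ![y] := by funext i; fin_cases i; rfl
  have h1 : (1 : Fin 2).removeNth ![x, y] = ![x] := by funext i; fin_cases i; rfl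
  rw [h0, h1]
  simp only [Fin.val_zero, pow_zero, one_smul, Fin.val_one, pow_one, neg_smul,
    Matrix.cons_val_zero, Matrix.cons_val_one]
  abel

theorem wedge_S_zero (ω : Alt 1 V3) (ζ : Alt 0 Skew) (v : Fin 2 → V3) :
    wedge (k := 2) (l := 0) (S ω) ζ v = wedge (k := 1) (l := 1) ω (SAdj 0 ζ) v := by
  have h1 := wedge_two_zero (S ω) ζ v
  have h2 := wedge_one_one ω (SAdj 0 ζ) v
  rw [SAdj_zero_apply, SAdj_zero_apply, inner_neg_right, inner_neg_right,
    ContinuousLinearMap.adjoint_inner_right, ContinuousLinearMap.adjoint_inner_right] at h2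
  rw [S_one_apply, inner_sub_left] at h1
  refine (h1.trans ?_).trans h2.symm
  ring

theorem wedge_S_one (ω : Alt 1 V3) (ζ : Alt 1 Skew) (v : Fin 3 → V3) :
    wedge (k := 2) (l := 1) (S ω) ζ v = wedge (k := 1) (l := 2) ω (SAdj 1 ζ) v := by
  have h1 := wedge_two_one (S ω) ζ v
  have h2 := wedge_one_two ω (SAdj 1 ζ) v
  simp only [SAdj_one_apply, inner_sub_right, ContinuousLinearMap.adjoint_inner_right] at h2
  simp only [S_one_apply, inner_sub_left] at h1
  refine (h1.trans ?_).trans h2.symm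
  ring

end SAdjoint

section SSurjective

theorem skew_ext {A B : Skew} (h : ∀ i j : Fin 3, i < j → A.1 (i, j) = B.1 (i, j)) : A = B := by
  refine Subtype.ext (PiLp.ext fun p => ?_)
  obtain ⟨i, j⟩ := p
  have hA := A.2
  have hB := B.2
  rcases lt_trichotomy i j with h1 | h1 | h1
  · exact h i j h1
  · subst h1
    have h2 := hA i i
    have h3 := hB i i
    linarith
  · rw [hA i j, hB i j, h j i h1]

theorem KMap_apply_apply (x v : V3) (i j : Fin 3) :
    (KMap x v).1 (i, j) = x i * v j - x j * v i := by
  simp [KMap_apply, skw, outer]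
  ring

/-- In terms of the matrix of the form `ω`, the map `S` is `A ↦ (tr A) I - Aᵀ` up to reindexing,
and hence invertible. -/
theorem S_surjective : Function.Surjective (SLin 1) := by
  intro β
  let e := EuclideanSpace.basisFun (Fin 3) ℝ
  let m : Fin 3 → Fin 3 → Fin 3 → Fin 3 → ℝ := fun p q i j => (β ![e p, e q]).1 (i, j)
  let a := m 0 1 0 1
  let b := m 0 2 0 2
  let c := m 1 2 1 2
  let A : V3 →ₗ[ℝ] V3 := Matrix.toEuclideanLin
    !![(a + b - c) / 2, m 1 2 0 2, -m 1 2 0 1;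
       m 0 2 1 2, (a + c - b) / 2, m 0 2 0 1;
       -m 0 1 1 2, m 0 1 0 2, (b + c - a) / 2]
  refine ⟨ContinuousAlternatingMap.ofSubsingleton ℝ V3 V3 (0 : Fin 1)
    (LinearMap.toContinuousLinearMap A), alt_two_ext fun p q hpq => skew_ext fun i j hij => ?_⟩
  rw [SLin_apply, S_one_apply]
  change (KMap (e p) _).1 (i, j) - (KMap (e q) _).1 (i, j) = m p q i j
  rw [KMap_apply_apply, KMap_apply_apply]
  fin_cases p <;> fin_cases q <;> first | (exact absurd hpq (by decide)) | skip
  all_goals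
    fin_cases i <;> fin_cases j <;> first | (exact absurd hij (by decide)) | skip
  all_goals
    simp [A, a, b, c, e, Matrix.toLpLin_apply]
  all_goals ring

end SSurjective

/-! ### Global interpolation -/

namespace Triangulation

variable {Ω : Set V3} {𝒯 : Triangulation Ω} {k : ℕ} {X : Type} [NormedAddCommGroup X]
  [InnerProductSpace ℝ X]

open Classical in
/-- On the faces `f` of the tetrahedron `T`, the form `ω` has the same degrees of freedom as the
form `η f` prescribed for this face. -/
def Interpolates (T : 𝒯.Tet) (s : ℤ) (ω : V3 → Alt k X) (η : Finset V3 → V3 → Alt k X) : Prop :=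
  ∀ l : ℕ, k + l ≤ 3 → ∀ v : Fin (k + l + 1) → V3, Function.Injective v →
    Set.range v ⊆ (T.1 : Set V3) → ∀ ζ ∈ PolyMap (s - l) (Alt l X),
      simplexPairing v ω ζ = simplexPairing v (η (Finset.univ.image v)) ζ

theorem sameDofs_iff {s : ℤ} {ω η : 𝒯.Piecewise k X} :
    𝒯.SameDofs s ω η ↔ ∀ T, Interpolates T s (ω T) fun _ => η T :=
  ⟨fun h T l hl v hv hvT ζ hζ => h l hl T v hv hvT ζ hζ,
    fun h l hl T v hv hvT ζ hζ => h T l hl v hv hvT ζ hζ⟩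

theorem Interpolates.faceDofs {T : 𝒯.Tet} {s : ℤ} {ω : V3 → Alt k X}
    {η : Finset V3 → V3 → Alt k X} (h : Interpolates T s ω η) (F : Finset ↥T.1) :
    FaceDofs (𝒯.basis T) F s ω (η (F.map (Function.Embedding.subtype _))) := by
  classical
  intro l hl c hc hF ζ hζ
  rw [h l hl _ ((𝒯.basis T).ind.injective.comp hc) ?_ ζ hζ]
  · congr 2
    rw [← hF]
    ext x
    simp
  · rintro _ ⟨a, rfl⟩
    exact (c a).2

theorem interpolates_of_faceDofs {T : 𝒯.Tet} {s : ℤ} {ω : V3 → Alt k X}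
    {η : Finset V3 → V3 → Alt k X}
    (h : ∀ F : Finset ↥T.1, FaceDofs (𝒯.basis T) F s ω (η (F.map (Function.Embedding.subtype _)))) :
    Interpolates T s ω η := by
  classical
  intro l hl v hv hvT ζ hζ
  let c : Fin (k + l + 1) → ↥T.1 := fun a => ⟨v a, hvT ⟨a, rfl⟩⟩
  have hc : Function.Injective c := fun a a' e => hv (congrArg (fun z : ↥T.1 => (z : V3)) e)
  have h1 := h (Finset.univ.image c) l hl c hc rfl ζ hζ
  have h2 : (Finset.univ.image c).map (Function.Embedding.subtype _) = Finset.univ.image v := by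
    ext x
    simp [c]
  rw [h2] at h1
  convert! h1 using 3

variable {T : 𝒯.Tet}

theorem FaceDofs.sub_zero {ι : Type} [Fintype ι] [DecidableEq ι] {b : AffineBasis ι ℝ V3}
    {F : Finset ι} {s s' s'' : ℤ} {ω ω' : V3 → Alt k X} (hω : ω ∈ PPlus s' k X)
    (hω' : ω' ∈ PPlus s'' k X)
    (h : FaceDofs b F s ω ω') : FaceDofs b F s (ω - ω') 0 := by
  intro l hl c hc hF ζ hζ
  have h0 := simplexPairing_smul_left (v := b ∘ c) (ω := (0 : V3 → Alt k X)) (ζ := ζ) 0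
  rw [zero_smul, zero_mul] at h0
  rw [h0, simplexPairing_sub_left (PPlus.onSimplex hω _) (PPlus.onSimplex hω' _)
    (PolyMap.onSimplex hζ _), h l hl c hc hF ζ hζ, sub_self]

/-- The degrees of freedom determine an element of the discrete space. -/
theorem eq_of_sameDofs (H : HasFaceSystems k X) {s : ℤ} {ω ω' : 𝒯.PPlusSpace s k X}
    {η : 𝒯.Piecewise k X} (h : 𝒯.SameDofs s ω.1 η) (h' : 𝒯.SameDofs s ω'.1 η) : ω = ω' := by
  refine Subtype.ext (funext fun T => sub_eq_zero.1 ?_)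
  refine eq_zero_of_faceDofs (b := 𝒯.basis T) H
    (Submodule.sub_mem _ (ω.2.1 T) (ω'.2.1 T)) fun G => ?_
  refine FaceDofs.sub_zero (ω.2.1 T) (ω'.2.1 T) fun l hl c hc hF ζ hζ => ?_
  rw [(sameDofs_iff.1 h T).faceDofs G l hl c hc hF ζ hζ,
    (sameDofs_iff.1 h' T).faceDofs G l hl c hc hF ζ hζ]

/-- Interpolation of compatible data is conforming: the trace on a common facet is determined by the
degrees of freedom on the faces of this facet. -/
theorem tracesMatch_of_interpolates (H : HasFaceSystems k X) {s : ℤ} {ω : 𝒯.Piecewise k X}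
    (hω : ∀ T, ω T ∈ PPlus s k X) {η : Finset V3 → V3 → Alt k X}
    (h : ∀ T, Interpolates T s (ω T) η) : TracesMatch ω := by
  classical
  intro i j hij x hx u hu
  rw [← sub_eq_zero, ← ContinuousAlternatingMap.sub_apply]
  have hF : ∀ q : ↥i.1.1, q ∉ Finset.univ.erase i.2 → q = i.2 := by simp
  refine trace_eq_zero (b := 𝒯.basis i.1) H (Submodule.sub_mem _ (hω i.1) (hω j.1))
    (F := Finset.univ.erase i.2) (fun G hG => ?_) (x := x) (fun q hq => ?_) fun a q hq => ?_
  · refine FaceDofs.sub_zero (hω i.1) (hω j.1) fun l hl c hc hcG ζ hζ => ?_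
    have hv : Function.Injective (𝒯.basis i.1 ∘ c) := (𝒯.basis i.1).ind.injective.comp hc
    have hface : ∀ a, (c a : V3) ∈ i.face := fun a => by
      have h1 : c a ∈ Finset.univ.erase i.2 := hG (hcG ▸ Finset.mem_image_of_mem c (Finset.mem_univ a))
      exact Facet.mem_face.2 ⟨fun e => (Finset.mem_erase.1 h1).1 (Subtype.ext e), (c a).2⟩
    rw [h i.1 l hl _ hv (by rintro _ ⟨a, rfl⟩; exact i.face_subset (hface a)) ζ hζ,
      h j.1 l hl _ hv (by rintro _ ⟨a, rfl⟩; exact j.face_subset (hij ▸ hface a)) ζ hζ]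
  · rw [hF q hq]; exact (Facet.mem_hull_iff.1 hx).2
  · rw [hF q hq]; exact hu a

/-- The degrees of freedom can be prescribed arbitrarily on all faces. -/
theorem exists_global_interpolant (H : HasFaceSystems k X) [FiniteDimensional ℝ X] (s : ℤ)
    (η : Finset V3 → V3 → Alt k X)
    (hη : ∀ (T : 𝒯.Tet) (f : Finset V3), f ⊆ T.1 → ContinuousOn (η f) (convexHull ℝ (f : Set V3))) :
    ∃ ω : 𝒯.PPlusSpace s k X, ∀ T, Interpolates T s (ω.1 T) η := by
  have : ∀ l, FiniteDimensional ℝ (Alt l X) := fun l => finiteDimensional_alt l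
  have : CompleteSpace X := FiniteDimensional.complete ℝ X
  have hloc := fun T : 𝒯.Tet => exists_interpolant (b := 𝒯.basis T) H s
    (fun F => η (F.map (Function.Embedding.subtype _))) fun F => by
      have h1 := hη T (F.map (Function.Embedding.subtype _)) fun x hx => by
        obtain ⟨y, -, rfl⟩ := Finset.mem_map.1 hx
        exact y.2
      rw [Finset.coe_map] at h1
      exact h1
  choose ω hω hωd using hloc
  have hint : ∀ T, Interpolates T s (ω T) η := fun T => interpolates_of_faceDofs (hωd T)
  exact ⟨⟨ω, mem_PPlusSpace_iff.2 ⟨hω, tracesMatch_of_interpolates H hω hint⟩⟩, hint⟩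

/-- The canonical projection is well defined on smooth forms. -/
theorem existsUnique_sameDofs_ofForm (H : HasFaceSystems k X) [FiniteDimensional ℝ X] (s : ℤ)
    {σ : V3 → Alt k X} (hσ : σ ∈ SmoothForm Ω k X) :
    ∃! ω : 𝒯.PPlusSpace s k X, 𝒯.SameDofs s ω.1 (𝒯.ofForm σ) := by
  have hσc : ContDiffOn ℝ ((⊤ : ℕ∞) : WithTop ℕ∞) σ (closure Ω) := hσ
  obtain ⟨ω, hω⟩ := exists_global_interpolant (𝒯 := 𝒯) H s (fun _ => σ) fun T f hf =>
    hσc.continuousOn.mono ((convexHull_mono (by exact_mod_cast hf)).trans (hull_subset_closure T))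
  exact ⟨ω, sameDofs_iff.2 hω, fun ω' hω' => eq_of_sameDofs H hω' (sameDofs_iff.2 hω)⟩

open Classical in
/-- A piecewise form, read on each face from one of the tetrahedra that contain it. -/
noncomputable def onFace (ω : 𝒯.Piecewise k X) (f : Finset V3) : V3 → Alt k X :=
  if h : ∃ T : 𝒯.Tet, f ⊆ T.1 then ω h.choose else 0

theorem exists_onFace_eq (ω : 𝒯.Piecewise k X) {f : Finset V3} {T : 𝒯.Tet} (h : f ⊆ T.1) :
    ∃ T' : 𝒯.Tet, f ⊆ T'.1 ∧ onFace ω f = ω T' := by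
  have h' : ∃ T : 𝒯.Tet, f ⊆ T.1 := ⟨T, h⟩
  exact ⟨h'.choose, h'.choose_spec, by rw [onFace, dif_pos h']⟩

theorem continuousOn_onFace {ω : 𝒯.Piecewise k X} (hω : ∀ T, Continuous (ω T)) (f : Finset V3)
    (s : Set V3) : ContinuousOn (onFace ω f) s := by
  unfold onFace
  split_ifs with h
  · exact (hω _).continuousOn
  · exact continuousOn_const

/-- The degrees of freedom of a 2-form `L ω` whose traces are formed from those of `ω` do not depend
on the tetrahedron from which a trace is taken, as only facets and tetrahedra carry them. -/
theorem TracesMatch.simplexPairing_eq {m l : ℕ} {ω : 𝒯.Piecewise m X} (hω : TracesMatch ω)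
    {Y : Type} [NormedAddCommGroup Y] [InnerProductSpace ℝ Y] (hl : 2 + l ≤ 3)
    (L : Alt m X → Alt 2 Y)
    (hL : ∀ (α β : Alt m X) (w : Fin 2 → V3), (∀ r : Fin m → Fin 2, α (fun a => w (r a)) =
      β fun a => w (r a)) → L α w = L β w)
    {v : Fin (2 + l + 1) → V3} (hv : Function.Injective v) {T T' : 𝒯.Tet}
    (hT : Set.range v ⊆ T.1) (hT' : Set.range v ⊆ T'.1) (ζ : V3 → Alt l Y) :
    simplexPairing v (fun x => L (ω T x)) ζ = simplexPairing v (fun x => L (ω T' x)) ζ := by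
  classical
  have hcard : (Finset.univ.image v).card = 2 + l + 1 := by
    rw [Finset.card_image_of_injective _ hv]; simp
  have hsub : ∀ {T : 𝒯.Tet}, Set.range v ⊆ T.1 → Finset.univ.image v ⊆ T.1 := by
    intro T h x hx
    obtain ⟨a, -, rfl⟩ := Finset.mem_image.1 hx
    exact h ⟨a, rfl⟩
  have : l ≤ 1 := by omega
  interval_cases l
  · obtain ⟨p, hpT, hp⟩ : ∃ p ∈ T.1, p ∉ Finset.univ.image v := by
      by_contra hne
      push Not at hne
      have := Finset.card_le_card (show T.1 ⊆ Finset.univ.image v from hne)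
      rw [hcard, T.2.2] at this
      omega
    have hface : (Facet.mk T ⟨p, hpT⟩).face = Finset.univ.image v := by
      refine (Finset.eq_of_subset_of_card_le (fun x hx => ?_) ?_).symm
      · exact Facet.mem_face.2 ⟨fun e => hp ((show x = p from e) ▸ hx), hsub hT hx⟩
      · rw [hcard, Facet.card_face]
    obtain ⟨j, rfl, hj⟩ := Facet.exists_of_subset (i := Facet.mk T ⟨p, hpT⟩) (T := T')
      (by rw [hface]; exact hsub hT')
    refine simplexPairing_congr fun t ht => wedge_congr (fun r => ?_) fun r => rfl
    refine hL _ _ _ fun r' => ?_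
    refine hω (Facet.mk T ⟨p, hpT⟩) j hj.symm _ ?_ _ fun a => ?_
    · rw [hface]
      exact simplexParam_mem_convexHull v ht fun a => by simp
    · have hzero : ∀ a, (𝒯.basis T).coord ⟨p, hpT⟩ (v a) = 0 := by
        intro a
        have h1 : v a = 𝒯.basis T ⟨v a, hT ⟨a, rfl⟩⟩ := rfl
        rw [h1, (𝒯.basis T).coord_apply_ne]
        intro e
        have e' : p = v a := congrArg (fun z : ↥T.1 => (z : V3)) e
        exact hp (by rw [e']; simp)
      change dcoord (𝒯.basis T) ⟨p, hpT⟩ _ = 0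
      rw [dcoord_sub, hzero, hzero, sub_zero]
  · have h1 : ∀ {T : 𝒯.Tet}, Set.range v ⊆ T.1 → Finset.univ.image v = T.1 := fun {T} h =>
      Finset.eq_of_subset_of_card_le (hsub h) (by rw [hcard, T.2.2])
    have : T = T' := Subtype.ext ((h1 hT).symm.trans (h1 hT'))
    rw [this]

open Classical in
theorem TracesMatch.simplexPairing_onFace {m l : ℕ} {ω : 𝒯.Piecewise m X} (hω : TracesMatch ω)
    {Y : Type} [NormedAddCommGroup Y] [InnerProductSpace ℝ Y] (hl : 2 + l ≤ 3)
    (L : Alt m X → Alt 2 Y)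
    (hL : ∀ (α β : Alt m X) (w : Fin 2 → V3), (∀ r : Fin m → Fin 2, α (fun a => w (r a)) =
      β fun a => w (r a)) → L α w = L β w)
    {v : Fin (2 + l + 1) → V3} (hv : Function.Injective v) {T : 𝒯.Tet} (hT : Set.range v ⊆ T.1)
    (ζ : V3 → Alt l Y) :
    simplexPairing v (fun x => L (onFace ω (Finset.univ.image v) x)) ζ =
      simplexPairing v (fun x => L (ω T x)) ζ := by
  have hf : Finset.univ.image v ⊆ T.1 := fun x hx => by
    obtain ⟨a, -, rfl⟩ := Finset.mem_image.1 hx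
    exact hT ⟨a, rfl⟩
  obtain ⟨T', hT', e⟩ := exists_onFace_eq ω hf
  rw [e]
  refine hω.simplexPairing_eq hl L hL hv (fun x hx => ?_) hT ζ
  obtain ⟨a, rfl⟩ := hx
  exact hT' (by simp)

/-! ### The operator `S_{1,h}` -/

/-- As `S` and its adjoint are algebraic, they turn the degrees of freedom of `S ω` into degrees of
freedom of `ω`. -/
theorem Interpolates.S {r : ℕ} {ω : V3 → Alt 1 V3} {η : Finset V3 → V3 → Alt 1 V3}
    (h : Interpolates T (r + 1) ω η) :
    Interpolates T r (fun x => ElasticityFEM.S (ω x)) fun f x => ElasticityFEM.S (η f x) := by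
  intro l hl v hv hvT ζ hζ
  have : l ≤ 1 := by omega
  interval_cases l
  · have hζ' : (fun x => SAdj 0 (ζ x)) ∈ PolyMap ((r + 1 : ℤ) - (1 : ℕ)) (Alt 1 V3) := by
      have h1 := PolyMap.map (SAdj 0) hζ
      simpa using h1
    have key : ∀ α : V3 → Alt 1 V3, simplexPairing (k := 2) (l := 0) v
        (fun x => ElasticityFEM.S (α x)) ζ =
          simplexPairing (k := 1) (l := 1) v α fun x => SAdj 0 (ζ x) := fun α =>
      congrArg (fun F : (Fin 2 → ℝ) → ℝ => ∫ t in refSimplex 2, F t)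
        (funext fun t => wedge_S_zero _ _ _)
    exact (key _).trans ((h 1 (by norm_num) v hv hvT _ hζ').trans (key _).symm)
  · have hζ' : (fun x => SAdj 1 (ζ x)) ∈ PolyMap ((r + 1 : ℤ) - (2 : ℕ)) (Alt 2 V3) := by
      have h1 := PolyMap.map (SAdj 1) hζ
      have e : ((r : ℤ) + 1 - (2 : ℕ)) = r - (1 : ℕ) := by push_cast; ring
      rw [e]; exact h1
    have key : ∀ α : V3 → Alt 1 V3, simplexPairing (k := 2) (l := 1) v
        (fun x => ElasticityFEM.S (α x)) ζ =
          simplexPairing (k := 1) (l := 2) v α fun x => SAdj 1 (ζ x) := fun α =>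
      congrArg (fun F : (Fin 3 → ℝ) → ℝ => ∫ t in refSimplex 3, F t)
        (funext fun t => wedge_S_one _ _ _)
    exact (key _).trans ((h 2 (by norm_num) v hv hvT _ hζ').trans (key _).symm)

theorem existsUnique_sameDofs_S {r : ℕ} (τ : 𝒯.PPlusSpace (r + 1) 1 V3) :
    ∃! μ : 𝒯.PPlusSpace r 2 Skew, 𝒯.SameDofs r μ.1 (𝒯.SPiecewise τ.1) := by
  have hτ := (mem_PPlusSpace_iff.1 τ.2).2
  have hc : ∀ T, Continuous (τ.1 T) := fun T => (PPlus.contDiff (τ.2.1 T) (n := 0)).continuous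
  have hSc : Continuous (SLin 1) :=
    have := finiteDimensional_alt (X := V3) 1
    (SLin 1).continuous_of_finiteDimensional
  obtain ⟨μ, hμ⟩ := exists_global_interpolant (𝒯 := 𝒯) hasFaceSystems_two r
    (fun f x => SLin 1 (onFace τ.1 f x)) fun T f _ =>
      hSc.comp_continuousOn (continuousOn_onFace hc f _)
  have hμ' : 𝒯.SameDofs r μ.1 (𝒯.SPiecewise τ.1) := fun l hl T v hv hvT ζ hζ =>
    (hμ T l hl v hv hvT ζ hζ).trans (hτ.simplexPairing_onFace hl (SLin 1) (fun α β w hw => by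
      rw [SLin_apply, SLin_apply, S_apply, S_apply]
      exact Finset.sum_congr rfl fun j _ => by
        rw [show j.removeNth w = fun a => w (j.succAbove a) from rfl, hw]) hv hvT ζ)
  exact ⟨μ, hμ', fun μ' h => eq_of_sameDofs hasFaceSystems_two h hμ'⟩

theorem sameDofs_proj {s : ℤ} {η : 𝒯.Piecewise k X}
    (h : ∃ ω : 𝒯.PPlusSpace s k X, 𝒯.SameDofs s ω.1 η) : 𝒯.SameDofs s (𝒯.proj s η).1 η :=
  Classical.epsilon_spec h

theorem S1h_proj {r : ℕ} {σ : V3 → Alt 1 V3} (hσ : σ ∈ SmoothForm Ω 1 V3) :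
    𝒯.S1h r (𝒯.proj (r + 1) (𝒯.ofForm σ)) =
      𝒯.proj r (𝒯.ofForm fun x => ElasticityFEM.S (σ x)) := by
  have h1 := sameDofs_proj
    (existsUnique_sameDofs_ofForm (𝒯 := 𝒯) hasFaceSystems_one (r + 1) hσ).exists
  have h2 : 𝒯.SameDofs r (𝒯.SPiecewise (𝒯.proj (r + 1) (𝒯.ofForm σ)).1)
      (𝒯.ofForm fun x => ElasticityFEM.S (σ x)) :=
    sameDofs_iff.2 fun T => (sameDofs_iff.1 h1 T).S
  refine congrArg Classical.epsilon (funext fun ω => propext ?_)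
  exact ⟨fun h l hl T v hv hvT ζ hζ => (h l hl T v hv hvT ζ hζ).trans (h2 l hl T v hv hvT ζ hζ),
    fun h l hl T v hv hvT ζ hζ =>
      (h l hl T v hv hvT ζ hζ).trans (h2 l hl T v hv hvT ζ hζ).symm⟩

/-- A right inverse of the algebraic operator `S`, followed by interpolation, is a right inverse of
`S_{1,h}`. -/
theorem S1h_surjective (r : ℕ) : Function.Surjective (𝒯.S1h r) := by
  intro μ
  have hμ := (mem_PPlusSpace_iff.1 μ.2).2
  obtain ⟨R, hR⟩ := (SLin 1).exists_rightInverse_of_surjective (LinearMap.range_eq_top.2 S_surjective)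
  have hR' : ∀ α, ElasticityFEM.S (R α) = α := fun α => LinearMap.congr_fun hR α
  have hRc : Continuous R :=
    have := finiteDimensional_alt (X := Skew) 2
    R.continuous_of_finiteDimensional
  have hc : ∀ T, Continuous (μ.1 T) := fun T => (PPlus.contDiff (μ.2.1 T) (n := 0)).continuous
  obtain ⟨τ, hτ⟩ := exists_global_interpolant (𝒯 := 𝒯) hasFaceSystems_one (r + 1)
    (fun f x => R (onFace μ.1 f x)) fun T f _ => hRc.comp_continuousOn (continuousOn_onFace hc f _)
  refine ⟨τ, ?_⟩
  have h1 := sameDofs_proj (existsUnique_sameDofs_S τ).exists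
  refine eq_of_sameDofs hasFaceSystems_two h1 fun l hl T v hv hvT ζ hζ => ?_
  have h2 := (hτ T).S l hl v hv hvT ζ hζ
  simp only [hR'] at h2
  exact (hμ.simplexPairing_onFace hl id (fun α β w hw => hw id) hv hvT ζ).symm.trans h2.symm

end Triangulation

end ElasticityFEM

theorem lemma6p1 {Ω : Set V3} (𝒯 : Triangulation Ω) (r : ℕ) :
    -- the degrees of freedom determine the projection of each smooth `𝕍`-valued 1-form
    (∀ σ ∈ SmoothForm Ω 1 V3,
      ∃! τ : 𝒯.PPlusSpace (r + 1) 1 V3, 𝒯.SameDofs (r + 1) τ.1 (𝒯.ofForm σ)) ∧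
    -- and of each smooth `𝕂`-valued 2-form
    (∀ η ∈ SmoothForm Ω 2 Skew,
      ∃! μ : 𝒯.PPlusSpace r 2 Skew, 𝒯.SameDofs r μ.1 (𝒯.ofForm η)) ∧
    -- and of `S₁ τ` for each `τ` in the discrete space, so that `S_{1,h}` is well defined
    (∀ τ : 𝒯.PPlusSpace (r + 1) 1 V3,
      ∃! μ : 𝒯.PPlusSpace r 2 Skew, 𝒯.SameDofs r μ.1 (𝒯.SPiecewise τ.1)) ∧
    -- the commutation `S_{1,h} Π̃_h¹ = Π_h² S₁` on smooth forms
    (∀ σ ∈ SmoothForm Ω 1 V3,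
      𝒯.S1h r (𝒯.proj (r + 1) (𝒯.ofForm σ)) = 𝒯.proj r (𝒯.ofForm fun x => S (σ x))) ∧
    -- surjectivity
    Function.Surjective (𝒯.S1h r) := by
  exact ⟨fun σ hσ => Triangulation.existsUnique_sameDofs_ofForm hasFaceSystems_one _ hσ,
    fun η hη => Triangulation.existsUnique_sameDofs_ofForm hasFaceSystems_two _ hη,
    Triangulation.existsUnique_sameDofs_S, fun σ hσ => Triangulation.S1h_proj hσ,
    Triangulation.S1h_surjective r⟩
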